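/- **Setting.** Let $\{x,y\}=x^0y^0-x^1y^1-x^2y^2-x^3y^3$ on $\mathbb R^4$ (and complex bilinearly on $\mathbb C^4$), let $P>0$, let $\Gamma_P^+=\{p\in\mathbb R^4:\{p,p\}=P,\ p^0>0\}$ with the Lorentz invariant measure $dM=d^3p/p^0$, and let $\Gamma_P^{(c)}=\{\zeta\in\mathbb C^4:\{\zeta,\zeta\}=P\}$. The representation of class $P_0^+$ of the proper orthochronous inhomogeneous Lorentz group on $L^2(\Gamma_P^+)$ is $U(a,A)\varphi(p)=e^{i\{p,a\}}\varphi(A^{-1}p)$. Let $\Lambda(\tau)$, $\tau\in\mathbb C$, be the velocity transform with $\Lambda(\tau)^0{}_0=\Lambda(\tau)^3{}_3=\cosh\tau$, $\Lambda(\tau)^0{}_3=\Lambda(\tau)^3{}_0=-\sinh\tau$ which fixes $x^1,x^2$, and let $\Upsilon=\mathrm{diag}(1,-1,-1,1)$. For $L=(a,I)$ put $U_L(t)=U((1-I\Lambda(t)I^{-1})a,\,I\Lambda(t)I^{-1})$ for $t\in\mathbb R$ and $j_L\varphi=U((1+I\Upsilon I^{-1})a,\,I\Upsilon I^{-1})\bar\varphi$.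 Let $U_L(\pm i\pi)$ be the closed operator obtained by analytic continuation, that is, the closure of $F(0)\mapsto F(\pm i\pi)$, where $F:\mathbb C\to L^2(\Gamma_P^+)$ runs over the entire functions with $F(t)=U_L(t)F(0)$ for all $t\in\mathbb R$. Put $s_{L,\pm}=j_LU_L(\pm i\pi)$. Let $W=\{x\in\mathbb R^4:x^3>|x^0|\}$ and $W_{(a,I)}=IW+a$. Let $K\subset\mathbb R^4$ be a region with vertices $a_1,\dots,a_n$ (extreme points of $K$) of the form $K=\bigcap_{i}\bigcap_{I\in X_{K,a_i}}\overline{W}_{(a_i,I)}$, where each $X_{K,a_i}$ is a nonempty subset of the proper orthochronous homogeneous Lorentz group that is the closure of its interior $X_{K,a_i}^\circ$. Let $X_K=\bigcup_i\{a_i\}\times X_{K,a_i}$ and $$\mathcal H^R_{K,\pm}=\{\varphi\in L^2(\Gamma_P^+): s_{L,\pm}\varphi=\varphi\ \text{ for all } L\in X_K\},$$ where $s_{L,\pm}\varphi=\varphi$ includes that $\varphi$ is in the domain of $s_{L,\pm}$. Finally let $$M^\pm_{K,a_i}=\{\zeta\in\Gamma_P^{(c)}:\zeta=I\Lambda(\tau)^{-1}I^{-1}p,\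 p\in\Gamma_P^+,\ 0<\pm\operatorname{Im}\tau<\pi,\ I\in X_{K,a_i}^\circ\}.$$ A function on $M^\pm_{K,a_i}$ is called holomorphic if it is locally the restriction of a holomorphic function on an open subset of $\mathbb C^4$. **Proposition.** For each of the two signs, a function $\varphi\in L^2(\Gamma_P^+)$ belongs to $\mathcal H^R_{K,\pm}$ if and only if for every $i=1,\dots,n$ there is a family $u_p=u_{\pm,a_i,p}$, $p\in\Gamma_P^+$, of functions on $M^\pm_{K,a_i}\cup\Gamma_P^+\cup(-\Gamma_P^+)$ such that: 1. each $u_p$ is holomorphic on $M^\pm_{K,a_i}$, and $u_p(\zeta)=e^{i\{p-q,a_i\}}u_q(\zeta)$ for all $p,q\in\Gamma_P^+$ and all $\zeta$; 2. $\varphi$ is the boundary value of the family in the sense of tempered distributions: for every $I\in X_{K,a_i}^\circ$ and every Schwartz function $\Phi$ on $\mathbb R^4$ the integral $\int_{\Gamma_P^+}u_p(I\Lambda(\tau)^{-1}I^{-1}p)\,\Phi(p)\,dM(p)$ converges absolutely for each $\tau$ with $0\le\pm\operatorname{Im}\tau\le\pi$ and is continuous in $\tau$ on this closed strip, and $u_p(p)=\varphi(p)$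 for almost every $p\in\Gamma_P^+$; 3. for every $I\in X_{K,a_i}$, for almost every $p\in\Gamma_P^+$ and $\xi=I\Upsilon I^{-1}p$, $$u_p(-\xi)=e^{i\{p,a_i\}}\,e^{i\{\xi,a_i\}}\,\overline{u_\xi(\xi)}.$$ -/

import Mathlib

open MeasureTheory Set Filter Topology

noncomputable section

namespace WignerLoc

/-! ### Minkowski space and the proper orthochronous Lorentz group -/

/-- Minkowski space (also used as momentum space), with coordinates `x 0, x 1, x 2, x 3`. -/
abbrev Mink : Type := Fin 4 → ℝ

/-- Complexified Minkowski space. -/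
abbrev MinkC : Type := Fin 4 → ℂ

/-- The Minkowski form `x⁰y⁰ - x¹y¹ - x²y² - x³y³`, over the reals or complex bilinear. -/
def form {R : Type*} [CommRing R] (x y : Fin 4 → R) : R :=
  x 0 * y 0 - x 1 * y 1 - x 2 * y 2 - x 3 * y 3

/-- The inclusion of real into complex Minkowski space. -/
def toC (x : Mink) : MinkC := fun k => (x k : ℂ)

/-- The metric tensor `g = diag(1, -1, -1, -1)`. -/
def metric : Matrix (Fin 4) (Fin 4) ℝ := Matrix.diagonal ![1, -1, -1, -1]

/-- The proper orthochronous (homogeneous) Lorentz group, with the topology induced from the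
space of real `4 × 4` matrices. An element of the proper orthochronous inhomogeneous group is a
pair `(a, I)` with `a : Mink` and `I : Lorentz`, acting by `x ↦ I x + a`. -/
abbrev Lorentz : Type :=
  {A : Matrix (Fin 4) (Fin 4) ℝ // A.transpose * metric * A = metric ∧ A.det = 1 ∧ 0 < A 0 0}

/-- The velocity transform `Λ(t)` in `x³`-direction, for real rapidity. -/
def boost (t : ℝ) : Matrix (Fin 4) (Fin 4) ℝ :=
  !![Real.cosh t, 0, 0, -Real.sinh t;
     0, 1, 0, 0;
     0, 0, 1, 0;
     -Real.sinh t, 0, 0, Real.cosh t]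

/-- The complex velocity transform `Λ(τ)` in `x³`-direction. -/
def boostC (τ : ℂ) : Matrix (Fin 4) (Fin 4) ℂ :=
  !![Complex.cosh τ, 0, 0, -Complex.sinh τ;
     0, 1, 0, 0;
     0, 0, 1, 0;
     -Complex.sinh τ, 0, 0, Complex.cosh τ]

/-- The rotation `Υ` by `π` around the `x³`-axis. -/
def rotPi : Matrix (Fin 4) (Fin 4) ℝ := Matrix.diagonal ![1, -1, -1, 1]

/-! ### The mass hyperboloid and the Hilbert space -/

/-- The mass hyperboloid `Γ_P^+`. -/
def massShell (P : ℝ) : Set Mink := {p | form p p = P ∧ 0 < p 0}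

/-- The complex mass hyperboloid `Γ_P^(c)`. -/
def massShellC (P : ℝ) : Set MinkC := {ζ | form ζ ζ = (P : ℂ)}

/-- The energy `√(P + |k|²)` of a particle with spatial momentum `k`. -/
def energy (P : ℝ) (k : Fin 3 → ℝ) : ℝ := Real.sqrt (P + ∑ i, k i ^ 2)

/-- The Lorentz invariant measure `dM = d³p / p⁰` on the mass hyperboloid, as a measure on
Minkowski space concentrated on `massShell P`. -/
def shellMeasure (P : ℝ) : Measure Mink :=
  Measure.map (fun k : Fin 3 → ℝ => (Matrix.vecCons (energy P k) k : Fin 4 → ℝ))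
    ((volume : Measure (Fin 3 → ℝ)).withDensity fun k => ENNReal.ofReal (1 / energy P k))

/-- The Hilbert space `L²(Γ_P^+)`. -/
abbrev Hilb (P : ℝ) : Type := Lp ℂ 2 (shellMeasure P)

/-! ### The representation of class `P_0^+` and the modular operators

Operators of the representation are written on functions on momentum space; on elements of
`Hilb P` they are used up to almost everywhere equality, which is legitimate because
`shellMeasure P` is Lorentz invariant. -/

/-- `U(a, A) φ (p) = e^{i{p,a}} φ(A⁻¹ p)`. -/
def rep (a : Mink) (A : Matrix (Fin 4) (Fin 4) ℝ) (φ : Mink → ℂ) : Mink → ℂ := fun p =>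
  Complex.exp (Complex.I * ((form p a : ℝ) : ℂ)) * φ (A⁻¹.mulVec p)

/-- The one-parameter group `U_L(t) = U((1 - I Λ(t) I⁻¹) a, I Λ(t) I⁻¹)`, where `L = (a, I)`. -/
def wedgeGroup (a : Mink) (I : Lorentz) (t : ℝ) (φ : Mink → ℂ) : Mink → ℂ :=
  rep ((1 - I.1 * boost t * I.1⁻¹).mulVec a) (I.1 * boost t * I.1⁻¹) φ

/-- The `PCT` operator `Θ φ = φ̄`. -/
def pct (φ : Mink → ℂ) : Mink → ℂ := fun p => (starRingEnd ℂ) (φ p)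

/-- The antiunitary involution `j_L = T((1 + I Υ I⁻¹) a) d(I Υ I⁻¹) Θ`, where `L = (a, I)`. -/
def wedgeConj (a : Mink) (I : Lorentz) (φ : Mink → ℂ) : Mink → ℂ :=
  rep ((1 + I.1 * rotPi * I.1⁻¹).mulVec a) (I.1 * rotPi * I.1⁻¹) (pct φ)

/-- The graph of the closed operator `U_L(z)`, for complex `z`: the analytic continuation
`F(0) ↦ F(z)` on the elements `F(0)` whose orbit `t ↦ U_L(t) F(0)` extends to an entire function
`F`, closed in `L²(Γ_P^+) × L²(Γ_P^+)`. -/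
def analyticGraph (P : ℝ) (a : Mink) (I : Lorentz) (z : ℂ) : Set (Hilb P × Hilb P) :=
  closure {x | ∃ F : ℂ → Hilb P, Differentiable ℂ F ∧
    (∀ t : ℝ, F (t : ℂ) =ᵐ[shellMeasure P] wedgeGroup a I t (F 0)) ∧ x = (F 0, F z)}

/-- `s_{L,σ} φ = ψ`, where `σ = ±1`, `s_{L,σ} = j_L U_L(σ i π)` and `L = (a, I)`. In particular
`φ` belongs to the domain of `s_{L,σ}`. -/
def ModularMapsTo (P : ℝ) (σ : ℤˣ) (a : Mink) (I : Lorentz) (φ ψ : Hilb P) : Prop :=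
  ∃ χ : Hilb P,
    (φ, χ) ∈ analyticGraph P a I (((σ : ℤ) : ℂ) * (Real.pi : ℂ) * Complex.I) ∧
    ψ =ᵐ[shellMeasure P] wedgeConj a I χ

/-! ### Wedges and polyhedral regions -/

/-- The wedge `W = {x | x³ > |x⁰|}`. -/
def wedge : Set Mink := {x | |x 0| < x 3}

/-- The transformed wedge `W_L = I W + a`, where `L = (a, I)`. -/
def wedgeAt (a : Mink) (I : Lorentz) : Set Mink := (fun x => I.1.mulVec x + a) '' wedge

/-- A closed region `K` with vertices `a_1, …, a_n` that is the intersection of the closed wedges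
`W_(a_i, I)` with `I` in `X i`, where each `X i` is a nonempty closed subset of the
(six-dimensional) Lorentz group that is the closure of its interior. -/
structure PolyhedralRegion (n : ℕ) where
  carrier : Set Mink
  vertex : Fin n → Mink
  X : Fin n → Set Lorentz
  vertex_mem : ∀ i, vertex i ∈ carrier.extremePoints ℝ
  X_nonempty : ∀ i, (X i).Nonempty
  X_closure_interior : ∀ i, closure (interior (X i)) = X i
  carrier_eq : carrier = ⋂ i, ⋂ I ∈ X i, closure (wedgeAt (vertex i) I)

/-- The real subspaces `H^R_{K,+}` (for `σ = 1`) and `H^R_{K,-}` (for `σ = -1`). -/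
def localizedSubspace (P : ℝ) {n : ℕ} (K : PolyhedralRegion n) (σ : ℤˣ) : Set (Hilb P) :=
  {φ | ∀ i, ∀ I ∈ K.X i, ModularMapsTo P σ (K.vertex i) I φ φ}

/-! ### The complex manifolds and holomorphic functions on them -/

/-- `I Λ(τ)⁻¹ I⁻¹ p`. -/
def orbit (I : Lorentz) (τ : ℂ) (p : Mink) : MinkC :=
  ((I.1.map Complex.ofReal) * (boostC τ)⁻¹ * (I.1.map Complex.ofReal)⁻¹).mulVec (toC p)

/-- The open strip `0 < Im τ < π` (for `σ = 1`) or `-π < Im τ < 0` (for `σ = -1`). -/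
def openStrip (σ : ℤˣ) : Set ℂ := {τ | 0 < ((σ : ℤ) : ℝ) * τ.im ∧ ((σ : ℤ) : ℝ) * τ.im < Real.pi}

/-- The closed strip `0 ≤ Im τ ≤ π` (for `σ = 1`) or `-π ≤ Im τ ≤ 0` (for `σ = -1`). -/
def closedStrip (σ : ℤˣ) : Set ℂ :=
  {τ | 0 ≤ ((σ : ℤ) : ℝ) * τ.im ∧ ((σ : ℤ) : ℝ) * τ.im ≤ Real.pi}

/-- The complex manifold `M^±_{K,a_i}`. -/
def cplxManifold (P : ℝ) {n : ℕ} (K : PolyhedralRegion n) (σ : ℤˣ) (i : Fin n) : Set MinkC :=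
  {ζ | ζ ∈ massShellC P ∧
    ∃ p ∈ massShell P, ∃ τ ∈ openStrip σ, ∃ I ∈ interior (K.X i), ζ = orbit I τ p}

/-- A function is holomorphic on a complex submanifold `M` of `ℂ⁴` if it is locally the
restriction to `M` of a function that is holomorphic on an open subset of `ℂ⁴`. -/
def HolomorphicOn (f : MinkC → ℂ) (M : Set MinkC) : Prop :=
  ∀ ζ ∈ M, ∃ U : Set MinkC, IsOpen U ∧ ζ ∈ U ∧
    ∃ g : MinkC → ℂ, DifferentiableOn ℂ g U ∧ EqOn f g (U ∩ M)

/-- The real points `Γ_P^+ ∪ (-Γ_P^+)` of the complex mass hyperboloid. -/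
def realPoints (P : ℝ) : Set MinkC := {ζ | ∃ q ∈ massShell P, ζ = toC q ∨ ζ = -toC q}

/-- `φ` is the boundary value of `u`, where `u p ζ` is a function of `ζ` in `M = M^±_{K,a_i}` and
of the boundary points `ζ` in `Γ_P^+ ∪ (-Γ_P^+)` that depends also on a reference momentum `p` in
`Γ_P^+`, in the same way as `U_L(τ) φ(p)`, for `ζ = I Λ(τ)⁻¹ I⁻¹ p`, does. The boundary values are
taken in the sense of tempered distributions on `Γ_P^+`: for each `I` in the interior of
`X_{K,a_i}` the functions `p ↦ u p (I Λ(τ)⁻¹ I⁻¹ p)` are tempered distributions that depend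
continuously on `τ` in the closed strip. -/
structure IsBoundaryValue (P : ℝ) {n : ℕ} (K : PolyhedralRegion n) (σ : ℤˣ) (i : Fin n)
    (u : Mink → MinkC → ℂ) (φ : Hilb P) : Prop where
  holomorphic : ∀ p ∈ massShell P, HolomorphicOn (u p) (cplxManifold P K σ i)
  phase : ∀ p ∈ massShell P, ∀ q ∈ massShell P, ∀ ζ ∈ cplxManifold P K σ i ∪ realPoints P,
    u p ζ = Complex.exp (Complex.I * ((form (p - q) (K.vertex i) : ℝ) : ℂ)) * u q ζ
  integrable : ∀ I ∈ interior (K.X i), ∀ Φ : SchwartzMap Mink ℂ, ∀ τ ∈ closedStrip σ,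
    Integrable (fun p => u p (orbit I τ p) * Φ p) (shellMeasure P)
  continuousOn : ∀ I ∈ interior (K.X i), ∀ Φ : SchwartzMap Mink ℂ,
    ContinuousOn (fun τ => ∫ p, u p (orbit I τ p) * Φ p ∂(shellMeasure P)) (closedStrip σ)
  boundary : ∀ᵐ p ∂(shellMeasure P), u p (toC p) = φ p

/-- The boundary condition `u(-ξ) = e^{i{p,a_i}} e^{i{ξ,a_i}} ū(ξ)` for all
`ξ = I Υ I⁻¹ p` with `p` in `Γ_P^+` and `I` in `X_{K,a_i}`. On the left `u` carries the reference
momentum `p`; `u(ξ)` is the value of `u` at the undisplaced point `ξ` (`τ = 0`), whose reference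
momentum is `ξ` itself. -/
def BoundaryCondition (P : ℝ) {n : ℕ} (K : PolyhedralRegion n) (i : Fin n)
    (u : Mink → MinkC → ℂ) : Prop :=
  ∀ I ∈ K.X i, ∀ᵐ p ∂(shellMeasure P), ∀ ξ : Mink, ξ = (I.1 * rotPi * I.1⁻¹).mulVec p →
    u p (-toC ξ) =
      Complex.exp (Complex.I * ((form p (K.vertex i) : ℝ) : ℂ)) *
        Complex.exp (Complex.I * ((form ξ (K.vertex i) : ℝ) : ℂ)) * (starRingEnd ℂ) (u ξ (toC ξ))

end WignerLoc

end

/-! Multiplication by e^{-i{p,a}}, a = a_i, removes the translations: U_L(t) becomes composition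
with a boost and j_L becomes complex conjugation followed by composition with IΥI⁻¹. As j_L is an
involution, s_{L,σ}φ = φ says that (φ, j_Lφ) lies in the graph of U_L(σiπ) (`modularMapsTo_iff`).
Replacing z by σz puts both signs on the strip 0 ≤ Im z ≤ π. Write ψ = e^{-i{·,a}}φ.

From boundary values to invariance. For I in the interior of X, the phase rule turns u into a family
f(τ,p) that interpolates between ψ and its conjugate composed with IΥI⁻¹. Integrated against a test
function it is holomorphic in the strip and continuous up to the edges, where it is bounded by L²
norms. Inside the strip no bound in Re τ is given; a real shift of τ boosts the test function, and
uniform boundedness on ℓ¹ superpositions of boosted test functions yields growth C exp((Re τ)²)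
(`exists_growth_bound`). This is admissible for Phragmén–Lindelöf, so the function is bounded, and a
Gaussian contour shift gives ∫ g_m(t-iπ) V_t ψ dt = ∫ g_m(t) V_t χ dt (`StripFamily.gauss_eq`),
where χ is the upper edge. Gaussian averages are entire vectors and approximate the identity, so
this identity for all m puts the pair into the closed graph (`mem_closure_entireGraph`). The
identity is closed in I, and X is the closure of its interior, hence it holds on all of X.

From invariance to boundary values. The graph condition yields, for each I, an L²-valued holomorphic
F_I on the strip with F_I(0) = ψ (`exists_modularOrbit`). One needs a function v on the complex
manifold with v(IΛ(στ)⁻¹I⁻¹p) = F_I(τ)(p) for almost every p, independent of how the point is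
represented, and holomorphic.

Pointwise values come from pairing with the vectors e_ζ(q) = e^{-{ζ,q}}, which depend
holomorphically on ζ in the tube where Re ζ lies in the forward cone. The kernels e^{-b{p,q}},
normalized, are Lorentz invariant contractions that tend to the identity as b → ∞ (`tendsto_reg`).
Set h(τ,ζ) = ⟨e_{IΛ(στ)I⁻¹ζ}, F_I(τ)⟩ (`contVal`). It is holomorphic in τ and unchanged by real
shifts of τ, so it is locally constant in τ, and at τ = 0 it equals ⟨e_ζ, ψ⟩ for every I. Thus all
F_I continue one and the same function of ζ, and the identity theorem along an orbit compares two
wedges as long as both stay in the tube (`contVal_eq_of_path`). For two representations of one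
point, an explicit choice of angle keeps the path in the tube (`pairing_eq_of_orbit_eq`).

For holomorphy, a neighbourhood in the three-dimensional complex mass shell is parametrized by a
real momentum k and three real parameters s, namely two rotations of the wedge and the angle Im τ.
For fixed s the k-integral of |reg_m F - reg_n F|² tends to zero by strong convergence, with a bound
uniform in s; Fubini and dominated convergence make the regularizations Cauchy in L² of a polydisc,
and the sub-mean value property upgrades this to locally uniform convergence to a holomorphic limit
(`exists_local_limit`). Extending v by ψ on Γ and by its conjugate on -Γ gives the boundary
condition. -/

noncomputable section

namespace WignerLoc

/-! ### Form-preserving matrices and the forward cone -/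

section Form

variable {R : Type*} [CommRing R]

/-- A matrix that preserves the Minkowski form. -/
def PresForm (A : Matrix (Fin 4) (Fin 4) R) : Prop :=
  ∀ x y : Fin 4 → R, form (A.mulVec x) (A.mulVec y) = form x y

lemma form_comm (x y : Fin 4 → R) : form x y = form y x := by
  simp only [form]; ring

lemma form_add_left (x y z : Fin 4 → R) : form (x + y) z = form x z + form y z := by
  simp only [form, Pi.add_apply]; ring

lemma form_sub_left (x y z : Fin 4 → R) : form (x - y) z = form x z - form y z := by
  simp only [form, Pi.sub_apply]; ring

lemma form_sub_right (x y z : Fin 4 → R) : form x (y - z) = form x y - form x z := by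
  simp only [form, Pi.sub_apply]; ring

lemma form_add_right (x y z : Fin 4 → R) : form x (y + z) = form x y + form x z := by
  simp only [form, Pi.add_apply]; ring

lemma form_neg_neg (x y : Fin 4 → R) : form (-x) (-y) = form x y := by
  simp only [form, Pi.neg_apply]; ring

lemma form_neg_left (x y : Fin 4 → R) : form (-x) y = - form x y := by
  simp only [form, Pi.neg_apply]; ring

lemma form_smul_left (c : R) (x y : Fin 4 → R) : form (c • x) y = c * form x y := by
  simp only [form, Pi.smul_apply, smul_eq_mul]; ring

lemma form_smul_right (c : R) (x y : Fin 4 → R) : form x (c • y) = c * form x y := by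
  simp only [form, Pi.smul_apply, smul_eq_mul]; ring

lemma form_eq_dotProduct (x y : Fin 4 → R) :
    form x y = x ⬝ᵥ (Matrix.diagonal ![1, -1, -1, -1]).mulVec y := by
  simp [form, dotProduct, Fin.sum_univ_four, Matrix.mulVec_diagonal]
  ring

lemma presForm_iff {A : Matrix (Fin 4) (Fin 4) R} :
    PresForm A ↔ A.transpose * Matrix.diagonal ![1, -1, -1, -1] * A =
      Matrix.diagonal ![1, -1, -1, -1] := by
  have key : ∀ x y : Fin 4 → R, form (A.mulVec x) (A.mulVec y) =
      x ⬝ᵥ (A.transpose * Matrix.diagonal ![1, -1, -1, -1] * A).mulVec y := by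
    intro x y
    rw [form_eq_dotProduct, ← Matrix.vecMul_transpose, ← Matrix.dotProduct_mulVec]
    simp only [Matrix.mulVec_mulVec, Matrix.mul_assoc]
  constructor
  · intro h
    ext i j
    have := h (Pi.single i 1) (Pi.single j 1)
    rw [key, form_eq_dotProduct] at this
    simp only [Matrix.mulVec_single_one, single_one_dotProduct] at this
    exact this
  · intro h x y
    rw [key, h, form_eq_dotProduct]

lemma PresForm.mul {A B : Matrix (Fin 4) (Fin 4) R} (hA : PresForm A) (hB : PresForm B) :
    PresForm (A * B) := fun x y => by
  rw [← Matrix.mulVec_mulVec, ← Matrix.mulVec_mulVec, hA, hB]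

lemma PresForm.inv_mul {A B : Matrix (Fin 4) (Fin 4) R} (hA : PresForm A) (h : A * B = 1) :
    PresForm B := fun x y => by
  rw [← hA (B.mulVec x) (B.mulVec y)]
  simp [Matrix.mulVec_mulVec, h]

end Form

/-- The open forward cone. -/
def fwd : Set Mink := {x | 0 < form x x ∧ 0 < x 0}

/-- A real matrix that preserves the Minkowski form and the forward cone. -/
structure Ortho (A : Matrix (Fin 4) (Fin 4) ℝ) : Prop where
  pres : PresForm A
  fwd : ∀ x ∈ fwd, A.mulVec x ∈ fwd

/-- The Euclidean length of the spatial part. -/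
def spatialNorm (x : Mink) : ℝ := √(x 1 ^ 2 + x 2 ^ 2 + x 3 ^ 2)

lemma spatialNorm_nonneg (x : Mink) : 0 ≤ spatialNorm x := Real.sqrt_nonneg _

lemma spatialNorm_sq (x : Mink) : spatialNorm x ^ 2 = x 1 ^ 2 + x 2 ^ 2 + x 3 ^ 2 :=
  Real.sq_sqrt (by positivity)

lemma form_self_eq (x : Mink) : form x x = x 0 ^ 2 - spatialNorm x ^ 2 := by
  rw [spatialNorm_sq, form]; ring

lemma continuous_spatialNorm : Continuous spatialNorm := by
  unfold spatialNorm; fun_prop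

lemma mem_fwd_iff {x : Mink} : x ∈ fwd ↔ spatialNorm x < x 0 := by
  have h := spatialNorm_nonneg x
  constructor
  · rintro ⟨h1, h2⟩
    rw [form_self_eq] at h1
    nlinarith
  · intro h1
    refine ⟨?_, by linarith⟩
    rw [form_self_eq]
    nlinarith

lemma isOpen_fwd : IsOpen fwd := by
  have : fwd = {x | spatialNorm x < x 0} := by ext x; exact mem_fwd_iff
  rw [this]
  exact isOpen_lt continuous_spatialNorm (continuous_apply 0)

/-- Cauchy–Schwarz for the spatial parts. For x in the forward cone the factor x⁰ - |x| is positive;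
it is the exponential decay rate of e^{-{x,q}} on the mass shell used throughout. -/
lemma le_form {x q : Mink} (hq : spatialNorm q ≤ q 0) :
    (x 0 - spatialNorm x) * q 0 ≤ form x q := by
  have h : x 1 * q 1 + x 2 * q 2 + x 3 * q 3 ≤ spatialNorm x * spatialNorm q := by
    rw [spatialNorm, spatialNorm, ← Real.sqrt_mul (by positivity)]
    apply Real.le_sqrt_of_sq_le
    nlinarith [sq_nonneg (x 1 * q 2 - x 2 * q 1), sq_nonneg (x 1 * q 3 - x 3 * q 1),
      sq_nonneg (x 2 * q 3 - x 3 * q 2)]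
  have := mul_le_mul_of_nonneg_left hq (spatialNorm_nonneg x)
  rw [form]
  linarith

lemma form_pos {x q : Mink} (hx : x ∈ fwd) (hq : q ∈ fwd) : 0 < form x q := by
  have h1 := mem_fwd_iff.1 hx
  have h2 := mem_fwd_iff.1 hq
  exact lt_of_lt_of_le (mul_pos (by linarith) hq.2) (le_form h2.le)

/-- A timelike vector is forward or backward, and the sign of its product with one forward vector
decides which. -/
lemma mem_fwd_of_form {x n : Mink} (hn : n ∈ fwd) (h : 0 < form x x) (h' : 0 < form x n) :
    x ∈ fwd := by
  refine ⟨h, ?_⟩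
  by_contra h0
  have h1 : -x ∈ fwd := by
    refine ⟨by rwa [form_neg_neg], ?_⟩
    rcases lt_or_eq_of_le (not_lt.1 h0) with h2 | h2
    · simpa using h2
    · rw [form_self_eq, h2] at h
      nlinarith [sq_nonneg (spatialNorm x)]
  have := form_pos h1 hn
  rw [form_neg_left] at this
  linarith

lemma massShell_subset_fwd {P : ℝ} (hP : 0 < P) : massShell P ⊆ fwd := fun p hp =>
  ⟨by rw [hp.1]; exact hP, hp.2⟩

lemma Ortho.mul {A B : Matrix (Fin 4) (Fin 4) ℝ} (hA : Ortho A) (hB : Ortho B) :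
    Ortho (A * B) :=
  ⟨hA.pres.mul hB.pres, fun x hx => by
    rw [← Matrix.mulVec_mulVec]; exact hA.fwd _ (hB.fwd _ hx)⟩

lemma Ortho.inv_mul {A B : Matrix (Fin 4) (Fin 4) ℝ} (hA : Ortho A) (h : A * B = 1) :
    Ortho B := by
  have hB := hA.pres.inv_mul h
  have e : ∀ x, A.mulVec (B.mulVec x) = x := fun x => by simp [Matrix.mulVec_mulVec, h]
  refine ⟨hB, fun x hx => ?_⟩
  have h1 : 0 < form (B.mulVec x) (B.mulVec x) := by rw [hB]; exact hx.1
  refine ⟨h1, ?_⟩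
  by_contra h0
  have h2 : -(B.mulVec x) ∈ WignerLoc.fwd := by
    refine ⟨by rwa [form_neg_neg], ?_⟩
    rcases lt_or_eq_of_le (not_lt.1 h0) with h2 | h2
    · simpa using h2
    · rw [form_self_eq, h2] at h1
      nlinarith [sq_nonneg (spatialNorm (B.mulVec x))]
  have h3 := (hA.fwd _ h2).2
  rw [Matrix.mulVec_neg, e] at h3
  have := hx.2
  simp at h3
  linarith

lemma Ortho.massShell {P : ℝ} (hP : 0 < P) {A : Matrix (Fin 4) (Fin 4) ℝ} (hA : Ortho A)
    {p : Mink} (hp : p ∈ massShell P) : A.mulVec p ∈ massShell P :=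
  ⟨by rw [hA.pres]; exact hp.1, (hA.fwd _ (massShell_subset_fwd hP hp)).2⟩

lemma Lorentz.mul_inv (I : Lorentz) : I.1 * I.1⁻¹ = 1 :=
  Matrix.mul_nonsing_inv _ (by rw [I.2.2.1]; exact isUnit_one)

lemma Lorentz.inv_mul (I : Lorentz) : I.1⁻¹ * I.1 = 1 :=
  Matrix.nonsing_inv_mul _ (by rw [I.2.2.1]; exact isUnit_one)

lemma Lorentz.ortho (I : Lorentz) : Ortho I.1 := by
  have hI : I.1.transpose * Matrix.diagonal ![1, -1, -1, -1] * I.1 =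
      Matrix.diagonal ![1, -1, -1, -1] := I.2.1
  have hp : PresForm I.1 := presForm_iff.2 hI
  refine ⟨hp, fun x hx => ⟨by rw [hp]; exact hx.1, ?_⟩⟩
  set G : Matrix (Fin 4) (Fin 4) ℝ := Matrix.diagonal ![1, -1, -1, -1] with hG
  have hGG : G * G = 1 := by
    rw [hG, Matrix.diagonal_mul_diagonal, ← Matrix.diagonal_one]
    congr 1; ext i; fin_cases i <;> simp
  have h1 : (G * I.1.transpose * G) * I.1 = 1 := by
    rw [Matrix.mul_assoc, Matrix.mul_assoc, ← Matrix.mul_assoc _ G, hI, hGG]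
  have h2 : I.1 * (G * I.1.transpose * G) = 1 := mul_eq_one_comm.1 h1
  have h3 : I.1 * G * I.1.transpose = G := by
    calc I.1 * G * I.1.transpose = I.1 * (G * I.1.transpose * G) * G := by
          simp only [Matrix.mul_assoc, hGG, Matrix.mul_one]
      _ = G := by rw [h2, Matrix.one_mul]
  have h4 := congrFun (congrFun h3 0) 0
  simp [Matrix.mul_apply, Fin.sum_univ_four, hG, Matrix.diagonal_apply] at h4
  -- The time component of I x is the Minkowski product of x with the first row of I, spatial signs
  -- flipped. That row is timelike by I G Iᵀ = G, and forward because I₀₀ > 0.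
  have hr : (![I.1 0 0, -I.1 0 1, -I.1 0 2, -I.1 0 3] : Mink) ∈ fwd := by
    refine ⟨?_, I.2.2.2⟩
    simp [form]
    linarith
  have := form_pos hr hx
  simp [form] at this
  simp [Matrix.mulVec, dotProduct, Fin.sum_univ_four]
  linarith

lemma Lorentz.ortho_inv (I : Lorentz) : Ortho I.1⁻¹ := I.ortho.inv_mul I.mul_inv

lemma ortho_boost (t : ℝ) : Ortho (boost t) := by
  have hp : PresForm (boost t) := by
    intro x y
    have := Real.cosh_sq t
    simp [form, boost, Matrix.mulVec, dotProduct, Fin.sum_univ_four]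
    linear_combination (x 0 * y 0 - x 3 * y 3) * this
  refine ⟨hp, fun x hx => ⟨by rw [hp]; exact hx.1, ?_⟩⟩
  have hr : (![Real.cosh t, 0, 0, Real.sinh t] : Mink) ∈ fwd := by
    refine ⟨?_, Real.cosh_pos t⟩
    have := Real.cosh_sq t
    simp [form]
    linarith
  have := form_pos hr hx
  simp [form] at this
  simp [boost, Matrix.mulVec, dotProduct, Fin.sum_univ_four]
  linarith

lemma ortho_rotPi : Ortho rotPi := by
  have hp : PresForm rotPi := by
    intro x y
    simp [form, rotPi, Matrix.mulVec_diagonal]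
  refine ⟨hp, fun x hx => ⟨by rw [hp]; exact hx.1, ?_⟩⟩
  simpa [rotPi, Matrix.mulVec_diagonal] using hx.2

/-! ### Boosts and rotations in the frame of a Lorentz transformation -/

/-- `I Λ(t) I⁻¹`. -/
def wedgeBoost (I : Lorentz) (t : ℝ) : Matrix (Fin 4) (Fin 4) ℝ := I.1 * boost t * I.1⁻¹

/-- `I Υ I⁻¹`. -/
def wedgeRot (I : Lorentz) : Matrix (Fin 4) (Fin 4) ℝ := I.1 * rotPi * I.1⁻¹

/-- `I Λ(τ) I⁻¹` for complex `τ`. -/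
def wedgeBoostC (I : Lorentz) (τ : ℂ) : Matrix (Fin 4) (Fin 4) ℂ :=
  I.1.map Complex.ofReal * boostC τ * I.1⁻¹.map Complex.ofReal

lemma map_mul_map (A B : Matrix (Fin 4) (Fin 4) ℝ) :
    A.map Complex.ofReal * B.map Complex.ofReal = (A * B).map Complex.ofReal := by
  ext i j
  simp [Matrix.mul_apply]

lemma map_one_ofReal : (1 : Matrix (Fin 4) (Fin 4) ℝ).map Complex.ofReal = 1 := by
  ext i j
  by_cases h : i = j <;> simp [Matrix.one_apply, h]

lemma boost_add (s t : ℝ) : boost (s + t) = boost s * boost t := by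
  ext i j
  fin_cases i <;> fin_cases j <;>
    simp [boost, Matrix.mul_apply, Fin.sum_univ_four, Real.cosh_add, Real.sinh_add] <;> ring

lemma boost_zero : boost 0 = 1 := by
  ext i j
  fin_cases i <;> fin_cases j <;> simp [boost]

lemma boostC_add (s t : ℂ) : boostC (s + t) = boostC s * boostC t := by
  ext i j
  fin_cases i <;> fin_cases j <;>
    simp [boostC, Matrix.mul_apply, Fin.sum_univ_four, Complex.cosh_add, Complex.sinh_add] <;> ring

lemma boostC_zero : boostC 0 = 1 := by
  ext i j
  fin_cases i <;> fin_cases j <;> simp [boostC]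

lemma boostC_ofReal (t : ℝ) : boostC t = (boost t).map Complex.ofReal := by
  ext i j
  fin_cases i <;> fin_cases j <;> simp [boostC, boost]

lemma boostC_pi : boostC (Real.pi * Complex.I) = -(rotPi.map Complex.ofReal) := by
  ext i j
  fin_cases i <;> fin_cases j <;>
    simp [boostC, rotPi, Complex.cosh_mul_I, Complex.sinh_mul_I]

lemma boostC_neg_pi : boostC (-(Real.pi * Complex.I)) = -(rotPi.map Complex.ofReal) := by
  ext i j
  fin_cases i <;> fin_cases j <;>
    simp [boostC, rotPi, Complex.cosh_mul_I, Complex.sinh_mul_I]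

lemma boostC_inv (τ : ℂ) : (boostC τ)⁻¹ = boostC (-τ) :=
  Matrix.inv_eq_left_inv (by rw [← boostC_add, neg_add_cancel, boostC_zero])

lemma Lorentz.map_inv (I : Lorentz) :
    (I.1.map Complex.ofReal)⁻¹ = I.1⁻¹.map Complex.ofReal :=
  Matrix.inv_eq_left_inv (by rw [map_mul_map, I.inv_mul, map_one_ofReal])

lemma orbit_eq (I : Lorentz) (τ : ℂ) (p : Mink) :
    orbit I τ p = (wedgeBoostC I (-τ)).mulVec (toC p) := by
  rw [orbit, boostC_inv, I.map_inv, wedgeBoostC]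

lemma wedgeBoostC_add (I : Lorentz) (s t : ℂ) :
    wedgeBoostC I (s + t) = wedgeBoostC I s * wedgeBoostC I t := by
  have : I.1⁻¹.map Complex.ofReal * I.1.map Complex.ofReal = 1 := by
    rw [map_mul_map, I.inv_mul, map_one_ofReal]
  simp only [wedgeBoostC, boostC_add, Matrix.mul_assoc]
  rw [← Matrix.mul_assoc (I.1⁻¹.map Complex.ofReal), this, Matrix.one_mul]

lemma wedgeBoostC_zero (I : Lorentz) : wedgeBoostC I 0 = 1 := by
  rw [wedgeBoostC, boostC_zero, Matrix.mul_one, map_mul_map, I.mul_inv, map_one_ofReal]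

lemma wedgeBoostC_ofReal (I : Lorentz) (t : ℝ) :
    wedgeBoostC I t = (wedgeBoost I t).map Complex.ofReal := by
  rw [wedgeBoostC, boostC_ofReal, map_mul_map, map_mul_map, wedgeBoost]

lemma wedgeBoostC_pi (I : Lorentz) :
    wedgeBoostC I (Real.pi * Complex.I) = -((wedgeRot I).map Complex.ofReal) := by
  rw [wedgeBoostC, boostC_pi, Matrix.mul_neg, Matrix.neg_mul, map_mul_map, map_mul_map, wedgeRot]

lemma wedgeBoostC_neg_pi (I : Lorentz) :
    wedgeBoostC I (-(Real.pi * Complex.I)) = -((wedgeRot I).map Complex.ofReal) := by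
  rw [wedgeBoostC, boostC_neg_pi, Matrix.mul_neg, Matrix.neg_mul, map_mul_map, map_mul_map,
    wedgeRot]

lemma wedgeBoost_add (I : Lorentz) (s t : ℝ) :
    wedgeBoost I (s + t) = wedgeBoost I s * wedgeBoost I t := by
  simp only [wedgeBoost, boost_add, Matrix.mul_assoc]
  rw [← Matrix.mul_assoc I.1⁻¹, I.inv_mul, Matrix.one_mul]

lemma wedgeBoost_zero (I : Lorentz) : wedgeBoost I 0 = 1 := by
  rw [wedgeBoost, boost_zero, Matrix.mul_one, I.mul_inv]

lemma wedgeBoost_mul_neg (I : Lorentz) (t : ℝ) : wedgeBoost I t * wedgeBoost I (-t) = 1 := by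
  rw [← wedgeBoost_add, add_neg_cancel, wedgeBoost_zero]

lemma wedgeBoost_inv (I : Lorentz) (t : ℝ) : (wedgeBoost I t)⁻¹ = wedgeBoost I (-t) :=
  Matrix.inv_eq_right_inv (wedgeBoost_mul_neg I t)

lemma rotPi_mul_self : rotPi * rotPi = 1 := by
  ext i j
  fin_cases i <;> fin_cases j <;> simp [rotPi]

lemma wedgeRot_mul_self (I : Lorentz) : wedgeRot I * wedgeRot I = 1 := by
  simp only [wedgeRot, Matrix.mul_assoc]
  rw [← Matrix.mul_assoc I.1⁻¹, I.inv_mul, Matrix.one_mul, ← Matrix.mul_assoc rotPi,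
    rotPi_mul_self, Matrix.one_mul, I.mul_inv]

lemma wedgeRot_inv (I : Lorentz) : (wedgeRot I)⁻¹ = wedgeRot I :=
  Matrix.inv_eq_right_inv (wedgeRot_mul_self I)

lemma ortho_wedgeBoost (I : Lorentz) (t : ℝ) : Ortho (wedgeBoost I t) :=
  (I.ortho.mul (ortho_boost t)).mul I.ortho_inv

lemma ortho_wedgeRot (I : Lorentz) : Ortho (wedgeRot I) :=
  (I.ortho.mul ortho_rotPi).mul I.ortho_inv

lemma presForm_map {A : Matrix (Fin 4) (Fin 4) ℝ} (hA : PresForm A) :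
    PresForm (A.map Complex.ofReal) := by
  rw [presForm_iff] at hA ⊢
  have h : (Matrix.diagonal ![1, -1, -1, -1] : Matrix (Fin 4) (Fin 4) ℂ) =
      (Matrix.diagonal ![1, -1, -1, -1] : Matrix (Fin 4) (Fin 4) ℝ).map Complex.ofReal := by
    ext i j
    fin_cases i <;> fin_cases j <;> simp
  rw [h, ← Matrix.transpose_map, map_mul_map, map_mul_map, hA]

lemma presForm_boostC (τ : ℂ) : PresForm (boostC τ) := by
  intro x y
  have := Complex.cosh_sq τ
  simp [form, boostC, Matrix.mulVec, dotProduct, Fin.sum_univ_four]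
  linear_combination (x 0 * y 0 - x 3 * y 3) * this

lemma presForm_wedgeBoostC (I : Lorentz) (τ : ℂ) : PresForm (wedgeBoostC I τ) :=
  ((presForm_map I.ortho.pres).mul (presForm_boostC τ)).mul (presForm_map I.ortho_inv.pres)

lemma toC_mulVec (A : Matrix (Fin 4) (Fin 4) ℝ) (x : Mink) :
    toC (A.mulVec x) = (A.map Complex.ofReal).mulVec (toC x) := by
  ext i
  simp [toC, Matrix.mulVec, dotProduct]

lemma form_toC (x y : Mink) : form (toC x) (toC y) = ((form x y : ℝ) : ℂ) := by
  simp [form, toC]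

/-- The real part of a complex vector. -/
def reV (ζ : MinkC) : Mink := fun k => (ζ k).re

/-- The imaginary part of a complex vector. -/
def imV (ζ : MinkC) : Mink := fun k => (ζ k).im

lemma reV_toC (x : Mink) : reV (toC x) = x := rfl

lemma continuous_reV : Continuous reV := by
  unfold reV; fun_prop

lemma reV_map_mulVec (A : Matrix (Fin 4) (Fin 4) ℝ) (ζ : MinkC) :
    reV ((A.map Complex.ofReal).mulVec ζ) = A.mulVec (reV ζ) := by
  ext i
  simp [reV, Matrix.mulVec, dotProduct]

lemma orbit_ofReal (I : Lorentz) (t : ℝ) (p : Mink) :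
    orbit I t p = toC ((wedgeBoost I (-t)).mulVec p) := by
  rw [orbit_eq, toC_mulVec, ← wedgeBoostC_ofReal, Complex.ofReal_neg]

/-- The real part of τ can be absorbed into the momentum by a real boost, so only purely imaginary
parameters need separate study. -/
lemma orbit_add (I : Lorentz) (τ : ℂ) (t : ℝ) (p : Mink) :
    orbit I (τ + t) p = orbit I τ ((wedgeBoost I (-t)).mulVec p) := by
  rw [orbit_eq, orbit_eq, toC_mulVec, ← wedgeBoostC_ofReal, Matrix.mulVec_mulVec,
    ← wedgeBoostC_add]
  push_cast
  congr 2
  ring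

/-- Since cosh(±iπ) = -1 and sinh(±iπ) = 0, Λ(±iπ) = -Υ; for either sign the far edge of the strip
lands on the negative mass shell at the rotated momentum. -/
lemma orbit_pi (I : Lorentz) (σ : ℤˣ) (p : Mink) :
    orbit I (((σ : ℤ) : ℂ) * Real.pi * Complex.I) p = -toC ((wedgeRot I).mulVec p) := by
  rw [orbit_eq, toC_mulVec]
  rcases Int.units_eq_one_or σ with h | h
  · subst h
    simp [wedgeBoostC_neg_pi, Matrix.neg_mulVec]
  · subst h
    simp [wedgeBoostC_pi, Matrix.neg_mulVec]

lemma orbit_mem_massShellC {P : ℝ} (I : Lorentz) (τ : ℂ) {p : Mink} (hp : p ∈ massShell P) :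
    orbit I τ p ∈ massShellC P := by
  change form _ _ = _
  rw [orbit_eq, presForm_wedgeBoostC, form_toC, hp.1]

/-! ### The invariant measure on the mass shell -/

/-- The parametrization of the mass shell by the spatial momentum. -/
def shellPoint (P : ℝ) (k : Fin 3 → ℝ) : Mink := Matrix.vecCons (energy P k) k

lemma energy_sq {P : ℝ} (hP : 0 < P) (k : Fin 3 → ℝ) :
    energy P k ^ 2 = P + (k 0 ^ 2 + k 1 ^ 2 + k 2 ^ 2) := by
  rw [energy, Real.sq_sqrt (by positivity), Fin.sum_univ_three]

lemma energy_pos {P : ℝ} (hP : 0 < P) (k : Fin 3 → ℝ) : 0 < energy P k :=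
  Real.sqrt_pos.2 (by positivity)

lemma continuous_energy (P : ℝ) : Continuous (energy P) := by
  unfold energy; fun_prop

lemma continuous_shellPoint (P : ℝ) : Continuous (shellPoint P) := by
  refine continuous_pi fun i => ?_
  refine Fin.cases ?_ (fun j => ?_) i
  · exact continuous_energy P
  · exact continuous_apply j

lemma shellPoint_mem {P : ℝ} (hP : 0 < P) (k : Fin 3 → ℝ) : shellPoint P k ∈ massShell P := by
  refine ⟨?_, energy_pos hP k⟩
  have := energy_sq hP k
  change energy P k * energy P k - k 0 * k 0 - k 1 * k 1 - k 2 * k 2 = P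
  linarith

lemma shellPoint_tail {P : ℝ} (hP : 0 < P) {p : Mink} (hp : p ∈ massShell P) :
    shellPoint P (fun i => p i.succ) = p := by
  ext i
  refine Fin.cases ?_ (fun j => ?_) i
  · change energy P _ = p 0
    have h := hp.1
    have h1 : energy P (fun i => p i.succ) ^ 2 = p 0 ^ 2 := by
      rw [energy_sq hP]
      simp only [form] at h
      change P + (p 1 ^ 2 + p 2 ^ 2 + p 3 ^ 2) = _
      linarith
    exact (pow_left_inj₀ (energy_pos hP _).le hp.2.le two_ne_zero).1 h1
  · rfl

lemma measurableSet_massShell (P : ℝ) : MeasurableSet (massShell P) := by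
  have h1 : Measurable fun p : Mink => form p p := by unfold form; fun_prop
  exact (h1 (measurableSet_singleton P)).inter
    ((measurable_pi_apply (0 : Fin 4)) measurableSet_Ioi)

lemma shellMeasure_eq (P : ℝ) : shellMeasure P = Measure.map (shellPoint P)
    ((volume : Measure (Fin 3 → ℝ)).withDensity fun k => ENNReal.ofReal (1 / energy P k)) := rfl

lemma ae_mem_massShell {P : ℝ} (hP : 0 < P) : ∀ᵐ p ∂(shellMeasure P), p ∈ massShell P := by
  rw [shellMeasure_eq]
  exact (ae_map_iff (continuous_shellPoint P).measurable.aemeasurable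
    (measurableSet_massShell P)).2 (Eventually.of_forall (shellPoint_mem hP))

lemma measurable_density (P : ℝ) :
    Measurable fun k : Fin 3 → ℝ => ENNReal.ofReal (1 / energy P k) :=
  ((continuous_energy P).measurable.const_div 1).ennreal_ofReal

lemma lintegral_shellMeasure (P : ℝ) {f : Mink → ENNReal} (hf : Measurable f) :
    ∫⁻ p, f p ∂(shellMeasure P) =
      ∫⁻ k, ENNReal.ofReal (1 / energy P k) * f (shellPoint P k) := by
  rw [shellMeasure_eq, lintegral_map hf (continuous_shellPoint P).measurable]
  exact lintegral_withDensity_eq_lintegral_mul _ (measurable_density P)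
    (hf.comp (continuous_shellPoint P).measurable)

/-- The action of a matrix on spatial momenta. -/
def shellMap (P : ℝ) (A : Matrix (Fin 4) (Fin 4) ℝ) (k : Fin 3 → ℝ) : Fin 3 → ℝ :=
  fun i => A.mulVec (shellPoint P k) i.succ

lemma shellPoint_shellMap {P : ℝ} (hP : 0 < P) {A : Matrix (Fin 4) (Fin 4) ℝ} (hA : Ortho A)
    (k : Fin 3 → ℝ) : shellPoint P (shellMap P A k) = A.mulVec (shellPoint P k) :=
  shellPoint_tail hP (hA.massShell hP (shellPoint_mem hP k))

/-- The Jacobian matrix of `shellMap`. -/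
def shellJac (P : ℝ) (A : Matrix (Fin 4) (Fin 4) ℝ) (k : Fin 3 → ℝ) :
    Matrix (Fin 3) (Fin 3) ℝ :=
  Matrix.of fun i j => A i.succ 0 * (k j / energy P k) + A i.succ j.succ

lemma hasFDerivAt_energy {P : ℝ} (hP : 0 < P) (k : Fin 3 → ℝ) :
    HasFDerivAt (energy P)
      (∑ j, (k j / energy P k) • (ContinuousLinearMap.proj j : (Fin 3 → ℝ) →L[ℝ] ℝ)) k := by
  have h1 : HasFDerivAt (fun k : Fin 3 → ℝ => P + ∑ i, k i ^ 2)
      (∑ j, (2 * k j) • (ContinuousLinearMap.proj j : (Fin 3 → ℝ) →L[ℝ] ℝ)) k := by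
    refine HasFDerivAt.const_add P (HasFDerivAt.fun_sum fun i _ => ?_)
    have := (hasFDerivAt_apply (𝕜 := ℝ) i k).pow 2
    simpa using this
  have h2 := h1.sqrt (by positivity)
  convert! h2 using 1
  rw [Finset.smul_sum]
  refine Finset.sum_congr rfl fun j _ => ?_
  rw [smul_smul]
  congr 1
  change _ = 1 / (2 * energy P k) * (2 * k j)
  have := (energy_pos hP k).ne'
  field_simp

lemma hasFDerivAt_shellMap {P : ℝ} (hP : 0 < P) (A : Matrix (Fin 4) (Fin 4) ℝ)
    (k : Fin 3 → ℝ) :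
    HasFDerivAt (shellMap P A) (Matrix.toLin' (shellJac P A k)).toContinuousLinearMap k := by
  rw [hasFDerivAt_pi']
  intro i
  have h1 : HasFDerivAt (fun k => A i.succ 0 * energy P k + ∑ j : Fin 3, A i.succ j.succ * k j)
      (A i.succ 0 • (∑ j, (k j / energy P k) •
        (ContinuousLinearMap.proj j : (Fin 3 → ℝ) →L[ℝ] ℝ)) +
        ∑ j : Fin 3, A i.succ j.succ • (ContinuousLinearMap.proj j : (Fin 3 → ℝ) →L[ℝ] ℝ)) k := by
    refine ((hasFDerivAt_energy hP k).const_mul _).add (HasFDerivAt.fun_sum fun j _ => ?_)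
    exact (hasFDerivAt_apply (𝕜 := ℝ) j k).const_mul _
  have e : (fun x => shellMap P A x i) =
      fun k => A i.succ 0 * energy P k + ∑ j : Fin 3, A i.succ j.succ * k j := by
    ext k
    simp [shellMap, Matrix.mulVec, dotProduct, Fin.sum_univ_succ (n := 3), shellPoint]
  rw [e]
  convert! h1 using 1
  ext v
  simp [shellJac, Matrix.mulVec, dotProduct, Fin.sum_univ_three]
  ring

lemma det_sq_of_presForm {A : Matrix (Fin 4) (Fin 4) ℝ} (hA : PresForm A) : |A.det| = 1 := by
  have h := congrArg Matrix.det (presForm_iff.1 hA)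
  rw [Matrix.det_mul, Matrix.det_mul, Matrix.det_transpose, Matrix.det_diagonal] at h
  simp [Fin.prod_univ_four] at h
  have : A.det ^ 2 = 1 := by linarith
  rw [← abs_sq, abs_pow] at this
  exact (pow_eq_one_iff_of_nonneg (abs_nonneg _) two_ne_zero).1 this

/-- The frame that consists of a point of the mass shell and the coordinate tangent vectors. -/
def shellFrame (P : ℝ) (k : Fin 3 → ℝ) : Matrix (Fin 4) (Fin 4) ℝ :=
  !![energy P k, k 0 / energy P k, k 1 / energy P k, k 2 / energy P k;
     k 0, 1, 0, 0;
     k 1, 0, 1, 0;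
     k 2, 0, 0, 1]

lemma det_shellFrame {P : ℝ} (hP : 0 < P) (k : Fin 3 → ℝ) :
    (shellFrame P k).det = P / energy P k := by
  have h1 := energy_sq hP k
  have h2 := (energy_pos hP k).ne'
  simp [shellFrame, Matrix.det_succ_row_zero, Fin.sum_univ_succ, Fin.succAbove]
  field_simp
  linarith

/-- `A` sends the point p to p' and, preserving orthogonality to p, sends tangent vectors to tangent
vectors. Hence A times the frame at k equals the frame at k' times the block matrix diag(1, J). The
frames have determinants P/E and P/E', and |det A| = 1. -/
lemma abs_det_shellJac {P : ℝ} (hP : 0 < P) {A : Matrix (Fin 4) (Fin 4) ℝ} (hA : Ortho A)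
    (k : Fin 3 → ℝ) :
    |(shellJac P A k).det| = energy P (shellMap P A k) / energy P k := by
  set J := shellJac P A k with hJ
  set k' := shellMap P A k with hk'
  have hE := energy_pos hP k
  have hE' := energy_pos hP k'
  have h1 := energy_sq hP k
  set B : Matrix (Fin 4) (Fin 4) ℝ :=
    !![1, 0, 0, 0; 0, J 0 0, J 0 1, J 0 2; 0, J 1 0, J 1 1, J 1 2; 0, J 2 0, J 2 1, J 2 2] with hB
  have hdetB : B.det = J.det := by
    simp [hB, Matrix.det_succ_row_zero, Fin.sum_univ_succ, Fin.succAbove]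
  have hsp : shellPoint P k' = A.mulVec (shellPoint P k) := shellPoint_shellMap hP hA k
  have hk0 : energy P k' = A 0 0 * energy P k + A 0 1 * k 0 + A 0 2 * k 1 + A 0 3 * k 2 := by
    have := congrFun hsp 0
    simpa [shellPoint, Matrix.mulVec, dotProduct, Fin.sum_univ_four] using this
  have hki : ∀ i : Fin 3, k' i = A i.succ 0 * energy P k + A i.succ 1 * k 0 + A i.succ 2 * k 1 +
      A i.succ 3 * k 2 := by
    intro i
    simp [hk', shellMap, shellPoint, Matrix.mulVec, dotProduct, Fin.sum_univ_four]
  have htan : ∀ j : Fin 3, energy P k' * (A 0 0 * (k j / energy P k) + A 0 j.succ) =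
      k' 0 * J 0 j + k' 1 * J 1 j + k' 2 * J 2 j := by
    intro j
    set v : Mink := Matrix.vecCons (k j / energy P k) (Pi.single j 1) with hv
    have h := hA.pres (shellPoint P k) v
    rw [← hsp] at h
    have hz : form (shellPoint P k) v = 0 := by
      fin_cases j <;> simp [form, shellPoint, hv] <;> field_simp <;> simp
    have hAv : ∀ i, A.mulVec v i = A i 0 * (k j / energy P k) + A i j.succ := by
      intro i
      fin_cases j <;> simp [hv, Matrix.mulVec, dotProduct, Fin.sum_univ_four]
    rw [hz] at h
    simp only [form, hAv] at h
    simp only [hJ, shellJac, Matrix.of_apply]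
    change energy P k' * _ - k' 0 * _ - k' 1 * _ - k' 2 * _ = 0 at h
    have e1 : (Fin.succ 0 : Fin 4) = 1 := rfl
    have e2 : (Fin.succ 1 : Fin 4) = 2 := rfl
    have e3 : (Fin.succ 2 : Fin 4) = 3 := rfl
    rw [e1, e2, e3]
    linarith
  have hmul : A * shellFrame P k = shellFrame P k' * B := by
    have h00 := htan 0
    have h01 := htan 1
    have h02 := htan 2
    have hk1 := hki 0
    have hk2 := hki 1
    have hk3 := hki 2
    ext i j
    fin_cases i <;> fin_cases j <;>
      simp [shellFrame, hB, Matrix.mul_apply, Fin.sum_univ_four] <;>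
      first
      | (simp at hk0 hk1 hk2 hk3; linarith)
      | (simp at h00 h01 h02; field_simp at h00 h01 h02 ⊢; linarith)
      | (simp [hJ, shellJac])
  have hd := congrArg Matrix.det hmul
  rw [Matrix.det_mul, Matrix.det_mul, det_shellFrame hP, det_shellFrame hP, hdetB] at hd
  have hd' := congrArg abs hd
  rw [abs_mul, abs_mul, det_sq_of_presForm hA.pres, abs_of_pos (by positivity),
    abs_of_pos (by positivity)] at hd'
  field_simp at hd' ⊢
  linarith

lemma shellMap_comp {P : ℝ} (hP : 0 < P) {A B : Matrix (Fin 4) (Fin 4) ℝ} (hB : Ortho B)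
    (h : A * B = 1) (k : Fin 3 → ℝ) : shellMap P A (shellMap P B k) = k := by
  ext i
  rw [shellMap, shellPoint_shellMap hP hB, Matrix.mulVec_mulVec, h, Matrix.one_mulVec]
  rfl

lemma Ortho.exists_inv {A : Matrix (Fin 4) (Fin 4) ℝ} (hA : Ortho A) :
    A * A⁻¹ = 1 ∧ A⁻¹ * A = 1 := by
  have h : IsUnit A.det := by
    rw [isUnit_iff_ne_zero]
    intro h
    have := det_sq_of_presForm hA.pres
    simp [h] at this
  exact ⟨Matrix.mul_nonsing_inv _ h, Matrix.nonsing_inv_mul _ h⟩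

lemma continuous_mulVec (A : Matrix (Fin 4) (Fin 4) ℝ) :
    Continuous fun x : Mink => A.mulVec x :=
  Continuous.matrix_mulVec continuous_const continuous_id

/-- Change of variables in the spatial momenta: the Jacobian E'/E is exactly compensated by the
density 1/E. -/
lemma measurePreserving_mulVec {P : ℝ} (hP : 0 < P) {A : Matrix (Fin 4) (Fin 4) ℝ}
    (hA : Ortho A) : MeasurePreserving (fun x : Mink => A.mulVec x) (shellMeasure P)
      (shellMeasure P) := by
  have hm := (continuous_mulVec A).measurable
  refine ⟨hm, Measure.ext_of_lintegral _ fun f hf => ?_⟩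
  have hinv := hA.exists_inv
  have hA' : Ortho A⁻¹ := hA.inv_mul hinv.1
  rw [lintegral_map hf hm,
    lintegral_shellMeasure P (f := fun x => f (A.mulVec x)) (hf.comp hm),
    lintegral_shellMeasure P hf]
  have hbij : Function.Bijective (shellMap P A) :=
    Function.bijective_iff_has_inverse.2 ⟨shellMap P A⁻¹, shellMap_comp hP hA hinv.2,
      shellMap_comp hP hA' hinv.1⟩
  have := lintegral_image_eq_lintegral_abs_det_fderiv_mul (volume : Measure (Fin 3 → ℝ))
    MeasurableSet.univ (fun k _ => (hasFDerivAt_shellMap hP A k).hasFDerivWithinAt)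
    hbij.1.injOn (fun k => ENNReal.ofReal (1 / energy P k) * f (shellPoint P k))
  rw [image_univ, hbij.2.range_eq, Measure.restrict_univ] at this
  rw [this]
  refine lintegral_congr fun k => ?_
  have e : ((Matrix.toLin' (shellJac P A k)).toContinuousLinearMap).det =
      (shellJac P A k).det := by
    simp [ContinuousLinearMap.det]
  rw [e, abs_det_shellJac hP hA, shellPoint_shellMap hP hA, ← mul_assoc,
    ← ENNReal.ofReal_mul (div_nonneg (energy_pos hP _).le (energy_pos hP _).le)]
  congr 2
  have h1 := (energy_pos hP k).ne'
  have h2 := (energy_pos hP (shellMap P A k)).ne'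
  field_simp

/-! ### Growth of the invariant measure -/

lemma norm_le_energy {P : ℝ} (hP : 0 < P) (k : Fin 3 → ℝ) : ‖k‖ ≤ energy P k := by
  refine (pi_norm_le_iff_of_nonneg (energy_pos hP k).le).2 fun i => ?_
  refine abs_le_of_sq_le_sq ?_ (energy_pos hP k).le
  rw [energy_sq hP]
  fin_cases i <;> simp <;> nlinarith [sq_nonneg (k 0), sq_nonneg (k 1), sq_nonneg (k 2)]

lemma norm_shellPoint {P : ℝ} (hP : 0 < P) (k : Fin 3 → ℝ) : ‖shellPoint P k‖ = energy P k := by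
  apply le_antisymm
  · refine (pi_norm_le_iff_of_nonneg (energy_pos hP k).le).2 fun i => ?_
    refine Fin.cases ?_ (fun j => ?_) i
    · exact (Real.norm_of_nonneg (energy_pos hP k).le).le
    · exact (norm_le_pi_norm k j).trans (norm_le_energy hP k)
  · have := norm_le_pi_norm (shellPoint P k) 0
    rwa [show shellPoint P k 0 = energy P k from rfl,
      Real.norm_of_nonneg (energy_pos hP k).le] at this

lemma norm_massShell {P : ℝ} (hP : 0 < P) {p : Mink} (hp : p ∈ massShell P) : ‖p‖ = p 0 := by
  rw [← shellPoint_tail hP hp, norm_shellPoint hP]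
  rfl

/-- The density is at most 1/√P and the exponent 4 exceeds the dimension 3. Both temperate growth
and local finiteness of the measure are drawn from this. -/
lemma integrable_shell_of_bound {P : ℝ} (hP : 0 < P) :
    Integrable (fun p : Mink => (1 + ‖p‖) ^ (-(4 : ℕ) : ℝ)) (shellMeasure P) := by
  have hm : Measurable fun p : Mink => (1 + ‖p‖) ^ (-(4 : ℕ) : ℝ) := by fun_prop
  refine ⟨hm.aestronglyMeasurable, ?_⟩
  rw [HasFiniteIntegral, lintegral_shellMeasure P hm.enorm]
  have hi : Integrable (fun k : Fin 3 → ℝ => (1 + ‖k‖) ^ (-(4 : ℕ) : ℝ)) :=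
    integrable_one_add_norm (by simp; norm_num)
  have hi' := hi.const_mul (1 / √P)
  refine lt_of_le_of_lt (lintegral_mono fun k => ?_) hi'.2
  rw [Real.enorm_eq_ofReal (by positivity), Real.enorm_eq_ofReal (by positivity),
    ← ENNReal.ofReal_mul (by have := (energy_pos hP k).le; positivity)]
  refine ENNReal.ofReal_le_ofReal ?_
  rw [norm_shellPoint hP]
  refine mul_le_mul ?_ ?_ (by have := (energy_pos hP k).le; positivity) (by positivity)
  · refine one_div_le_one_div_of_le (Real.sqrt_pos.2 hP) ?_
    exact Real.sqrt_le_sqrt (by simp; positivity)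
  · refine Real.rpow_le_rpow_of_nonpos (by positivity) ?_ (by norm_num)
    linarith [norm_le_energy hP k]

lemma hasTemperateGrowth_shellMeasure {P : ℝ} (hP : 0 < P) :
    (shellMeasure P).HasTemperateGrowth := ⟨4, integrable_shell_of_bound hP⟩

lemma isLocallyFiniteMeasure_shellMeasure {P : ℝ} (hP : 0 < P) :
    IsLocallyFiniteMeasure (shellMeasure P) := by
  refine ⟨fun x => ⟨Metric.ball x 1, Metric.ball_mem_nhds x one_pos, ?_⟩⟩
  have h := (integrable_shell_of_bound hP).2
  by_contra htop
  rw [not_lt, top_le_iff] at htop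
  set c : ℝ := (1 + (‖x‖ + 1)) ^ (-(4 : ℕ) : ℝ) with hc
  have hcpos : 0 < c := by positivity
  have h1 : ∫⁻ _ in Metric.ball x 1, ENNReal.ofReal c ∂(shellMeasure P) ≤
      ∫⁻ p, ‖(1 + ‖p‖) ^ (-(4 : ℕ) : ℝ)‖ₑ ∂(shellMeasure P) := by
    refine le_trans (setLIntegral_mono' measurableSet_ball fun p hp => ?_)
      (setLIntegral_le_lintegral _ _)
    rw [Real.enorm_eq_ofReal (by positivity)]
    refine ENNReal.ofReal_le_ofReal (Real.rpow_le_rpow_of_nonpos (by positivity) ?_ (by norm_num))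
    have h2 := norm_sub_norm_le p x
    have h3 := mem_ball_iff_norm.1 hp
    linarith
  rw [setLIntegral_const, htop, ENNReal.mul_top (by simpa using hcpos)] at h1
  exact (lt_irrefl _ (lt_of_le_of_lt h1 h)).elim

/-! ### Holomorphic functions on the strip `0 ≤ Im z ≤ π` -/

section Strip

variable {E : Type*} [NormedAddCommGroup E] [NormedSpace ℂ E]

/-- An integral that depends holomorphically on a parameter, with locally uniform domination. -/
lemma differentiableOn_integral {α : Type*} [MeasurableSpace α] {μ : Measure α} {U : Set ℂ}
    {f : ℂ → α → E} (hm : ∀ z ∈ U, AEStronglyMeasurable (f z) μ)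
    (hd : ∀ᵐ a ∂μ, DifferentiableOn ℂ (fun z => f z a) U)
    (hb : ∀ z₀ ∈ U, ∃ r > 0, ∃ bound : α → ℝ, Integrable bound μ ∧ Metric.ball z₀ r ⊆ U ∧
      ∀ᵐ a ∂μ, ∀ z ∈ Metric.ball z₀ r, ‖f z a‖ ≤ bound a) :
    DifferentiableOn ℂ (fun z => ∫ a, f z a ∂μ) U := by
  intro z₀ hz₀
  obtain ⟨r, hr, bound, hbi, hrU, hbd⟩ := hb z₀ hz₀
  have hUn : U ∈ 𝓝 z₀ := mem_of_superset (Metric.ball_mem_nhds z₀ hr) hrU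
  have hsub : ∀ z ∈ Metric.ball z₀ (r / 2), Metric.ball z (r / 2) ⊆ Metric.ball z₀ r := by
    intro z hz
    refine Metric.ball_subset_ball' ?_
    have := Metric.mem_ball.1 hz
    linarith
  have hda : ∀ᵐ a ∂μ, ∀ z ∈ Metric.ball z₀ (r / 2),
      HasDerivAt (fun z => f z a) (deriv (fun z => f z a) z) z := by
    filter_upwards [hd] with a ha z hz
    exact ((ha z (hrU (Metric.ball_subset_ball (by linarith) hz))).differentiableAt
      (mem_of_superset (Metric.isOpen_ball.mem_nhds
        (Metric.ball_subset_ball (by linarith) hz)) hrU)).hasDerivAt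
  -- The derivative is an almost everywhere limit of difference quotients along a sequence of
  -- increments inside the ball, hence measurable.
  have hmeas : AEStronglyMeasurable (fun a => deriv (fun z => f z a) z₀) μ := by
    have hseq : ∀ n : ℕ, z₀ + ((r / 2 / (n + 1) : ℝ) : ℂ) ∈ U := by
      intro n
      refine hrU ?_
      rw [Metric.mem_ball, dist_eq_norm, add_sub_cancel_left, Complex.norm_real,
        Real.norm_of_nonneg (by positivity)]
      have : r / 2 / (n + 1) ≤ r / 2 := div_le_self (by linarith) (by linarith [n.cast_nonneg (α := ℝ)])
      linarith
    have ht : Tendsto (fun n : ℕ => ((r / 2 / (n + 1) : ℝ) : ℂ)) atTop (𝓝 0) := by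
      have h1 : Tendsto (fun n : ℕ => r / 2 / ((n : ℝ) + 1)) atTop (𝓝 0) :=
        tendsto_const_nhds.div_atTop (tendsto_natCast_atTop_atTop.atTop_add tendsto_const_nhds)
      exact (Complex.continuous_ofReal.tendsto' 0 0 (by simp)).comp h1
    refine aestronglyMeasurable_of_tendsto_ae atTop (f := fun (n : ℕ) a =>
      (((r / 2 / (n + 1) : ℝ) : ℂ))⁻¹ • (f (z₀ + ((r / 2 / (n + 1) : ℝ) : ℂ)) a - f z₀ a))
      (fun n => ((hm _ (hseq n)).sub (hm _ hz₀)).const_smul _) ?_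
    filter_upwards [hda] with a ha
    have h2 := (ha z₀ (Metric.mem_ball_self (by linarith))).tendsto_slope_zero
    refine h2.comp (tendsto_nhdsWithin_iff.2 ⟨ht, Eventually.of_forall fun n => ?_⟩)
    simp only [mem_compl_iff, mem_singleton_iff, Complex.ofReal_eq_zero]
    positivity
  have hint : Integrable (f z₀) μ := by
    refine hbi.mono' (hm _ hz₀) ?_
    filter_upwards [hbd] with a ha using ha z₀ (Metric.mem_ball_self hr)
  have := hasDerivAt_integral_of_dominated_loc_of_deriv_le (μ := μ) (F := f)
    (F' := fun z a => deriv (fun z => f z a) z) (bound := fun a => 2 * bound a / (r / 2))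
    (Metric.ball_mem_nhds z₀ (by linarith : 0 < r / 2))
    (by filter_upwards [hUn] with z hz using hm z hz) hint hmeas ?_
    ((hbi.const_mul 2).div_const _) hda
  · exact this.2.differentiableAt.differentiableWithinAt
  · filter_upwards [hd, hbd] with a ha hba z hz
    rw [norm_deriv_eq_norm_fderiv]
    refine Complex.norm_fderiv_le_div_of_mapsTo_ball
      (ha.mono ((hsub z hz).trans hrU)) ?_ (by linarith)
    intro w hw
    rw [mem_closedBall_iff_norm]
    have h1 := hba w (hsub z hz hw)
    have h2 := hba z (hsub z hz (Metric.mem_ball_self (by linarith)))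
    have := norm_sub_le (f w a) (f z a)
    linarith

/-- The open strip `0 < Im z < π`. -/
abbrev strip : Set ℂ := Complex.im ⁻¹' Ioo 0 Real.pi

lemma closure_strip : closure strip = Complex.im ⁻¹' Icc 0 Real.pi := by
  rw [Complex.closure_preimage_im, closure_Ioo Real.pi_pos.ne]

lemma isOpen_strip : IsOpen strip := isOpen_Ioo.preimage Complex.continuous_im

/-- Phragmén–Lindelöf: in a strip of width π, growth exp(B exp(c|Re z|)) is harmless precisely in
the range c < 1. -/
lemma norm_le_of_edges {f : ℂ → E} (hf : DiffContOnCl ℂ f strip)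
    (hgrowth : ∃ c < 1, ∃ A B, ∀ z ∈ strip, ‖f z‖ ≤ A * Real.exp (B * Real.exp (c * |z.re|)))
    {C : ℝ} (h0 : ∀ t : ℝ, ‖f t‖ ≤ C) (h1 : ∀ t : ℝ, ‖f (t + Real.pi * Complex.I)‖ ≤ C)
    {z : ℂ} (hz : z.im ∈ Icc 0 Real.pi) : ‖f z‖ ≤ C := by
  obtain ⟨c, hc, A, B, hAB⟩ := hgrowth
  refine PhragmenLindelof.horizontal_strip hf ⟨c, by simpa [Real.pi_pos.ne'] using hc, B, ?_⟩
    ?_ ?_ hz.1 hz.2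
  · refine Asymptotics.IsBigO.of_bound A (mem_inf_of_right ?_)
    intro z hz
    simpa [abs_of_pos (Real.exp_pos _)] using hAB z hz
  · intro z hz
    have : z = (z.re : ℂ) := Complex.ext rfl (by simp [hz])
    rw [this]; exact h0 _
  · intro z hz
    have : z = (z.re : ℂ) + Real.pi * Complex.I := Complex.ext (by simp) (by simp [hz])
    rw [this]; exact h1 _

lemma norm_le_of_edges_of_bounded {f : ℂ → E} (hf : DiffContOnCl ℂ f strip) {B : ℝ}
    (hB : ∀ z ∈ strip, ‖f z‖ ≤ B) {C : ℝ} (h0 : ∀ t : ℝ, ‖f t‖ ≤ C)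
    (h1 : ∀ t : ℝ, ‖f (t + Real.pi * Complex.I)‖ ≤ C)
    {z : ℂ} (hz : z.im ∈ Icc 0 Real.pi) : ‖f z‖ ≤ C :=
  norm_le_of_edges hf ⟨0, one_pos, B, 0, fun z hz => by simpa using hB z hz⟩ h0 h1 hz

/-- The Gaussian weight. -/
def gauss (m : ℝ) (z : ℂ) : ℂ := Complex.exp (-(m * z) ^ 2)

lemma differentiable_gauss (m : ℝ) : Differentiable ℂ (gauss m) := by
  unfold gauss; fun_prop

lemma norm_gauss (m x y : ℝ) : ‖gauss m (x + y * Complex.I)‖ =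
    Real.exp (m ^ 2 * y ^ 2) * Real.exp (-m ^ 2 * x ^ 2) := by
  rw [gauss, Complex.norm_exp, ← Real.exp_add]
  congr 1
  simp [pow_two]
  ring

lemma integrable_gauss_smul {m : ℝ} (hm : 0 < m) (y : ℝ) {f : ℝ → E}
    (hf : AEStronglyMeasurable f volume) {B : ℝ} (hB : ∀ t, ‖f t‖ ≤ B) :
    Integrable fun t : ℝ => gauss m (t + y * Complex.I) • f t := by
  have hi := ((integrable_exp_neg_mul_sq (b := m ^ 2) (by positivity)).const_mul
    (Real.exp (m ^ 2 * y ^ 2))).mul_const B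
  refine hi.mono' ?_ (Eventually.of_forall fun t => ?_)
  · refine AEStronglyMeasurable.smul (Continuous.aestronglyMeasurable ?_) hf
    exact (differentiable_gauss m).continuous.comp (by fun_prop)
  · rw [norm_smul, norm_gauss]
    exact mul_le_mul_of_nonneg_left (hB t) (by positivity)

/-- Cauchy's theorem for gauss(z - iπ) f(z) on the rectangles [-T,T] × [0,π]; the Gaussian kills the
vertical sides as T → ∞. -/
lemma gauss_shift {f : ℂ → E} (hf : DiffContOnCl ℂ f strip) {B : ℝ}
    (hB : ∀ z, z.im ∈ Icc 0 Real.pi → ‖f z‖ ≤ B) {m : ℝ} (hm : 0 < m) :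
    ∫ t : ℝ, gauss m (t - Real.pi * Complex.I) • f t =
      ∫ t : ℝ, gauss m t • f (t + Real.pi * Complex.I) := by
  have hcl : ContinuousOn f (Complex.im ⁻¹' Icc 0 Real.pi) := closure_strip ▸ hf.continuousOn
  have hB0 : 0 ≤ B := (norm_nonneg _).trans (hB 0 ⟨by simp, by simpa using Real.pi_pos.le⟩)
  set h : ℂ → E := fun z => gauss m (z - Real.pi * Complex.I) • f z with hh
  have hgd : Differentiable ℂ fun z : ℂ => gauss m (z - Real.pi * Complex.I) :=
    (differentiable_gauss m).comp (differentiable_id.sub_const _)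
  have hcont : ContinuousOn h (Complex.im ⁻¹' Icc 0 Real.pi) := hgd.continuous.continuousOn.smul hcl
  have hdiff : DifferentiableOn ℂ h strip := hgd.differentiableOn.smul hf.differentiableOn
  have hpi := Real.pi_pos
  have hline : ∀ y ∈ Icc 0 Real.pi, Continuous fun t : ℝ => f (t + y * Complex.I) := by
    intro y hy
    refine hcl.comp_continuous (by fun_prop) fun t => ?_
    simpa using hy
  have hrect : ∀ T : ℝ, (∫ x : ℝ in -T..T, h x) - (∫ x : ℝ in -T..T, h (x + Real.pi * Complex.I)) +
      (Complex.I • (∫ y : ℝ in (0 : ℝ)..Real.pi, h (T + y * Complex.I)) -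
      Complex.I • (∫ y : ℝ in (0 : ℝ)..Real.pi, h (-T + y * Complex.I))) = 0 := by
    intro T
    have := Complex.integral_boundary_rect_eq_zero_of_continuousOn_of_differentiableOn h
      (-T : ℝ) (T + Real.pi * Complex.I) (hcont.mono ?_) (hdiff.mono ?_)
    · simpa [add_sub_assoc] using this
    · intro z hz
      simpa [uIcc_of_le hpi.le] using hz.2
    · intro z hz
      simpa [hpi.le] using hz.2
  have hside : ∀ s : ℝ → ℝ, (∀ T, |s T| = |T|) →
      Tendsto (fun T : ℝ => ∫ y : ℝ in (0 : ℝ)..Real.pi, h ((s T : ℝ) + y * Complex.I)) atTop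
        (𝓝 0) := by
    intro s hs
    have hlim : Tendsto (fun T : ℝ => (Real.exp (m ^ 2 * Real.pi ^ 2) *
        Real.exp (-(m ^ 2 * T ^ 2)) * B) * |Real.pi - 0|) atTop (𝓝 0) := by
      have h1 : Tendsto (fun T : ℝ => Real.exp (-(m ^ 2 * T ^ 2))) atTop (𝓝 0) :=
        Real.tendsto_exp_neg_atTop_nhds_zero.comp
          ((tendsto_pow_atTop two_ne_zero).const_mul_atTop (by positivity))
      simpa using ((h1.const_mul (Real.exp (m ^ 2 * Real.pi ^ 2))).mul_const B).mul_const
        |Real.pi - 0|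
    refine squeeze_zero_norm (fun T => ?_) hlim
    refine intervalIntegral.norm_integral_le_of_norm_le_const fun y hy => ?_
    rw [uIoc_of_le hpi.le] at hy
    rw [hh]
    simp only
    rw [norm_smul]
    have e : ((s T : ℝ) : ℂ) + y * Complex.I - Real.pi * Complex.I =
        (s T : ℝ) + ((y - Real.pi : ℝ) : ℂ) * Complex.I := by push_cast; ring
    rw [e, norm_gauss]
    have e2 : (s T) ^ 2 = T ^ 2 := by rw [← sq_abs, hs, sq_abs]
    have e3 : (y - Real.pi) ^ 2 ≤ Real.pi ^ 2 := by nlinarith [hy.1, hy.2]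
    refine mul_le_mul ?_ (hB _ ?_) (norm_nonneg _) (by positivity)
    · rw [e2, neg_mul]
      gcongr
    · simpa using ⟨hy.1.le, hy.2⟩
  have h0 := hline 0 ⟨le_rfl, hpi.le⟩
  have h1 := hline Real.pi ⟨hpi.le, le_rfl⟩
  simp only [Complex.ofReal_zero, zero_mul, add_zero] at h0
  have hi0 : Integrable fun t : ℝ => h t := by
    have := integrable_gauss_smul hm (-Real.pi) h0.aestronglyMeasurable (B := B)
      (fun t => hB _ (by simpa using hpi.le))
    simpa [hh, sub_eq_add_neg] using this
  have hi1 : Integrable fun t : ℝ => h (t + Real.pi * Complex.I) := by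
    have := integrable_gauss_smul hm 0 h1.aestronglyMeasurable (B := B)
      (fun t => hB _ (by simpa using hpi.le))
    simpa [hh] using this
  have ht0 := intervalIntegral_tendsto_integral hi0 tendsto_neg_atTop_atBot tendsto_id
  have ht1 := intervalIntegral_tendsto_integral hi1 tendsto_neg_atTop_atBot tendsto_id
  have hs1 := hside (fun T => T) (fun _ => rfl)
  have hs2 := hside (fun T => -T) (fun _ => abs_neg _)
  have htot := (ht0.sub ht1).add ((hs1.const_smul Complex.I).sub (hs2.const_smul Complex.I))
  have hz : Tendsto (fun _ : ℝ => (0 : E)) atTop (𝓝 0) := tendsto_const_nhds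
  have := tendsto_nhds_unique (htot.congr fun T => by
    have := hrect T
    simpa using this) hz
  simp only [smul_zero, sub_zero, add_zero] at this
  have := sub_eq_zero.1 this
  simpa [hh] using this

end Strip

/-! ### Analytic continuation of one-parameter groups of isometries -/

section Group

variable {E : Type*} [NormedAddCommGroup E] [NormedSpace ℂ E]

/-- A strongly continuous one-parameter group of isometries. -/
structure IsoGroup (V : ℝ → E →ₗᵢ[ℂ] E) : Prop where
  zero : ∀ x, V 0 x = x
  add : ∀ s t x, V (s + t) x = V s (V t x)
  cont : ∀ x, Continuous fun t => V t x

/-- The analytic continuation of the group to `π i` on the elements with an entire orbit. -/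
def entireGraph (V : ℝ → E →ₗᵢ[ℂ] E) : Set (E × E) :=
  {x | ∃ F : ℂ → E, Differentiable ℂ F ∧ (∀ t : ℝ, F t = V t (F 0)) ∧
    x = (F 0, F (Real.pi * Complex.I))}

/-- `F` continues the orbit of `φ` to the strip, with upper boundary value the orbit of `χ`. -/
structure StripOrbit (V : ℝ → E →ₗᵢ[ℂ] E) (φ χ : E) (F : ℂ → E) : Prop where
  holo : DiffContOnCl ℂ F strip
  lower : ∀ t : ℝ, F t = V t φ
  upper : ∀ t : ℝ, F (t + Real.pi * Complex.I) = V t χ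
  shift : ∀ z, z.im ∈ Icc 0 Real.pi → ∀ t : ℝ, F (z + t) = V t (F z)
  bound : ∃ B, ∀ z, z.im ∈ Icc 0 Real.pi → ‖F z‖ ≤ B

variable {V : ℝ → E →ₗᵢ[ℂ] E}

/-- Both sides are entire in z and agree at the real points 1/(n+1), which accumulate at 0. -/
lemma entire_shift [CompleteSpace E] (hV : IsoGroup V) {F : ℂ → E} (hF : Differentiable ℂ F)
    (h : ∀ t : ℝ, F t = V t (F 0)) (z : ℂ) (t : ℝ) : F (z + t) = V t (F z) := by
  have h1 : AnalyticOnNhd ℂ (fun z => F (z + t)) univ :=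
    (hF.comp (differentiable_id.add_const _)).differentiableOn.analyticOnNhd isOpen_univ
  have h2 : AnalyticOnNhd ℂ (fun z => V t (F z)) univ :=
    ((V t).toContinuousLinearMap.differentiable.comp hF).differentiableOn.analyticOnNhd isOpen_univ
  have h3 : ∃ᶠ w in 𝓝[≠] (0 : ℂ), F (w + t) = V t (F w) := by
    have hseq : Tendsto (fun n : ℕ => ((1 / ((n : ℝ) + 1) : ℝ) : ℂ)) atTop (𝓝[≠] 0) := by
      refine tendsto_nhdsWithin_iff.2 ⟨?_, Eventually.of_forall fun n => ?_⟩
      · exact (Complex.continuous_ofReal.tendsto' 0 0 (by simp)).comp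
          tendsto_one_div_add_atTop_nhds_zero_nat
      · simp only [mem_compl_iff, mem_singleton_iff, Complex.ofReal_eq_zero]
        positivity
    refine hseq.frequently (Frequently.of_forall fun n => ?_)
    rw [← Complex.ofReal_add, h, h (1 / ((n : ℝ) + 1)), add_comm, hV.add]
  exact congrFun (h1.eq_of_frequently_eq h2 h3) z

/-- The norm depends on Im z alone, so compactness of [0,π] supplies the a priori bound that the
three lines theorem needs. -/
lemma norm_le_of_shift {G : ℂ → E} (hG : Differentiable ℂ G)
    (hs : ∀ z (t : ℝ), ‖G (z + t)‖ = ‖G z‖) {z : ℂ} (hz : z.im ∈ Icc 0 Real.pi) :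
    ‖G z‖ ≤ max ‖G 0‖ ‖G (Real.pi * Complex.I)‖ := by
  have hvert : ∀ z : ℂ, ‖G z‖ = ‖G (z.im * Complex.I)‖ := by
    intro z
    rw [← hs (z.im * Complex.I) z.re]
    congr 2
    apply Complex.ext <;> simp
  obtain ⟨B, hB⟩ := (isCompact_Icc (a := (0 : ℝ)) (b := Real.pi)).exists_bound_of_continuousOn
    (f := fun y : ℝ => G (y * Complex.I)) (hG.continuous.comp (by fun_prop)).continuousOn
  refine norm_le_of_edges_of_bounded hG.diffContOnCl (B := B) (fun z hz => ?_) (fun t => ?_)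
    (fun t => ?_) hz
  · rw [hvert]; exact hB _ ⟨hz.1.le, hz.2.le⟩
  · have := hs 0 t
    rw [zero_add] at this
    rw [this]; exact le_max_left _ _
  · rw [add_comm, hs]; exact le_max_right _ _

/-- Take entire orbits whose values at 0 and iπ converge. The estimate by the two edge values,
applied to differences, makes them uniformly Cauchy on the closed strip, and the limit inherits
holomorphy, continuity and equivariance. -/
lemma exists_stripOrbit [CompleteSpace E] (hV : IsoGroup V) {φ χ : E}
    (h : (φ, χ) ∈ closure (entireGraph V)) : ∃ F, StripOrbit V φ χ F := by
  obtain ⟨x, hx, hlim⟩ := mem_closure_iff_seq_limit.1 h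
  choose F hFd hFV hxF using hx
  have hsh : ∀ n z (t : ℝ), F n (z + t) = V t (F n z) := fun n =>
    entire_shift hV (hFd n) (hFV n)
  have hl0 : Tendsto (fun n => F n 0) atTop (𝓝 φ) := by
    have := (continuous_fst.tendsto _).comp hlim
    refine this.congr fun n => by simp [hxF n]
  have hl1 : Tendsto (fun n => F n (Real.pi * Complex.I)) atTop (𝓝 χ) := by
    have := (continuous_snd.tendsto _).comp hlim
    refine this.congr fun n => by simp [hxF n]
  have hdiff : ∀ n m z, z.im ∈ Icc 0 Real.pi → ‖F n z - F m z‖ ≤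
      max ‖F n 0 - F m 0‖ ‖F n (Real.pi * Complex.I) - F m (Real.pi * Complex.I)‖ := by
    intro n m z hz
    exact norm_le_of_shift (G := fun z => F n z - F m z) ((hFd n).sub (hFd m))
      (fun z t => by rw [hsh, hsh, ← map_sub, (V t).norm_map]) hz
  have hunif : UniformCauchySeqOn F atTop (Complex.im ⁻¹' Icc 0 Real.pi) := by
    rw [Metric.uniformCauchySeqOn_iff]
    intro ε hε
    obtain ⟨N0, h0⟩ := Metric.cauchySeq_iff.1 hl0.cauchySeq ε hε
    obtain ⟨N1, h1⟩ := Metric.cauchySeq_iff.1 hl1.cauchySeq ε hε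
    refine ⟨max N0 N1, fun n hn m hm z hz => ?_⟩
    rw [dist_eq_norm]
    refine lt_of_le_of_lt (hdiff n m z hz) (max_lt ?_ ?_)
    · rw [← dist_eq_norm]
      exact h0 n (le_trans (le_max_left _ _) hn) m (le_trans (le_max_left _ _) hm)
    · rw [← dist_eq_norm]
      exact h1 n (le_trans (le_max_right _ _) hn) m (le_trans (le_max_right _ _) hm)
  have hex : ∀ z, ∃ y, z.im ∈ Icc 0 Real.pi → Tendsto (fun n => F n z) atTop (𝓝 y) := by
    intro z
    by_cases hz : z.im ∈ Icc 0 Real.pi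
    · obtain ⟨y, hy⟩ := cauchySeq_tendsto_of_complete (hunif.cauchySeq hz)
      exact ⟨y, fun _ => hy⟩
    · exact ⟨0, fun h => (hz h).elim⟩
  choose G hG using hex
  have htu : TendstoUniformlyOn F G atTop (Complex.im ⁻¹' Icc 0 Real.pi) :=
    hunif.tendstoUniformlyOn_of_tendsto fun z hz => hG z hz
  have hreal : ∀ t : ℝ, ((t : ℂ)).im ∈ Icc 0 Real.pi := fun t =>
    ⟨by simp, by simpa using Real.pi_pos.le⟩
  have hupp : ∀ t : ℝ, ((t : ℂ) + Real.pi * Complex.I).im ∈ Icc 0 Real.pi := fun t =>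
    ⟨by simpa using Real.pi_pos.le, by simp⟩
  have hshift : ∀ z, z.im ∈ Icc 0 Real.pi → ∀ t : ℝ, G (z + t) = V t (G z) := by
    intro z hz t
    have h1 := hG (z + t) (by simpa using hz)
    have h2 := ((V t).continuous.tendsto _).comp (hG z hz)
    refine tendsto_nhds_unique h1 (h2.congr fun n => (hsh n z t).symm)
  have e0 : G 0 = φ := tendsto_nhds_unique (hG 0 (by simpa using hreal 0)) hl0
  have e1 : G (Real.pi * Complex.I) = χ :=
    tendsto_nhds_unique (hG _ (by simpa using hupp 0)) hl1
  have hcont : ContinuousOn G (Complex.im ⁻¹' Icc 0 Real.pi) :=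
    htu.continuousOn (Frequently.of_forall fun n => (hFd n).continuous.continuousOn)
  refine ⟨G, ⟨?_, ?_⟩, fun t => ?_, fun t => ?_, hshift, ?_⟩
  · exact (htu.mono (preimage_mono Ioo_subset_Icc_self)).tendstoLocallyUniformlyOn.differentiableOn
      (Eventually.of_forall fun n => (hFd n).differentiableOn) isOpen_strip
  · rw [closure_strip]; exact hcont
  · have := hshift 0 (by simpa using hreal 0) t
    rwa [zero_add, e0] at this
  · have := hshift (Real.pi * Complex.I) (by simpa using hupp 0) t
    rwa [add_comm, e1] at this
  · obtain ⟨B, hB⟩ := (isCompact_Icc (a := (0 : ℝ)) (b := Real.pi)).exists_bound_of_continuousOn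
      (f := fun y : ℝ => G (y * Complex.I))
      (hcont.comp (by fun_prop) fun y hy => by simpa using hy)
    refine ⟨B, fun z hz => ?_⟩
    have : z = z.im * Complex.I + z.re := by apply Complex.ext <;> simp
    rw [this, hshift _ (by simpa using hz), (V _).norm_map]
    exact hB _ hz

/-- The Gaussian regularization of an orbit, as an entire function. -/
def gaussOrbit (V : ℝ → E →ₗᵢ[ℂ] E) (m : ℝ) (z : ℂ) (x : E) : E :=
  ∫ t : ℝ, gauss m (t - z) • V t x

lemma integrable_gaussOrbit (hV : IsoGroup V) {m : ℝ} (hm : 0 < m) (z : ℂ) (x : E) :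
    Integrable fun t : ℝ => gauss m (t - z) • V t x := by
  have h := integrable_gauss_smul hm (-z.im) (f := fun t => V (t + z.re) x)
    ((hV.cont x).comp (continuous_id.add_const _)).aestronglyMeasurable
    (B := ‖x‖) (fun t => ((V _).norm_map x).le)
  have h2 := h.comp_sub_right z.re
  refine h2.congr (Eventually.of_forall fun t => ?_)
  have : (((t - z.re : ℝ) : ℂ) + ((-z.im : ℝ) : ℂ) * Complex.I) = t - z := by
    apply Complex.ext <;> simp
  simp only [sub_add_cancel, this]

lemma differentiable_gaussOrbit (hV : IsoGroup V) {m : ℝ} (hm : 0 < m) (x : E) :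
    Differentiable ℂ fun z => gaussOrbit V m z x := by
  rw [← differentiableOn_univ]
  refine differentiableOn_integral (fun z _ => (integrable_gaussOrbit hV hm z x).1) ?_ ?_
  · refine Eventually.of_forall fun t => ?_
    have : Differentiable ℂ fun z : ℂ => gauss m (t - z) :=
      (differentiable_gauss m).comp ((differentiable_const _).sub differentiable_id)
    exact (this.smul_const _).differentiableOn
  · intro z₀ _
    set Y := |z₀.im| + 1 with hY
    -- Halving the exponent absorbs the movement of Re z within the unit ball: (t - Re z)² ≥ (t - Re
    -- z₀)²/2 - 1. The prefactor pays for the -1 and for |Im z| ≤ Y.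
    have hi := (((integrable_exp_neg_mul_sq (b := m ^ 2 / 2) (by positivity)).const_mul
      (Real.exp (m ^ 2 * Y ^ 2 + m ^ 2))).mul_const ‖x‖).comp_sub_right z₀.re
    refine ⟨1, one_pos, _, hi, subset_univ _, Eventually.of_forall fun t z hz => ?_⟩
    rw [norm_smul, (V t).norm_map]
    have e : (t : ℂ) - z = ((t - z.re : ℝ) : ℂ) + ((-z.im : ℝ) : ℂ) * Complex.I := by
      apply Complex.ext <;> simp
    rw [e, norm_gauss, ← Real.exp_add, ← Real.exp_add]
    refine mul_le_mul_of_nonneg_right (Real.exp_le_exp.2 ?_) (norm_nonneg _)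
    have hz' := mem_ball_iff_norm.1 hz
    have h1 : |z.re - z₀.re| ≤ 1 := (Complex.abs_re_le_norm (z - z₀)).trans hz'.le
    have h2 : |z.im - z₀.im| ≤ 1 := (Complex.abs_im_le_norm (z - z₀)).trans hz'.le
    have h3 : z.im ^ 2 ≤ Y ^ 2 := by
      rw [sq_le_sq, abs_of_nonneg (by positivity : 0 ≤ Y)]
      have := abs_sub_abs_le_abs_sub z.im z₀.im
      linarith
    have h4 : (t - z₀.re) ^ 2 / 2 - 1 ≤ (t - z.re) ^ 2 := by
      have : (z.re - z₀.re) ^ 2 ≤ 1 := by rw [← sq_abs]; nlinarith [abs_nonneg (z.re - z₀.re)]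
      nlinarith [sq_nonneg ((t - z.re) - (z.re - z₀.re))]
    nlinarith [mul_le_mul_of_nonneg_left h3 (sq_nonneg m),
      mul_le_mul_of_nonneg_left h4 (sq_nonneg m)]

lemma gaussOrbit_shift [CompleteSpace E] (hV : IsoGroup V) {m : ℝ} (hm : 0 < m) (s : ℝ) (x : E) :
    gaussOrbit V m s x = V s (gaussOrbit V m 0 x) := by
  rw [gaussOrbit, gaussOrbit]
  have h := (V s).toContinuousLinearMap.integral_comp_comm (integrable_gaussOrbit hV hm 0 x)
  simp only [LinearIsometry.coe_toContinuousLinearMap] at h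
  rw [← h, ← integral_add_right_eq_self _ s]
  refine integral_congr_ae (Eventually.of_forall fun t => ?_)
  simp only [map_smul, sub_zero, Complex.ofReal_add, add_sub_cancel_right]
  rw [add_comm t s, hV.add]

/-- After rescaling t the Gaussian is fixed and the group is evaluated at t/(n+1) → 0; dominated
convergence and ∫ e^{-t²} = √π conclude. -/
lemma tendsto_gaussOrbit [CompleteSpace E] (hV : IsoGroup V) (x : E) :
    Tendsto (fun n : ℕ => ((((n : ℝ) + 1) / √Real.pi : ℝ) : ℂ) • gaussOrbit V ((n : ℝ) + 1) 0 x)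
      atTop (𝓝 x) := by
  have h1 : ∀ n : ℕ, ((((n : ℝ) + 1) / √Real.pi : ℝ) : ℂ) • gaussOrbit V ((n : ℝ) + 1) 0 x =
      ((1 / √Real.pi : ℝ) : ℂ) • ∫ t : ℝ, gauss 1 t • V (t / ((n : ℝ) + 1)) x := by
    intro n
    have hn : (0 : ℝ) < (n : ℝ) + 1 := by positivity
    rw [gaussOrbit]
    have := Measure.integral_comp_mul_left
      (fun t : ℝ => gauss 1 t • V (t / ((n : ℝ) + 1)) x) ((n : ℝ) + 1)
    rw [abs_of_pos (inv_pos.2 hn)] at this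
    have e : ∀ t : ℝ, gauss ((n : ℝ) + 1) (t - 0) • V t x =
        gauss 1 ((((n : ℝ) + 1) * t : ℝ) : ℂ) • V ((((n : ℝ) + 1) * t) / ((n : ℝ) + 1)) x := by
      intro t
      rw [mul_div_cancel_left₀ _ hn.ne']
      simp [gauss]
    simp_rw [e]
    rw [this, ← Complex.coe_smul, smul_smul]
    congr 1
    rw [← Complex.ofReal_mul]
    congr 1
    field_simp
  simp_rw [h1]
  have hlim : Tendsto (fun n : ℕ => ∫ t : ℝ, gauss 1 t • V (t / ((n : ℝ) + 1)) x) atTop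
      (𝓝 (∫ t : ℝ, gauss 1 t • x)) := by
    refine tendsto_integral_of_dominated_convergence (fun t : ℝ => ‖gauss 1 t‖ * ‖x‖) ?_ ?_ ?_ ?_
    · intro n
      refine Continuous.aestronglyMeasurable ?_
      exact ((differentiable_gauss 1).continuous.comp Complex.continuous_ofReal).smul
        ((hV.cont x).comp (continuous_id.div_const _))
    · have := integrable_gauss_smul one_pos 0 (f := fun _ : ℝ => (1 : ℂ))
        aestronglyMeasurable_const (B := 1) (by simp)
      simpa using this.norm.mul_const ‖x‖
    · intro n
      refine Eventually.of_forall fun t => ?_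
      rw [norm_smul, (V _).norm_map]
    · refine Eventually.of_forall fun t => ?_
      have h2 : Tendsto (fun n : ℕ => t / ((n : ℝ) + 1)) atTop (𝓝 0) :=
        tendsto_const_nhds.div_atTop (tendsto_natCast_atTop_atTop.atTop_add tendsto_const_nhds)
      have h3 := ((hV.cont x).tendsto 0).comp h2
      rw [hV.zero] at h3
      exact h3.const_smul _
  have hval : ∫ t : ℝ, gauss 1 t • x = ((√Real.pi : ℝ) : ℂ) • x := by
    rw [integral_smul_const]
    congr 1
    have h := integral_gaussian 1
    have e : ∀ t : ℝ, gauss 1 t = ((Real.exp (-1 * t ^ 2) : ℝ) : ℂ) := by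
      intro t; simp [gauss]
    simp_rw [e]
    rw [integral_complex_ofReal, h, div_one]
  rw [hval] at hlim
  have := hlim.const_smul ((1 / √Real.pi : ℝ) : ℂ)
  rw [smul_smul, ← Complex.ofReal_mul, one_div_mul_cancel (Real.sqrt_pos.2 Real.pi_pos).ne',
    Complex.ofReal_one, one_smul] at this
  exact this

/-- The Gaussian average of φ has an entire orbit, whose value at iπ is, by hypothesis, the Gaussian
average of χ. As m → ∞ the averages tend to φ and χ. The criterion involves only real orbits of φ
and χ, which makes it stable under limits of the group. -/
lemma mem_closure_entireGraph [CompleteSpace E] (hV : IsoGroup V) {φ χ : E}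
    (h : ∀ m : ℝ, 0 < m → gaussOrbit V m (Real.pi * Complex.I) φ = gaussOrbit V m 0 χ) :
    (φ, χ) ∈ closure (entireGraph V) := by
  refine mem_closure_of_tendsto ((tendsto_gaussOrbit hV φ).prodMk_nhds
    (tendsto_gaussOrbit hV χ)) (Eventually.of_forall fun n => ?_)
  have hn : (0 : ℝ) < (n : ℝ) + 1 := by positivity
  refine ⟨fun z => ((((n : ℝ) + 1) / √Real.pi : ℝ) : ℂ) • gaussOrbit V ((n : ℝ) + 1) z φ,
    (differentiable_gaussOrbit hV hn φ).const_smul _, fun t => ?_, ?_⟩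
  · simp only [map_smul]
    rw [gaussOrbit_shift hV hn]
  · simp only [h _ hn]

end Group

/-! ### The operators of the representation on `L²` -/

/-- The phase `e^{i{p,a}}`. -/
def phase (a p : Mink) : ℂ := Complex.exp (Complex.I * ((form p a : ℝ) : ℂ))

lemma norm_phase (a p : Mink) : ‖phase a p‖ = 1 := by
  rw [phase, mul_comm, Complex.norm_exp_ofReal_mul_I]

lemma continuous_form_right (p : Mink) : Continuous fun x : Mink => form p x := by
  unfold form; fun_prop

lemma continuous_form_left (a : Mink) : Continuous fun p : Mink => form p a := by
  unfold form; fun_prop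

lemma continuous_phase (a : Mink) : Continuous (phase a) := by
  have := continuous_form_left a
  unfold phase; fun_prop

lemma phase_mul_neg (a p : Mink) : phase a p * phase (-a) p = 1 := by
  rw [phase, phase, ← Complex.exp_add, ← Complex.exp_zero]
  congr 1
  have : form p (-a) = -form p a := by simp only [form, Pi.neg_apply]; ring
  rw [this]; push_cast; ring

lemma conj_phase (a p : Mink) : (starRingEnd ℂ) (phase a p) = phase (-a) p := by
  rw [phase, phase, ← Complex.exp_conj]
  congr 1
  have : form p (-a) = -form p a := by simp only [form, Pi.neg_apply]; ring
  rw [this]; simp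

lemma phase_sub_left (a p q : Mink) : phase a (p - q) = phase a p * phase (-a) q := by
  rw [phase, phase, phase, ← Complex.exp_add]
  congr 1
  have : form q (-a) = -form q a := by simp only [form, Pi.neg_apply]; ring
  rw [this, form_sub_left]; push_cast; ring

lemma phase_sub_right (a b p : Mink) : phase (a - b) p = phase a p * phase (-b) p := by
  rw [phase, phase, phase, ← Complex.exp_add]
  congr 1
  have : form p (-b) = -form p b := by simp only [form, Pi.neg_apply]; ring
  rw [this, form_sub_right]; push_cast; ring

lemma phase_add_right (a b p : Mink) : phase (a + b) p = phase a p * phase b p := by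
  rw [phase, phase, phase, ← Complex.exp_add]
  congr 1
  rw [form_add_right]; push_cast; ring

lemma memLp_phase_mul (P : ℝ) (a : Mink) (φ : Hilb P) :
    MemLp (fun p => phase a p * φ p) 2 (shellMeasure P) := by
  refine (Lp.memLp φ).of_le
    ((continuous_phase a).aestronglyMeasurable.mul (Lp.aestronglyMeasurable φ))
    (Eventually.of_forall fun p => ?_)
  rw [norm_mul, norm_phase, one_mul]

/-- Multiplication by the phase `e^{i{p,a}}`. -/
def phaseOp (P : ℝ) (a : Mink) : Hilb P →ₗᵢ[ℂ] Hilb P where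
  toFun φ := (memLp_phase_mul P a φ).toLp
  map_add' φ ψ := by
    ext1
    filter_upwards [(memLp_phase_mul P a (φ + ψ)).coeFn_toLp, (memLp_phase_mul P a φ).coeFn_toLp,
      (memLp_phase_mul P a ψ).coeFn_toLp, Lp.coeFn_add φ ψ,
      Lp.coeFn_add (memLp_phase_mul P a φ).toLp (memLp_phase_mul P a ψ).toLp] with p h1 h2 h3 h4 h5
    rw [h5, h1, Pi.add_apply, h2, h3, h4, Pi.add_apply, mul_add]
  map_smul' c φ := by
    ext1
    filter_upwards [(memLp_phase_mul P a (c • φ)).coeFn_toLp, (memLp_phase_mul P a φ).coeFn_toLp,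
      Lp.coeFn_smul c φ, Lp.coeFn_smul c (memLp_phase_mul P a φ).toLp] with p h1 h2 h4 h5
    simp only [RingHom.id_apply]
    rw [h5, h1, Pi.smul_apply, h2, h4, Pi.smul_apply, smul_eq_mul, smul_eq_mul]
    ring
  norm_map' φ := by
    change ‖(memLp_phase_mul P a φ).toLp‖ = ‖φ‖
    rw [Lp.norm_toLp, Lp.norm_def]
    congr 1
    refine eLpNorm_congr_norm_ae (Eventually.of_forall fun p => ?_)
    rw [norm_mul, norm_phase, one_mul]

lemma coeFn_phaseOp (P : ℝ) (a : Mink) (φ : Hilb P) :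
    phaseOp P a φ =ᵐ[shellMeasure P] fun p => phase a p * φ p :=
  (memLp_phase_mul P a φ).coeFn_toLp

lemma phaseOp_neg_apply (P : ℝ) (a : Mink) (φ : Hilb P) :
    phaseOp P a (phaseOp P (-a) φ) = φ := by
  ext1
  filter_upwards [coeFn_phaseOp P a (phaseOp P (-a) φ), coeFn_phaseOp P (-a) φ] with p h1 h2
  rw [h1, h2, ← mul_assoc, phase_mul_neg, one_mul]

lemma phaseOp_apply_neg (P : ℝ) (a : Mink) (φ : Hilb P) :
    phaseOp P (-a) (phaseOp P a φ) = φ := by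
  have := phaseOp_neg_apply P (-a) φ
  rwa [neg_neg] at this

lemma norm_star_hilb {P : ℝ} (φ : Hilb P) : ‖star φ‖ = ‖φ‖ := by
  rw [Lp.norm_def, Lp.norm_def]
  congr 1
  refine eLpNorm_congr_norm_ae ?_
  filter_upwards [Lp.coeFn_star φ] with p hp
  rw [hp, Pi.star_apply, norm_star]

section Op

variable {P : ℝ} (hP : 0 < P)

/-- Composition with a form-preserving matrix. -/
def compOp {A : Matrix (Fin 4) (Fin 4) ℝ} (hA : Ortho A) : Hilb P →ₗᵢ[ℂ] Hilb P :=
  Lp.compMeasurePreservingₗᵢ ℂ _ (measurePreserving_mulVec hP hA)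

lemma coeFn_compOp {A : Matrix (Fin 4) (Fin 4) ℝ} (hA : Ortho A) (φ : Hilb P) :
    compOp hP hA φ =ᵐ[shellMeasure P] fun p => φ (A.mulVec p) :=
  Lp.coeFn_compMeasurePreserving φ (measurePreserving_mulVec hP hA)

lemma ae_comp (hP : 0 < P) {A : Matrix (Fin 4) (Fin 4) ℝ} (hA : Ortho A) {p : Mink → Prop}
    (h : ∀ᵐ x ∂(shellMeasure P), p x) : ∀ᵐ x ∂(shellMeasure P), p (A.mulVec x) :=
  (measurePreserving_mulVec hP hA).quasiMeasurePreserving.ae h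

lemma compOp_compOp {A B : Matrix (Fin 4) (Fin 4) ℝ} (hA : Ortho A) (hB : Ortho B) (φ : Hilb P) :
    compOp hP hA (compOp hP hB φ) = compOp hP (hB.mul hA) φ := by
  ext1
  filter_upwards [coeFn_compOp hP hA (compOp hP hB φ), ae_comp hP hA (coeFn_compOp hP hB φ),
    coeFn_compOp hP (hB.mul hA) φ] with p h1 h2 h3
  rw [h1, h2, h3, Matrix.mulVec_mulVec]

lemma compOp_congr {A B : Matrix (Fin 4) (Fin 4) ℝ} (hA : Ortho A) (hB : Ortho B) (h : A = B)
    (φ : Hilb P) : compOp hP hA φ = compOp hP hB φ := by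
  subst h; rfl

lemma compOp_one {A : Matrix (Fin 4) (Fin 4) ℝ} (hA : Ortho A) (h : A = 1) (φ : Hilb P) :
    compOp hP hA φ = φ := by
  subst h
  ext1
  filter_upwards [coeFn_compOp hP hA φ] with p h1
  rw [h1, Matrix.one_mulVec]

lemma continuous_compOp {Z : Type*} [TopologicalSpace Z] {A : Z → Matrix (Fin 4) (Fin 4) ℝ}
    (hA : Continuous A) (hO : ∀ z, Ortho (A z)) (φ : Hilb P) :
    Continuous fun z => compOp hP (hO z) φ := by
  have := isLocallyFiniteMeasure_shellMeasure hP
  have hg : Continuous fun z => (⟨fun x : Mink => (A z).mulVec x, continuous_mulVec _⟩ : C(Mink, Mink)) := by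
    refine ContinuousMap.continuous_of_continuous_uncurry _ ?_
    exact Continuous.matrix_mulVec (hA.comp continuous_fst) continuous_snd
  exact Continuous.compMeasurePreservingLp (continuous_const (y := φ)) hg
    (fun z => measurePreserving_mulVec hP (hO z)) (by norm_num)

/-- The one-parameter group `t ↦ U_L(σ t)` on `L²`. -/
def wedgeOp (σ : ℤˣ) (a : Mink) (I : Lorentz) (t : ℝ) : Hilb P →ₗᵢ[ℂ] Hilb P :=
  ((phaseOp P a).comp (compOp hP (ortho_wedgeBoost I (-(((σ : ℤ) : ℝ) * t))))).comp
    (phaseOp P (-a))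

/-- The antiunitary involution `j_L` on `L²`. -/
def wedgeConjOp (a : Mink) (I : Lorentz) (φ : Hilb P) : Hilb P :=
  phaseOp P a (compOp hP (ortho_wedgeRot I) (star (phaseOp P (-a) φ)))

lemma wedgeOp_apply (σ : ℤˣ) (a : Mink) (I : Lorentz) (t : ℝ) (φ : Hilb P) :
    wedgeOp hP σ a I t φ = phaseOp P a (compOp hP (ortho_wedgeBoost I (-(((σ : ℤ) : ℝ) * t)))
      (phaseOp P (-a) φ)) := rfl

lemma phaseOp_compOp_ae {A : Matrix (Fin 4) (Fin 4) ℝ} (hA : Ortho A) (a : Mink) (φ : Hilb P) :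
    phaseOp P a (compOp hP hA φ) =ᵐ[shellMeasure P] fun p => phase a p * φ (A.mulVec p) := by
  filter_upwards [coeFn_phaseOp P a (compOp hP hA φ), coeFn_compOp hP hA φ] with p h1 h2
  rw [h1, h2]

/-- By Lorentz invariance of the form, {p,(1-A)a} = {p,a} - {A⁻¹p,a}: the translation part of U_L(t)
is conjugation of the pure boost by a phase. -/
lemma wedgeOp_ae (σ : ℤˣ) (a : Mink) (I : Lorentz) (t : ℝ) (φ : Hilb P) :
    wedgeOp hP σ a I t φ =ᵐ[shellMeasure P] wedgeGroup a I (((σ : ℤ) : ℝ) * t) φ := by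
  set s := ((σ : ℤ) : ℝ) * t
  filter_upwards [phaseOp_compOp_ae hP (ortho_wedgeBoost I (-s)) a (phaseOp P (-a) φ),
    ae_comp hP (ortho_wedgeBoost I (-s)) (coeFn_phaseOp P (-a) φ)] with p h1 h2
  rw [wedgeOp_apply, h1, h2, wedgeGroup, rep]
  change _ = phase ((1 - wedgeBoost I s).mulVec a) p * φ ((wedgeBoost I s)⁻¹.mulVec p)
  rw [wedgeBoost_inv, Matrix.sub_mulVec, Matrix.one_mulVec, phase_sub_right, ← mul_assoc]
  congr 2
  rw [phase, phase]
  congr 3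
  have := (ortho_wedgeBoost I s).pres ((wedgeBoost I (-s)).mulVec p) (-a)
  rw [Matrix.mulVec_mulVec, wedgeBoost_mul_neg, Matrix.one_mulVec, Matrix.mulVec_neg] at this
  rw [this]

/-- As for the group, except that complex conjugation flips the inner phase; this accounts for the
sign in 1 + IΥI⁻¹. -/
lemma wedgeConjOp_ae (a : Mink) (I : Lorentz) (φ : Hilb P) :
    wedgeConjOp hP a I φ =ᵐ[shellMeasure P] wedgeConj a I φ := by
  filter_upwards [phaseOp_compOp_ae hP (ortho_wedgeRot I) a (star (phaseOp P (-a) φ)),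
    ae_comp hP (ortho_wedgeRot I) (coeFn_phaseOp P (-a) φ),
    ae_comp hP (ortho_wedgeRot I) (Lp.coeFn_star (phaseOp P (-a) φ))] with p h1 h2 h3
  rw [wedgeConjOp, h1, h3, Pi.star_apply, h2, wedgeConj, rep, pct]
  change _ = phase ((1 + wedgeRot I).mulVec a) p * (starRingEnd ℂ) (φ ((wedgeRot I)⁻¹.mulVec p))
  rw [wedgeRot_inv, Matrix.add_mulVec, Matrix.one_mulVec, phase_add_right, ← starRingEnd_apply,
    map_mul, conj_phase, neg_neg, mul_assoc]
  congr 2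
  rw [phase, phase]
  congr 3
  have := (ortho_wedgeRot I).pres ((wedgeRot I).mulVec p) a
  rw [Matrix.mulVec_mulVec, wedgeRot_mul_self, Matrix.one_mulVec] at this
  rw [this]

lemma wedgeConjOp_wedgeConjOp (a : Mink) (I : Lorentz) (φ : Hilb P) :
    wedgeConjOp hP a I (wedgeConjOp hP a I φ) = φ := by
  rw [wedgeConjOp, wedgeConjOp, phaseOp_apply_neg]
  have : star (compOp hP (ortho_wedgeRot I) (star (phaseOp P (-a) φ))) =
      compOp hP (ortho_wedgeRot I) (phaseOp P (-a) φ) := by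
    ext1
    filter_upwards [Lp.coeFn_star (compOp hP (ortho_wedgeRot I) (star (phaseOp P (-a) φ))),
      coeFn_compOp hP (ortho_wedgeRot I) (star (phaseOp P (-a) φ)),
      coeFn_compOp hP (ortho_wedgeRot I) (phaseOp P (-a) φ),
      ae_comp hP (ortho_wedgeRot I) (Lp.coeFn_star (phaseOp P (-a) φ))] with p h1 h2 h3 h4
    rw [h1, Pi.star_apply, h2, h3, h4, Pi.star_apply, star_star]
  rw [this, compOp_compOp, compOp_one hP _ (wedgeRot_mul_self I), phaseOp_neg_apply]

lemma Lorentz.continuous_inv : Continuous fun I : Lorentz => I.1⁻¹ := by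
  have : (fun I : Lorentz => I.1⁻¹) = fun I : Lorentz => I.1.adjugate := by
    ext1 I
    rw [Matrix.inv_def, I.2.2.1]
    simp
  rw [this]
  exact continuous_subtype_val.matrix_adjugate

lemma continuous_boost : Continuous boost := by
  unfold boost
  refine continuous_pi fun i => continuous_pi fun j => ?_
  fin_cases i <;> fin_cases j <;> simp <;> fun_prop

lemma continuous_wedgeBoost : Continuous fun x : Lorentz × ℝ => wedgeBoost x.1 x.2 := by
  unfold wedgeBoost
  exact ((continuous_subtype_val.comp continuous_fst).matrix_mul
    (continuous_boost.comp continuous_snd)).matrix_mul (Lorentz.continuous_inv.comp continuous_fst)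

lemma continuous_wedgeRot : Continuous wedgeRot := by
  unfold wedgeRot
  exact (continuous_subtype_val.matrix_mul continuous_const).matrix_mul Lorentz.continuous_inv

instance : FirstCountableTopology (Matrix (Fin 4) (Fin 4) ℝ) :=
  inferInstanceAs (FirstCountableTopology (Fin 4 → Fin 4 → ℝ))

instance : FirstCountableTopology Lorentz :=
  Topology.IsInducing.subtypeVal.firstCountableTopology

lemma continuous_wedgeOp (σ : ℤˣ) (a : Mink) (φ : Hilb P) :
    Continuous fun x : Lorentz × ℝ => wedgeOp hP σ a x.1 x.2 φ := by
  simp only [wedgeOp_apply]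
  refine (phaseOp P a).continuous.comp (continuous_compOp hP ?_ _ _)
  exact continuous_wedgeBoost.comp (continuous_fst.prodMk (continuous_snd.const_mul _).neg)

lemma wedgeOp_zero (σ : ℤˣ) (a : Mink) (I : Lorentz) (φ : Hilb P) :
    wedgeOp hP σ a I 0 φ = φ := by
  rw [wedgeOp_apply, compOp_one hP _ (by rw [mul_zero, neg_zero, wedgeBoost_zero]),
    phaseOp_neg_apply]

lemma wedgeOp_add (σ : ℤˣ) (a : Mink) (I : Lorentz) (s t : ℝ) (φ : Hilb P) :
    wedgeOp hP σ a I (s + t) φ = wedgeOp hP σ a I s (wedgeOp hP σ a I t φ) := by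
  rw [wedgeOp_apply, wedgeOp_apply, wedgeOp_apply, phaseOp_apply_neg, compOp_compOp]
  congr 1
  apply compOp_congr
  rw [← wedgeBoost_add]
  congr 1
  ring

lemma isoGroup_wedgeOp (σ : ℤˣ) (a : Mink) (I : Lorentz) : IsoGroup (wedgeOp hP σ a I) :=
  ⟨wedgeOp_zero hP σ a I, wedgeOp_add hP σ a I, fun φ => by
    have h := (continuous_wedgeOp hP σ a φ).comp (Continuous.prodMk_right I)
    exact h⟩

lemma unit_sq (σ : ℤˣ) : ((σ : ℤ) : ℝ) * ((σ : ℤ) : ℝ) = 1 := by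
  rcases Int.units_eq_one_or σ with h | h <;> subst h <;> simp

lemma unit_sqC (σ : ℤˣ) : ((σ : ℤ) : ℂ) * ((σ : ℤ) : ℂ) = 1 := by
  rcases Int.units_eq_one_or σ with h | h <;> subst h <;> simp

/-- The substitution z ↦ σz, together with σ² = 1, lets both signs be treated as continuation to
+iπ. -/
lemma analyticGraph_eq (σ : ℤˣ) (a : Mink) (I : Lorentz) :
    analyticGraph P a I (((σ : ℤ) : ℂ) * (Real.pi : ℂ) * Complex.I) =
      closure (entireGraph (wedgeOp hP σ a I)) := by
  rw [analyticGraph]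
  congr 1
  ext x
  constructor
  · rintro ⟨F, hF, h, rfl⟩
    refine ⟨fun z => F (((σ : ℤ) : ℂ) * z), hF.comp (differentiable_id.const_mul _), fun t => ?_, ?_⟩
    · ext1
      have h1 := h (((σ : ℤ) : ℝ) * t)
      have h2 := wedgeOp_ae hP σ a I t (F (((σ : ℤ) : ℂ) * 0))
      simp only [mul_zero] at h2 ⊢
      push_cast at h1
      exact h1.trans h2.symm
    · simp [mul_assoc]
  · rintro ⟨F, hF, h, rfl⟩
    refine ⟨fun z => F (((σ : ℤ) : ℂ) * z), hF.comp (differentiable_id.const_mul _), fun t => ?_, ?_⟩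
    · have h1 := h (((σ : ℤ) : ℝ) * t)
      have h2 := wedgeOp_ae hP σ a I (((σ : ℤ) : ℝ) * t) (F 0)
      rw [← mul_assoc, unit_sq, one_mul] at h2
      push_cast at h1
      simp only [mul_zero]
      rw [h1]
      exact h2
    · simp only [mul_zero, ← mul_assoc, unit_sqC, one_mul]

/-- As j_L is an involution, φ = j_L χ determines χ = j_L φ, so the existential over χ disappears.
-/
lemma modularMapsTo_iff (σ : ℤˣ) (a : Mink) (I : Lorentz) (φ : Hilb P) :
    ModularMapsTo P σ a I φ φ ↔
      (φ, wedgeConjOp hP a I φ) ∈ closure (entireGraph (wedgeOp hP σ a I)) := by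
  rw [ModularMapsTo, analyticGraph_eq hP]
  constructor
  · rintro ⟨χ, h1, h2⟩
    have : φ = wedgeConjOp hP a I χ := by
      ext1
      exact h2.trans (wedgeConjOp_ae hP a I χ).symm
    have h3 : wedgeConjOp hP a I φ = χ := by
      rw [this, wedgeConjOp_wedgeConjOp]
    rwa [h3]
  · intro h
    refine ⟨_, h, ?_⟩
    have := wedgeConjOp_ae hP a I (wedgeConjOp hP a I φ)
    rwa [wedgeConjOp_wedgeConjOp] at this

/-- The condition `s_{L,σ} φ = φ` is closed in `L`. -/
lemma isClosed_gaussOrbit_eq (σ : ℤˣ) (a : Mink) (φ : Hilb P) :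
    IsClosed {I : Lorentz | ∀ m : ℝ, 0 < m →
      gaussOrbit (wedgeOp hP σ a I) m (Real.pi * Complex.I) φ =
      gaussOrbit (wedgeOp hP σ a I) m 0 (wedgeConjOp hP a I φ)} := by
  simp only [ofPred_forall]
  refine isClosed_iInter fun m => isClosed_iInter fun hm => isClosed_eq ?_ ?_
  · refine continuous_of_dominated (bound := fun t : ℝ =>
      ‖gauss m (t - Real.pi * Complex.I)‖ * ‖φ‖) ?_ ?_ ?_ ?_
    · intro I
      exact (integrable_gaussOrbit (isoGroup_wedgeOp hP σ a I) hm _ φ).1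
    · intro I
      refine Eventually.of_forall fun t => ?_
      rw [norm_smul, (wedgeOp hP σ a I t).norm_map]
    · have h := integrable_gauss_smul hm (-Real.pi) (f := fun _ : ℝ => (1 : ℂ))
        aestronglyMeasurable_const (B := 1) (by simp)
      simpa [sub_eq_add_neg] using h.norm.mul_const ‖φ‖
    · refine Eventually.of_forall fun t => ?_
      have h := (continuous_wedgeOp hP σ a φ).comp (Continuous.prodMk_left (X := Lorentz) t)
      exact h.const_smul (gauss m (t - Real.pi * Complex.I))
  · refine continuous_of_dominated (bound := fun t : ℝ => ‖gauss m (t - 0)‖ * ‖φ‖) ?_ ?_ ?_ ?_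
    · intro I
      exact (integrable_gaussOrbit (isoGroup_wedgeOp hP σ a I) hm _ _).1
    · intro I
      refine Eventually.of_forall fun t => ?_
      rw [norm_smul, (wedgeOp hP σ a I t).norm_map, wedgeConjOp, (phaseOp P a).norm_map,
        (compOp hP _).norm_map, norm_star_hilb, (phaseOp P (-a)).norm_map]
    · have h := integrable_gauss_smul hm 0 (f := fun _ : ℝ => (1 : ℂ))
        aestronglyMeasurable_const (B := 1) (by simp)
      simpa using h.norm.mul_const ‖φ‖
    · refine Eventually.of_forall fun t => ?_
      -- The integrand applies an operator depending on I to a vector depending on I. Merging the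
      -- two compositions into one leaves a fixed vector, so that strong continuity of a single
      -- composition suffices.
      have : (fun I : Lorentz => gauss m (t - 0) • (wedgeOp hP σ a I t) (wedgeConjOp hP a I φ)) =
          fun I : Lorentz => gauss m (t - 0) • phaseOp P a (compOp hP
            ((ortho_wedgeRot I).mul (ortho_wedgeBoost I (-(((σ : ℤ) : ℝ) * t))))
            (star (phaseOp P (-a) φ))) := by
        ext1 I
        rw [wedgeOp_apply, wedgeConjOp, phaseOp_apply_neg, compOp_compOp]
      rw [this]
      have h := continuous_wedgeRot.matrix_mul (continuous_wedgeBoost.comp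
        (Continuous.prodMk_left (X := Lorentz) (-(((σ : ℤ) : ℝ) * t))))
      have h2 := (phaseOp P a).continuous.comp (continuous_compOp hP h
        (fun I => (ortho_wedgeRot I).mul (ortho_wedgeBoost I (-(((σ : ℤ) : ℝ) * t))))
        (star (phaseOp P (-a) φ)))
      exact h2.const_smul (gauss m (t - 0))

end Op

/-! ### The bilinear pairing on `L²` -/

section Pairing

variable {P : ℝ}

lemma integrable_mul_hilb (f g : Hilb P) : Integrable (fun p => f p * g p) (shellMeasure P) :=
  (Lp.memLp f).integrable_mul (Lp.memLp g)

lemma integral_mul_hilb_eq (f g : Hilb P) :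
    ∫ p, f p * g p ∂(shellMeasure P) = inner ℂ (star f) g := by
  rw [L2.inner_def]
  refine integral_congr_ae ?_
  filter_upwards [Lp.coeFn_star f] with p hp
  rw [hp]
  simp [mul_comm]

/-- The bilinear pairing `(f, g) ↦ ∫ f g` on `L²`. -/
def pairing (P : ℝ) : Hilb P →L[ℂ] Hilb P →L[ℂ] ℂ :=
  LinearMap.mkContinuous₂ (LinearMap.mk₂ ℂ
    (fun f g : Hilb P => ∫ p, f p * g p ∂(shellMeasure P))
    (fun f f' g => by
      rw [← integral_add (integrable_mul_hilb f g) (integrable_mul_hilb f' g)]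
      refine integral_congr_ae ?_
      filter_upwards [Lp.coeFn_add f f'] with p hp
      rw [hp, Pi.add_apply, add_mul])
    (fun c f g => by
      rw [smul_eq_mul, ← integral_const_mul]
      refine integral_congr_ae ?_
      filter_upwards [Lp.coeFn_smul c f] with p hp
      rw [hp, Pi.smul_apply, smul_eq_mul, mul_assoc])
    (fun f g g' => by
      rw [← integral_add (integrable_mul_hilb f g) (integrable_mul_hilb f g')]
      refine integral_congr_ae ?_
      filter_upwards [Lp.coeFn_add g g'] with p hp
      rw [hp, Pi.add_apply, mul_add])
    (fun c f g => by
      rw [smul_eq_mul, ← integral_const_mul]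
      refine integral_congr_ae ?_
      filter_upwards [Lp.coeFn_smul c g] with p hp
      rw [hp, Pi.smul_apply, smul_eq_mul, mul_left_comm])) 1 (fun f g => by
      rw [LinearMap.mk₂_apply, integral_mul_hilb_eq, one_mul]
      exact (norm_inner_le_norm _ _).trans_eq (by rw [norm_star_hilb]))

lemma pairing_apply (f g : Hilb P) : pairing P f g = ∫ p, f p * g p ∂(shellMeasure P) := rfl

lemma norm_pairing_le (f g : Hilb P) : ‖pairing P f g‖ ≤ ‖f‖ * ‖g‖ := by
  rw [pairing_apply, integral_mul_hilb_eq]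
  exact (norm_inner_le_norm _ _).trans_eq (by rw [norm_star_hilb])

end Pairing

/-! ### Schwartz functions on momentum space -/

lemma iteratedDeriv_cexp_I (n : ℕ) : iteratedDeriv n (fun t : ℝ => Complex.exp (Complex.I * t)) =
    fun t : ℝ => Complex.I ^ n * Complex.exp (Complex.I * t) := by
  induction n with
  | zero => simp
  | succ n ih =>
    rw [iteratedDeriv_succ, ih]
    ext t
    have h1 : HasDerivAt (fun t : ℝ => Complex.I * (t : ℂ)) Complex.I t := by
      simpa using (Complex.ofRealCLM.hasDerivAt (x := t)).const_mul Complex.I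
    rw [((h1.cexp).const_mul (Complex.I ^ n)).deriv]
    ring

lemma hasTemperateGrowth_phase (a : Mink) : (phase a).HasTemperateGrowth := by
  have h1 : (fun t : ℝ => Complex.exp (Complex.I * t)).HasTemperateGrowth := by
    refine ⟨?_, fun n => ⟨0, 1, fun t => ?_⟩⟩
    · exact (contDiff_const.mul Complex.ofRealCLM.contDiff).cexp
    · rw [norm_iteratedFDeriv_eq_norm_iteratedDeriv, iteratedDeriv_cexp_I, norm_mul, norm_pow,
        Complex.norm_I, one_pow, mul_comm Complex.I, Complex.norm_exp_ofReal_mul_I]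
      simp
  set ℓ : Mink →ₗ[ℝ] ℝ :=
    { toFun := fun p => form p a
      map_add' := fun p q => form_add_left p q a
      map_smul' := fun c p => form_smul_left c p a } with hℓ
  have h2 := h1.comp ℓ.toContinuousLinearMap.hasTemperateGrowth
  exact h2

/-- Multiplication of a Schwartz function by a phase. -/
lemma exists_schwartz_phase (a : Mink) (Ψ : SchwartzMap Mink ℂ) :
    ∃ Φ : SchwartzMap Mink ℂ, ∀ p, Φ p = phase a p * Ψ p :=
  ⟨SchwartzMap.smulLeftCLM ℂ (phase a) Ψ, fun p => by
    rw [SchwartzMap.smulLeftCLM_apply_apply (hasTemperateGrowth_phase a), smul_eq_mul]⟩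

-- The largest absolute row sum of Λ(t) is cosh t + |sinh t| = e^{|t|}; the conjugation by I
-- contributes the constant.
open scoped Matrix.Norms.Operator in
lemma exists_norm_wedgeBoost_le (I : Lorentz) : ∃ N : ℝ, 0 ≤ N ∧ ∀ (t : ℝ) (x : Mink),
    ‖(wedgeBoost I t).mulVec x‖ ≤ N * Real.exp |t| * ‖x‖ := by
  have hb : ∀ t, ‖boost t‖ ≤ Real.exp |t| := by
    intro t
    have h1 : Real.cosh t + |Real.sinh t| ≤ Real.exp |t| := by
      rw [Real.abs_sinh, ← Real.cosh_abs, Real.cosh_add_sinh]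
    have h2 : 1 ≤ Real.exp |t| := Real.one_le_exp (abs_nonneg t)
    rw [Matrix.linfty_opNorm_def]
    have h3 : ∀ i : Fin 4, ((∑ j, ‖boost t i j‖₊ : NNReal) : ℝ) ≤ Real.exp |t| := by
      intro i
      push_cast
      have := Real.cosh_pos t
      fin_cases i <;> simp [boost, Fin.sum_univ_four, abs_of_pos this] <;> linarith
    have h4 : (Finset.univ.sup fun i : Fin 4 => ∑ j, ‖boost t i j‖₊) ≤
        ⟨Real.exp |t|, (Real.exp_pos _).le⟩ := by
      refine Finset.sup_le fun i _ => ?_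
      exact_mod_cast h3 i
    exact_mod_cast h4
  refine ⟨‖I.1‖ * ‖I.1⁻¹‖, by positivity, fun t x => ?_⟩
  refine (Matrix.linfty_opNorm_mulVec _ _).trans ?_
  refine mul_le_mul_of_nonneg_right ?_ (norm_nonneg _)
  calc ‖I.1 * boost t * I.1⁻¹‖ ≤ ‖I.1‖ * ‖boost t‖ * ‖I.1⁻¹‖ :=
        (norm_mul_le _ _).trans (mul_le_mul_of_nonneg_right (norm_mul_le _ _) (norm_nonneg _))
    _ ≤ ‖I.1‖ * Real.exp |t| * ‖I.1⁻¹‖ := by gcongr; exact hb t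
    _ = _ := by ring

/-- A matrix as a continuous linear map. -/
def mulVecL (A : Matrix (Fin 4) (Fin 4) ℝ) : Mink →L[ℝ] Mink :=
  (Matrix.toLin' A).toContinuousLinearMap

lemma mulVecL_apply (A : Matrix (Fin 4) (Fin 4) ℝ) (x : Mink) : mulVecL A x = A.mulVec x := by
  simp [mulVecL]

/-- Each power of ‖x‖ and each derivative costs one factor N e^{|t|} under the boost, and the weight
e^{-t²} beats all of them. The weighted boosted functions are thus bounded in every Schwartz
seminorm, uniformly in t. -/
lemma exists_boosted_bound (I : Lorentz) (Φ : SchwartzMap Mink ℂ) (j k : ℕ) :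
    ∃ C : ℝ, ∀ (t : ℝ) (x : Mink), ‖x‖ ^ j * ‖iteratedFDeriv ℝ k
      (fun y => ((Real.exp (-t ^ 2) : ℝ) : ℂ) * Φ ((wedgeBoost I t).mulVec y)) x‖ ≤ C := by
  obtain ⟨N, hN, hb⟩ := exists_norm_wedgeBoost_le I
  set s := SchwartzMap.seminorm ℝ j k Φ with hs
  have hs0 : 0 ≤ s := apply_nonneg _ _
  refine ⟨N ^ (j + k) * Real.exp (((j + k : ℕ) : ℝ) ^ 2) * s, fun t x => ?_⟩
  set L := mulVecL (wedgeBoost I t) with hL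
  have hcd : ContDiff ℝ k (Φ ∘ L) := (Φ.smooth k).comp L.contDiff
  have h1 : iteratedFDeriv ℝ k
      (fun y => ((Real.exp (-t ^ 2) : ℝ) : ℂ) * Φ ((wedgeBoost I t).mulVec y)) x =
      ((Real.exp (-t ^ 2) : ℝ) : ℂ) • (iteratedFDeriv ℝ k Φ (L x)).compContinuousLinearMap
        fun _ => L := by
    have e : (fun y => ((Real.exp (-t ^ 2) : ℝ) : ℂ) * Φ ((wedgeBoost I t).mulVec y)) =
        ((Real.exp (-t ^ 2) : ℝ) : ℂ) • (Φ ∘ L) := by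
      ext y; simp [hL, mulVecL_apply]
    rw [e, iteratedFDeriv_const_smul_apply hcd.contDiffAt,
      L.iteratedFDeriv_comp_right (Φ.smooth k) x le_rfl]
  have hLn : ‖L‖ ≤ N * Real.exp |t| := L.opNorm_le_bound (by positivity) fun y => by
    rw [hL, mulVecL_apply]; exact hb t y
  have hx : ‖x‖ ≤ N * Real.exp |t| * ‖L x‖ := by
    have h2 := hb (-t) (L x)
    rw [hL, mulVecL_apply, Matrix.mulVec_mulVec, ← wedgeBoost_add, neg_add_cancel,
      wedgeBoost_zero, Matrix.one_mulVec, abs_neg] at h2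
    rw [hL, mulVecL_apply]; exact h2
  have h3 : ‖iteratedFDeriv ℝ k (fun y => ((Real.exp (-t ^ 2) : ℝ) : ℂ) *
      Φ ((wedgeBoost I t).mulVec y)) x‖ ≤
      Real.exp (-t ^ 2) * (‖iteratedFDeriv ℝ k Φ (L x)‖ * (N * Real.exp |t|) ^ k) := by
    rw [h1, norm_smul, Complex.norm_real, Real.norm_of_nonneg (Real.exp_pos _).le]
    refine mul_le_mul_of_nonneg_left ?_ (Real.exp_pos _).le
    refine (ContinuousMultilinearMap.norm_compContinuousLinearMap_le _ _).trans ?_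
    rw [Finset.prod_const, Finset.card_univ, Fintype.card_fin]
    gcongr
  have h4 := SchwartzMap.le_seminorm ℝ j k Φ (L x)
  -- Completing the square in |t| bounds -t² + (j+k)|t| by (j+k)².
  have h5 : Real.exp (-t ^ 2) * Real.exp |t| ^ (j + k) ≤ Real.exp (((j + k : ℕ) : ℝ) ^ 2) := by
    rw [← Real.exp_nat_mul, ← Real.exp_add]
    refine Real.exp_le_exp.2 ?_
    have := sq_abs t
    nlinarith [sq_nonneg (((j + k : ℕ) : ℝ) - |t|)]
  calc ‖x‖ ^ j * _ ≤ (N * Real.exp |t| * ‖L x‖) ^ j *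
        (Real.exp (-t ^ 2) * (‖iteratedFDeriv ℝ k Φ (L x)‖ * (N * Real.exp |t|) ^ k)) := by
        gcongr
    _ = N ^ (j + k) * (Real.exp (-t ^ 2) * Real.exp |t| ^ (j + k)) *
        (‖L x‖ ^ j * ‖iteratedFDeriv ℝ k Φ (L x)‖) := by
        rw [mul_pow, mul_pow, mul_pow, pow_add, pow_add]; ring
    _ ≤ N ^ (j + k) * Real.exp (((j + k : ℕ) : ℝ) ^ 2) * s := by
        gcongr

/-- A summable superposition of boosted Schwartz functions is a Schwartz function. -/
lemma exists_schwartz_superposition (I : Lorentz) (Φ : SchwartzMap Mink ℂ) (d : ℝ → ℂ)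
    (hd : Summable fun t => ‖d t‖) : ∃ Ψ : SchwartzMap Mink ℂ, ∀ x, Ψ x =
      ∑' t : ℝ, d t * (((Real.exp (-t ^ 2) : ℝ) : ℂ) * Φ ((wedgeBoost I t).mulVec x)) := by
  choose C hC using exists_boosted_bound I Φ
  set g : ℝ → Mink → ℂ := fun t x =>
    d t * (((Real.exp (-t ^ 2) : ℝ) : ℂ) * Φ ((wedgeBoost I t).mulVec x)) with hg
  have hcd0 : ∀ t, ContDiff ℝ (⊤ : ℕ∞) fun y =>
      ((Real.exp (-t ^ 2) : ℝ) : ℂ) * Φ ((wedgeBoost I t).mulVec y) := by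
    intro t
    have h := (Φ.smooth (⊤ : ℕ∞)).comp (mulVecL (wedgeBoost I t)).contDiff
    have h2 := (contDiff_const (c := ((Real.exp (-t ^ 2) : ℝ) : ℂ))).mul h
    convert! h2 using 3
  have hcd : ∀ t, ContDiff ℝ (⊤ : ℕ∞) (g t) := fun t => contDiff_const.mul (hcd0 t)
  have hbd : ∀ (j k : ℕ) t x, ‖x‖ ^ j * ‖iteratedFDeriv ℝ k (g t) x‖ ≤ ‖d t‖ * C j k := by
    intro j k t x
    have e : g t = d t • fun y => ((Real.exp (-t ^ 2) : ℝ) : ℂ) *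
        Φ ((wedgeBoost I t).mulVec y) := by
      ext y; simp [hg]
    rw [e, iteratedFDeriv_const_smul_apply ((hcd0 t).of_le (by exact_mod_cast le_top)).contDiffAt,
      norm_smul, mul_left_comm]
    exact mul_le_mul_of_nonneg_left (hC j k t x) (norm_nonneg _)
  have hbd0 : ∀ (k : ℕ) t x, (k : ℕ∞) ≤ (⊤ : ℕ∞) →
      ‖iteratedFDeriv ℝ k (g t) x‖ ≤ ‖d t‖ * C 0 k := by
    intro k t x _
    simpa using hbd 0 k t x
  have hsum : ∀ k : ℕ, (k : ℕ∞) ≤ (⊤ : ℕ∞) → Summable fun t => ‖d t‖ * C 0 k :=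
    fun k _ => hd.mul_right _
  refine ⟨⟨fun x => ∑' t, g t x, contDiff_tsum hcd hsum hbd0, fun j k =>
    ⟨∑' t, ‖d t‖ * C j k, fun x => ?_⟩⟩, fun x => rfl⟩
  rw [iteratedFDeriv_tsum_apply hcd hsum hbd0 le_top, ← Real.norm_of_nonneg
    (pow_nonneg (norm_nonneg x) j), ← norm_smul]
  have hs : Summable fun t => iteratedFDeriv ℝ k (g t) x :=
    Summable.of_norm_bounded (hsum k le_top) fun t => hbd0 k t x le_top
  rw [← hs.tsum_const_smul]
  refine tsum_of_norm_bounded (hd.mul_right _).hasSum fun t => ?_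
  rw [norm_smul, Real.norm_of_nonneg (pow_nonneg (norm_nonneg x) j)]
  exact hbd j k t x

/-! ### Uniform boundedness for boosted test functions -/

/-- The Banach space of absolutely summable families indexed by rapidities. -/
abbrev SumFam : Type := lp (fun _ : ℝ => ℂ) 1

lemma SumFam.summable (d : SumFam) : Summable fun t => ‖d t‖ := by
  have := (lp.memℓp d).summable (by norm_num)
  simpa using this

lemma SumFam.norm_eq (d : SumFam) : ‖d‖ = ∑' t, ‖d t‖ := by
  have := lp.norm_eq_tsum_rpow (by norm_num) d
  simpa using this

/-- The superposition of boosted test functions. -/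
def superpose (I : Lorentz) (Φ : SchwartzMap Mink ℂ) (d : ℝ → ℂ) (x : Mink) : ℂ :=
  ∑' t : ℝ, d t * (((Real.exp (-t ^ 2) : ℝ) : ℂ) * Φ ((wedgeBoost I t).mulVec x))

lemma exists_bound_schwartz (Φ : SchwartzMap Mink ℂ) : ∃ C : ℝ, 0 ≤ C ∧ ∀ x, ‖Φ x‖ ≤ C :=
  ⟨_, apply_nonneg _ _, fun x => SchwartzMap.norm_le_seminorm ℝ Φ x⟩

lemma norm_superpose_term_le (I : Lorentz) (Φ : SchwartzMap Mink ℂ) {C : ℝ}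
    (hC : ∀ x, ‖Φ x‖ ≤ C) (d : ℝ → ℂ) (x : Mink) (t : ℝ) :
    ‖d t * (((Real.exp (-t ^ 2) : ℝ) : ℂ) * Φ ((wedgeBoost I t).mulVec x))‖ ≤ ‖d t‖ * C := by
  rw [norm_mul, norm_mul, Complex.norm_real, Real.norm_of_nonneg (Real.exp_pos _).le]
  refine mul_le_mul_of_nonneg_left ?_ (norm_nonneg _)
  have h1 : Real.exp (-t ^ 2) ≤ 1 := Real.exp_le_one_iff.2 (by nlinarith [sq_nonneg t])
  exact (mul_le_of_le_one_left (norm_nonneg _) h1).trans (hC _)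

lemma summable_superpose (I : Lorentz) (Φ : SchwartzMap Mink ℂ) (d : SumFam) (x : Mink) :
    Summable fun t : ℝ =>
      d t * (((Real.exp (-t ^ 2) : ℝ) : ℂ) * Φ ((wedgeBoost I t).mulVec x)) := by
  obtain ⟨C, _, hC⟩ := exists_bound_schwartz Φ
  exact Summable.of_norm_bounded (d.summable.mul_right C)
    fun t => norm_superpose_term_le I Φ hC d x t

lemma superpose_add (I : Lorentz) (Φ : SchwartzMap Mink ℂ) (d e : SumFam) (x : Mink) :
    superpose I Φ (d + e : SumFam) x = superpose I Φ d x + superpose I Φ e x := by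
  rw [superpose, superpose, superpose,
    ← (summable_superpose I Φ d x).tsum_add (summable_superpose I Φ e x)]
  refine tsum_congr fun t => ?_
  rw [lp.coeFn_add, Pi.add_apply, add_mul]

lemma superpose_smul (I : Lorentz) (Φ : SchwartzMap Mink ℂ) (c : ℂ) (d : SumFam) (x : Mink) :
    superpose I Φ (c • d : SumFam) x = c * superpose I Φ d x := by
  rw [superpose, superpose, ← tsum_mul_left]
  refine tsum_congr fun t => ?_
  rw [lp.coeFn_smul, Pi.smul_apply, smul_eq_mul, mul_assoc]

lemma norm_superpose_le (I : Lorentz) (Φ : SchwartzMap Mink ℂ) {C : ℝ}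
    (hC : ∀ x, ‖Φ x‖ ≤ C) (d : SumFam) (x : Mink) : ‖superpose I Φ d x‖ ≤ C * ‖d‖ := by
  rw [mul_comm, SumFam.norm_eq, ← tsum_mul_right]
  exact tsum_of_norm_bounded (d.summable.mul_right C).hasSum
    fun t => norm_superpose_term_le I Φ hC d x t

lemma superpose_single (I : Lorentz) (Φ : SchwartzMap Mink ℂ) (s : ℝ) (x : Mink) :
    superpose I Φ (lp.single 1 s (1 : ℂ) : SumFam) x =
      ((Real.exp (-s ^ 2) : ℝ) : ℂ) * Φ ((wedgeBoost I s).mulVec x) := by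
  rw [superpose, tsum_eq_single s]
  · simp
  · intro t ht
    simp [ht]

lemma integrableOn_ball_of_schwartz {μ : Measure Mink} {f : Mink → ℂ}
    (h : ∀ Ψ : SchwartzMap Mink ℂ, Integrable (fun p => f p * Ψ p) μ) (r : ℝ) :
    IntegrableOn f (Metric.ball 0 r) μ := by
  let b : ContDiffBump (0 : Mink) :=
    ⟨max r 1, max r 1 + 1, lt_of_lt_of_le one_pos (le_max_right _ _), by linarith⟩
  have hcs : HasCompactSupport fun x : Mink => ((b x : ℝ) : ℂ) :=
    b.hasCompactSupport.comp_left (g := Complex.ofReal) Complex.ofReal_zero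
  have hcd : ContDiff ℝ (⊤ : ℕ∞) fun x : Mink => ((b x : ℝ) : ℂ) :=
    Complex.ofRealCLM.contDiff.comp b.contDiff
  have h1 := (h (hcs.toSchwartzMap hcd)).integrableOn (s := Metric.ball 0 r)
  refine h1.congr_fun_ae ?_
  filter_upwards [ae_restrict_mem measurableSet_ball] with x hx
  have : b x = 1 := b.one_of_mem_closedBall
    (Metric.ball_subset_closedBall (Metric.ball_subset_ball (le_max_left _ _) hx))
  simp [this]

/-- A superposition of boosted, Gaussian weighted test functions with ℓ¹ coefficients is again a
Schwartz function, so the functionals d ↦ ∫ f_θ · (superposition) on ℓ¹ are pointwise bounded in θ.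
Banach–Steinhaus bounds their norms uniformly; evaluation at the unit vector at t gives the factor
e^{t²}. -/
lemma exists_growth_bound {μ : Measure Mink} {Θ : Set ℝ} {f : ℝ → Mink → ℂ}
    (hint : ∀ θ ∈ Θ, ∀ Ψ : SchwartzMap Mink ℂ, Integrable (fun p => f θ p * Ψ p) μ)
    (hbdd : ∀ Ψ : SchwartzMap Mink ℂ, ∃ B, ∀ θ ∈ Θ, ‖∫ p, f θ p * Ψ p ∂μ‖ ≤ B)
    (I : Lorentz) (Φ : SchwartzMap Mink ℂ) :
    ∃ C, ∀ θ ∈ Θ, ∀ t : ℝ,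
      ‖∫ p, f θ p * Φ ((wedgeBoost I t).mulVec p) ∂μ‖ ≤ C * Real.exp (t ^ 2) := by
  obtain ⟨C₀, hC₀, hC⟩ := exists_bound_schwartz Φ
  have hsch : ∀ d : SumFam, ∃ Ψ : SchwartzMap Mink ℂ, ∀ x, Ψ x = superpose I Φ d x := fun d =>
    exists_schwartz_superposition I Φ d d.summable
  have hint' : ∀ θ ∈ Θ, ∀ d : SumFam, Integrable (fun p => f θ p * superpose I Φ d p) μ := by
    intro θ hθ d
    obtain ⟨Ψ, hΨ⟩ := hsch d
    simpa only [hΨ] using hint θ hθ Ψ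
  have hball : ∀ θ ∈ Θ, ∀ n : ℕ, IntegrableOn (f θ) (Metric.ball 0 n) μ := fun θ hθ n =>
    integrableOn_ball_of_schwartz (hint θ hθ) n
  -- Integrability of f_θ against Schwartz functions gives no direct norm bound on the full
  -- functional. The truncations to balls are bounded because f_θ is integrable there, and a
  -- pointwise limit of continuous functionals on a Banach space is continuous.
  let T₀ : ∀ θ ∈ Θ, ℕ → SumFam →L[ℂ] ℂ := fun θ hθ n =>
    LinearMap.mkContinuous
      { toFun := fun d => ∫ p in Metric.ball 0 n, f θ p * superpose I Φ d p ∂μ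
        map_add' := fun d e => by
          rw [← integral_add (hint' θ hθ d).integrableOn (hint' θ hθ e).integrableOn]
          simp only [superpose_add, mul_add]
        map_smul' := fun c d => by
          rw [RingHom.id_apply, smul_eq_mul, ← integral_const_mul]
          simp only [superpose_smul, mul_left_comm] }
      ((∫ p in Metric.ball 0 n, ‖f θ p‖ ∂μ) * C₀) (fun d => by
        simp only [LinearMap.coe_mk, AddHom.coe_mk]
        rw [mul_assoc, ← integral_mul_const]
        refine norm_integral_le_of_norm_le ((hball θ hθ n).norm.mul_const _)
          (Eventually.of_forall fun p => ?_)
        rw [norm_mul]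
        exact mul_le_mul_of_nonneg_left (norm_superpose_le I Φ hC d p) (norm_nonneg _))
  have hlim : ∀ θ (hθ : θ ∈ Θ), Tendsto (fun n d => T₀ θ hθ n d) atTop
      (𝓝 fun d : SumFam => ∫ p, f θ p * superpose I Φ d p ∂μ) := by
    intro θ hθ
    rw [tendsto_pi_nhds]
    intro d
    have hU : (⋃ n : ℕ, Metric.ball (0 : Mink) n) = univ := Metric.iUnion_ball_nat 0
    have h := tendsto_setIntegral_of_monotone (μ := μ)
      (f := fun p => f θ p * superpose I Φ d p)
      (s := fun n : ℕ => Metric.ball (0 : Mink) n) (fun n => measurableSet_ball)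
      (fun m n hmn => Metric.ball_subset_ball (by exact_mod_cast hmn))
      (hint' θ hθ d).integrableOn
    rw [hU, setIntegral_univ] at h
    exact h
  let T : Θ → SumFam →L[ℂ] ℂ := fun θ => continuousLinearMapOfTendsto _ (hlim θ.1 θ.2)
  have hT : ∀ (θ : Θ) d, T θ d = ∫ p, f θ.1 p * superpose I Φ d p ∂μ := fun θ d => rfl
  obtain ⟨C, hTC⟩ := banach_steinhaus (g := T) (fun d => by
    obtain ⟨Ψ, hΨ⟩ := hsch d
    obtain ⟨B, hB⟩ := hbdd Ψ
    refine ⟨B, fun θ => ?_⟩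
    rw [hT]
    simpa only [hΨ] using hB θ.1 θ.2)
  refine ⟨C, fun θ hθ t => ?_⟩
  have h1 := (T ⟨θ, hθ⟩).le_opNorm (lp.single 1 t (1 : ℂ))
  rw [hT, lp.norm_single (by norm_num), norm_one, mul_one] at h1
  have h2 := h1.trans (hTC ⟨θ, hθ⟩)
  have e : ∀ p, f θ p * superpose I Φ (lp.single 1 t (1 : ℂ) : SumFam) p =
      ((Real.exp (-t ^ 2) : ℝ) : ℂ) * (f θ p * Φ ((wedgeBoost I t).mulVec p)) := fun p => by
    rw [superpose_single, mul_left_comm]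
  simp only [e] at h2
  rw [integral_const_mul, norm_mul, Complex.norm_real, Real.norm_of_nonneg (Real.exp_pos _).le,
    Real.exp_neg] at h2
  rw [← div_le_iff₀ (Real.exp_pos _), div_eq_inv_mul]
  exact h2

/-! ### Complex orbits -/

lemma differentiable_boostC_mulVec (ζ : MinkC) : Differentiable ℂ fun τ => (boostC τ).mulVec ζ := by
  have h : (fun τ => (boostC τ).mulVec ζ) = fun τ => ![Complex.cosh τ * ζ 0 - Complex.sinh τ * ζ 3,
      ζ 1, ζ 2, -Complex.sinh τ * ζ 0 + Complex.cosh τ * ζ 3] := by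
    ext τ i
    fin_cases i <;> simp [boostC, Matrix.mulVec, dotProduct, Fin.sum_univ_four]
    ring
  rw [h, differentiable_pi]
  intro i
  fin_cases i <;> simp

lemma differentiable_mulVecC (A : Matrix (Fin 4) (Fin 4) ℂ) :
    Differentiable ℂ fun ζ : MinkC => A.mulVec ζ :=
  (Matrix.toLin' A).toContinuousLinearMap.differentiable

lemma differentiable_wedgeBoostC_mulVec (I : Lorentz) (ζ : MinkC) :
    Differentiable ℂ fun τ => (wedgeBoostC I τ).mulVec ζ := by
  have h : (fun τ => (wedgeBoostC I τ).mulVec ζ) = fun τ => (I.1.map Complex.ofReal).mulVec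
      ((boostC τ).mulVec ((I.1⁻¹.map Complex.ofReal).mulVec ζ)) := by
    ext1 τ
    rw [wedgeBoostC, Matrix.mulVec_mulVec, Matrix.mulVec_mulVec, Matrix.mul_assoc]
  rw [h]
  exact (differentiable_mulVecC _).comp (differentiable_boostC_mulVec _)

lemma differentiable_orbit (I : Lorentz) (p : Mink) : Differentiable ℂ fun τ => orbit I τ p := by
  have h : (fun τ => orbit I τ p) = fun τ => (wedgeBoostC I (-τ)).mulVec (toC p) := by
    ext1 τ; exact orbit_eq I τ p
  rw [h]
  exact (differentiable_wedgeBoostC_mulVec I _).comp differentiable_neg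

lemma continuous_boostC : Continuous boostC := by
  unfold boostC
  refine continuous_pi fun i => continuous_pi fun j => ?_
  fin_cases i <;> fin_cases j <;> simp <;> fun_prop

lemma continuous_map_ofReal : Continuous fun A : Matrix (Fin 4) (Fin 4) ℝ =>
    A.map Complex.ofReal :=
  continuous_id.matrix_map Complex.continuous_ofReal

lemma continuous_wedgeBoostC {X : Type*} [TopologicalSpace X] {f : X → Lorentz} {g : X → ℂ}
    (hf : Continuous f) (hg : Continuous g) : Continuous fun x => wedgeBoostC (f x) (g x) := by
  unfold wedgeBoostC
  exact ((continuous_map_ofReal.comp (continuous_subtype_val.comp hf)).matrix_mul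
    (continuous_boostC.comp hg)).matrix_mul
      (continuous_map_ofReal.comp (Lorentz.continuous_inv.comp hf))

lemma continuous_toC : Continuous toC := by
  unfold toC; fun_prop

lemma continuous_orbit {X : Type*} [TopologicalSpace X] {f : X → Lorentz} {g : X → ℂ}
    {h : X → Mink} (hf : Continuous f) (hg : Continuous g) (hh : Continuous h) :
    Continuous fun x => orbit (f x) (g x) (h x) := by
  have e : (fun x => orbit (f x) (g x) (h x)) =
      fun x => (wedgeBoostC (f x) (-g x)).mulVec (toC (h x)) := by
    ext1 x; exact orbit_eq _ _ _
  rw [e]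
  exact (continuous_wedgeBoostC hf hg.neg).matrix_mulVec (continuous_toC.comp hh)

lemma isClosed_massShell {P : ℝ} (hP : 0 < P) : IsClosed (massShell P) := by
  have h : massShell P = {p | form p p = P} ∩ {p | 0 ≤ p 0} := by
    ext p
    constructor
    · rintro ⟨h1, h2⟩; exact ⟨h1, h2.le⟩
    · rintro ⟨h1, h2⟩
      refine ⟨h1, lt_of_le_of_ne h2 fun h0 => ?_⟩
      have h1' : form p p = P := h1
      rw [form_self_eq, ← h0] at h1'
      nlinarith [sq_nonneg (spatialNorm p)]
  rw [h]
  have hc : Continuous fun p : Mink => form p p := by unfold form; fun_prop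
  exact (isClosed_eq hc continuous_const).inter (isClosed_le continuous_const (continuous_apply 0))

lemma unit_mul_mul (σ : ℤˣ) (x : ℝ) : ((σ : ℤ) : ℝ) * (((σ : ℤ) : ℝ) * x) = x := by
  rw [← mul_assoc, unit_sq, one_mul]

lemma im_unit_mul (σ : ℤˣ) (τ : ℂ) : (((σ : ℤ) : ℂ) * τ).im = ((σ : ℤ) : ℝ) * τ.im := by
  simp

lemma mem_openStrip_iff (σ : ℤˣ) (τ : ℂ) : ((σ : ℤ) : ℂ) * τ ∈ openStrip σ ↔ τ ∈ strip := by
  simp only [openStrip, mem_ofPred_eq, im_unit_mul, unit_mul_mul]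
  rfl

lemma mem_closedStrip_iff (σ : ℤˣ) (τ : ℂ) :
    ((σ : ℤ) : ℂ) * τ ∈ closedStrip σ ↔ τ.im ∈ Icc 0 Real.pi := by
  simp only [closedStrip, mem_ofPred_eq, im_unit_mul, unit_mul_mul]
  rfl

section Manifold

variable {P : ℝ} {n : ℕ} (K : PolyhedralRegion n) (σ : ℤˣ) (i : Fin n)

lemma orbit_mem_cplxManifold {I : Lorentz} (hI : I ∈ interior (K.X i)) {τ : ℂ} (hτ : τ ∈ strip)
    {p : Mink} (hp : p ∈ massShell P) : orbit I (((σ : ℤ) : ℂ) * τ) p ∈ cplxManifold P K σ i :=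
  ⟨orbit_mem_massShellC I _ hp, p, hp, _, (mem_openStrip_iff σ τ).2 hτ, I, hI, rfl⟩

lemma orbit_lower (I : Lorentz) (t : ℝ) (p : Mink) : orbit I (((σ : ℤ) : ℂ) * t) p =
    toC ((wedgeBoost I (-(((σ : ℤ) : ℝ) * t))).mulVec p) := by
  rw [← orbit_ofReal]; push_cast; rfl

lemma orbit_shift (I : Lorentz) (τ : ℂ) (t : ℝ) (p : Mink) :
    orbit I (((σ : ℤ) : ℂ) * (τ + t)) p =
      orbit I (((σ : ℤ) : ℂ) * τ) ((wedgeBoost I (-(((σ : ℤ) : ℝ) * t))).mulVec p) := by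
  rw [← orbit_add]; push_cast; rw [mul_add]

lemma orbit_upper (I : Lorentz) (t : ℝ) (p : Mink) :
    orbit I (((σ : ℤ) : ℂ) * (t + Real.pi * Complex.I)) p =
    -toC ((wedgeRot I).mulVec ((wedgeBoost I (-(((σ : ℤ) : ℝ) * t))).mulVec p)) := by
  rw [add_comm, orbit_shift, ← orbit_pi I σ, mul_assoc]

lemma orbit_mem (hP : 0 < P) {I : Lorentz} (hI : I ∈ interior (K.X i)) {τ : ℂ} (hτ : τ.im ∈ Icc 0 Real.pi)
    {p : Mink} (hp : p ∈ massShell P) :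
    orbit I (((σ : ℤ) : ℂ) * τ) p ∈ cplxManifold P K σ i ∪ realPoints P := by
  have hA : ∀ t : ℝ, (wedgeBoost I t).mulVec p ∈ massShell P := fun t =>
    (ortho_wedgeBoost I t).massShell hP hp
  rcases eq_or_lt_of_le hτ.1 with h0 | h0
  · right
    have e : τ = (τ.re : ℂ) := Complex.ext rfl (by simp [← h0])
    rw [e, orbit_lower]
    exact ⟨_, hA _, Or.inl rfl⟩
  rcases eq_or_lt_of_le hτ.2 with h1 | h1
  · right
    have e : τ = (τ.re : ℂ) + Real.pi * Complex.I := Complex.ext (by simp) (by simp [h1])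
    rw [e, orbit_upper]
    exact ⟨_, (ortho_wedgeRot I).massShell hP (hA _), Or.inr rfl⟩
  · left
    exact orbit_mem_cplxManifold K σ i hI ⟨h0, h1⟩ hp

end Manifold

lemma HolomorphicOn.continuousOn {f : MinkC → ℂ} {M : Set MinkC} (hf : HolomorphicOn f M) :
    ContinuousOn f M := by
  intro ζ hζ
  obtain ⟨U, hU, hζU, g, hg, hfg⟩ := hf ζ hζ
  have h1 : ContinuousWithinAt g M ζ :=
    ((hg.differentiableAt (hU.mem_nhds hζU)).continuousAt).continuousWithinAt
  refine h1.congr_of_eventuallyEq ?_ (hfg ⟨hζU, hζ⟩)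
  filter_upwards [inter_mem_nhdsWithin M (hU.mem_nhds hζU)] with x hx
  exact hfg ⟨hx.2, hx.1⟩

lemma HolomorphicOn.differentiableOn_comp {f : MinkC → ℂ} {M : Set MinkC}
    (hf : HolomorphicOn f M) {γ : ℂ → MinkC} (hγ : Differentiable ℂ γ) {S : Set ℂ}
    (hS : IsOpen S) (hM : ∀ τ ∈ S, γ τ ∈ M) : DifferentiableOn ℂ (fun τ => f (γ τ)) S := by
  intro τ hτ
  obtain ⟨U, hU, hζU, g, hg, hfg⟩ := hf (γ τ) (hM τ hτ)
  have h1 : DifferentiableAt ℂ (fun τ => g (γ τ)) τ :=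
    (hg.differentiableAt (hU.mem_nhds hζU)).comp τ (hγ τ)
  refine (h1.congr_of_eventuallyEq ?_).differentiableWithinAt
  filter_upwards [hS.mem_nhds hτ, hγ.continuous.continuousAt.preimage_mem_nhds (hU.mem_nhds hζU)]
    with z hz1 hz2
  exact hfg ⟨hz2, hM z hz1⟩

lemma integral_comp_mulVec {P : ℝ} (hP : 0 < P) {A : Matrix (Fin 4) (Fin 4) ℝ} (hA : Ortho A)
    {E : Type*} [NormedAddCommGroup E] [NormedSpace ℝ E]
    (f : Mink → E) : ∫ p, f (A.mulVec p) ∂(shellMeasure P) = ∫ p, f p ∂(shellMeasure P) := by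
  refine (measurePreserving_mulVec hP hA).integral_comp ?_ f
  refine (continuous_mulVec A).measurableEmbedding fun x y h => ?_
  have := congrArg (A⁻¹.mulVec ·) h
  simpa [Matrix.mulVec_mulVec, hA.exists_inv.2] using this

/-- An `L²` function that is orthogonal to all test functions vanishes. -/
lemma eq_zero_of_pairing {P : ℝ} (hP : 0 < P) (f : Hilb P)
    (h : ∀ Ψ : SchwartzMap Mink ℂ, HasCompactSupport Ψ →
      ∫ p, f p * Ψ p ∂(shellMeasure P) = 0) : f = 0 := by
  have := isLocallyFiniteMeasure_shellMeasure hP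
  have h1 : ∀ᵐ p ∂(shellMeasure P), f p = 0 := by
    refine ae_eq_zero_of_integral_contDiff_smul_eq_zero
      ((Lp.memLp f).locallyIntegrable (by norm_num)) fun g hg hgc => ?_
    have hcs : HasCompactSupport fun x : Mink => ((g x : ℝ) : ℂ) :=
      hgc.comp_left (g := Complex.ofReal) Complex.ofReal_zero
    have hcd : ContDiff ℝ (⊤ : ℕ∞) fun x : Mink => ((g x : ℝ) : ℂ) :=
      Complex.ofRealCLM.contDiff.comp hg
    have := h (hcs.toSchwartzMap hcd) hcs
    rw [← this]
    refine integral_congr_ae (Eventually.of_forall fun p => ?_)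
    change g p • f p = f p * ((g p : ℝ) : ℂ)
    rw [Complex.real_smul, mul_comm]
  ext1
  filter_upwards [h1, Lp.coeFn_zero ℂ 2 (shellMeasure P)] with p hp h0
  rw [hp, h0]; rfl

/-- A family of functions on the mass shell that interpolates between the boosted functions of
`g₀` and `g₁` in the sense of tempered distributions. -/
structure StripFamily (P : ℝ) (σ : ℤˣ) (I : Lorentz) (g₀ g₁ : Hilb P) (f : ℂ → Mink → ℂ) :
    Prop where
  integrable : ∀ τ : ℂ, τ.im ∈ Icc 0 Real.pi → ∀ Ψ : SchwartzMap Mink ℂ,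
    Integrable (fun p => f τ p * Ψ p) (shellMeasure P)
  continuousOn : ∀ Ψ : SchwartzMap Mink ℂ,
    ContinuousOn (fun τ => ∫ p, f τ p * Ψ p ∂(shellMeasure P)) (Complex.im ⁻¹' Icc 0 Real.pi)
  shift : ∀ (τ : ℂ) (t : ℝ) (p : Mink),
    f (τ + t) p = f τ ((wedgeBoost I (-(((σ : ℤ) : ℝ) * t))).mulVec p)
  holo : ∀ p ∈ massShell P, DifferentiableOn ℂ (fun τ => f τ p) strip
  cont : ContinuousOn (fun x : ℂ × Mink => f x.1 x.2) (strip ×ˢ massShell P)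
  lower : ∀ᵐ p ∂(shellMeasure P), f 0 p = g₀ p
  upper : ∀ᵐ p ∂(shellMeasure P), f (Real.pi * Complex.I) p = g₁ p

/-- Brings Gaussian growth into the double exponential form with rate 1/2 < 1. The 8 comes from x²/2
≤ e^x at x = |t|/2. -/
lemma exp_sq_le (t : ℝ) : Real.exp (t ^ 2) ≤ Real.exp (8 * Real.exp (1 / 2 * |t|)) := by
  have h := Real.quadratic_le_exp_of_nonneg (by positivity : 0 ≤ 1 / 2 * |t|)
  refine Real.exp_le_exp.2 ?_
  have h1 := sq_abs t
  have := abs_nonneg t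
  nlinarith

/-! ### Growth, holomorphy and contour shift for strip families -/

section Family

variable {P : ℝ} {σ : ℤˣ} {I : Lorentz} {g₀ g₁ : Hilb P} {f : ℂ → Mink → ℂ}

/-- Invariance of the measure moves the real part of τ onto the test function as a boost. On the
remaining compact segment of imaginary parts each pairing is bounded by continuity, which is what
uniform boundedness requires. -/
lemma StripFamily.exists_growth (hP : 0 < P) (hf : StripFamily P σ I g₀ g₁ f)
    (Ψ : SchwartzMap Mink ℂ) : ∃ C, ∀ τ : ℂ, τ.im ∈ Icc 0 Real.pi →
      ‖∫ p, f τ p * Ψ p ∂(shellMeasure P)‖ ≤ C * Real.exp (τ.re ^ 2) := by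
  have him : ∀ θ : ℝ, ((θ : ℂ) * Complex.I).im = θ := fun θ => by simp
  obtain ⟨C, hC⟩ := exists_growth_bound (μ := shellMeasure P) (Θ := Icc 0 Real.pi)
    (f := fun θ => f (θ * Complex.I))
    (fun θ hθ Ψ => hf.integrable _ (by rwa [him]) Ψ)
    (fun Ψ => by
      have hc : ContinuousOn (fun θ : ℝ => ∫ p, f (θ * Complex.I) p * Ψ p ∂(shellMeasure P))
          (Icc 0 Real.pi) := (hf.continuousOn Ψ).comp
        (Continuous.continuousOn (f := fun θ : ℝ => (θ : ℂ) * Complex.I) (by fun_prop))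
        (fun θ hθ => by rw [mem_preimage, him]; exact hθ)
      exact isCompact_Icc.exists_bound_of_continuousOn hc) I Ψ
  refine ⟨C, fun τ hτ => ?_⟩
  have e : τ = (τ.im : ℂ) * Complex.I + (τ.re : ℂ) := Complex.ext (by simp) (by simp)
  have e2 : ∫ p, f τ p * Ψ p ∂(shellMeasure P) =
      ∫ p, f (τ.im * Complex.I) p * Ψ ((wedgeBoost I (((σ : ℤ) : ℝ) * τ.re)).mulVec p)
        ∂(shellMeasure P) := by
    rw [← integral_comp_mulVec hP (ortho_wedgeBoost I (-(((σ : ℤ) : ℝ) * τ.re)))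
      (fun p => f (τ.im * Complex.I) p * Ψ ((wedgeBoost I (((σ : ℤ) : ℝ) * τ.re)).mulVec p))]
    refine integral_congr_ae (Eventually.of_forall fun p => ?_)
    simp only [Matrix.mulVec_mulVec]
    rw [← hf.shift, ← e, wedgeBoost_mul_neg, Matrix.one_mulVec]
  rw [e2]
  refine (hC _ hτ (((σ : ℤ) : ℝ) * τ.re)).trans_eq ?_
  rw [mul_pow, pow_two ((σ : ℤ) : ℝ), unit_sq, one_mul]

/-- Compact support gives a dominating function for differentiation under the integral: f is jointly
continuous, hence bounded on compact sets of τ and of momenta in the support. -/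
lemma StripFamily.differentiableOn (hP : 0 < P) (hf : StripFamily P σ I g₀ g₁ f)
    (Ψ : SchwartzMap Mink ℂ) (hΨ : HasCompactSupport Ψ) :
    DifferentiableOn ℂ (fun τ => ∫ p, f τ p * Ψ p ∂(shellMeasure P)) strip := by
  have := isLocallyFiniteMeasure_shellMeasure hP
  refine differentiableOn_integral
    (fun z hz => (hf.integrable z ⟨hz.1.le, hz.2.le⟩ Ψ).1) ?_ fun z₀ hz₀ => ?_
  · filter_upwards [ae_mem_massShell hP] with p hp
    exact (hf.holo p hp).mul_const _
  · obtain ⟨r, hr, hrs⟩ := Metric.isOpen_iff.1 isOpen_strip z₀ hz₀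
    have hrs' : Metric.closedBall z₀ (r / 2) ⊆ strip :=
      (Metric.closedBall_subset_ball (by linarith)).trans hrs
    have hK : IsCompact (Metric.closedBall z₀ (r / 2) ×ˢ (tsupport Ψ ∩ massShell P)) :=
      (isCompact_closedBall _ _).prod (hΨ.isCompact.inter_right (isClosed_massShell hP))
    obtain ⟨B, hB⟩ := hK.exists_bound_of_continuousOn
      (hf.cont.mono (prod_mono hrs' inter_subset_right))
    refine ⟨r / 2, by linarith, fun p => B * ‖Ψ p‖,
      ((Ψ.continuous.integrable_of_hasCompactSupport hΨ).norm.const_mul B),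
      (Metric.ball_subset_closedBall).trans hrs', ?_⟩
    filter_upwards [ae_mem_massShell hP] with p hp z hz
    rw [norm_mul]
    by_cases hpt : p ∈ tsupport Ψ
    · exact mul_le_mul_of_nonneg_right
        (hB (z, p) ⟨Metric.ball_subset_closedBall hz, hpt, hp⟩) (norm_nonneg _)
    · simp [image_eq_zero_of_notMem_tsupport hpt]

/-- Tested against Ψ, the edges are bounded by the L² norms of g₀ and g₁ times that of Ψ. With the a
priori growth, Phragmén–Lindelöf extends the bound to the strip, the contour may be shifted, and
compactly supported test functions separate vectors. -/
lemma StripFamily.gauss_eq (hP : 0 < P) (hf : StripFamily P σ I g₀ g₁ f) {m : ℝ} (hm : 0 < m) :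
    ∫ t : ℝ, gauss m (t - Real.pi * Complex.I) •
        compOp hP (ortho_wedgeBoost I (-(((σ : ℤ) : ℝ) * t))) g₀ =
      ∫ t : ℝ, gauss m t • compOp hP (ortho_wedgeBoost I (-(((σ : ℤ) : ℝ) * t))) g₁ := by
  have := isLocallyFiniteMeasure_shellMeasure hP
  have hD : ∀ g : Hilb P, Continuous fun t : ℝ =>
      compOp hP (ortho_wedgeBoost I (-(((σ : ℤ) : ℝ) * t))) g := fun g =>
    continuous_compOp hP (A := fun t : ℝ => wedgeBoost I (-(((σ : ℤ) : ℝ) * t)))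
      (continuous_wedgeBoost.comp (f := fun t : ℝ => (I, -(((σ : ℤ) : ℝ) * t))) (by fun_prop)) _ _
  have hi : ∀ (g : Hilb P) (y : ℝ), Integrable fun t : ℝ => gauss m (t + y * Complex.I) •
      compOp hP (ortho_wedgeBoost I (-(((σ : ℤ) : ℝ) * t))) g := fun g y =>
    integrable_gauss_smul hm y (hD g).aestronglyMeasurable
      (fun t => ((compOp hP _).norm_map g).le)
  have hi0 : Integrable fun t : ℝ => gauss m (t - Real.pi * Complex.I) •
      compOp hP (ortho_wedgeBoost I (-(((σ : ℤ) : ℝ) * t))) g₀ := by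
    simpa [sub_eq_add_neg] using hi g₀ (-Real.pi)
  have hi1 : Integrable fun t : ℝ => gauss m t •
      compOp hP (ortho_wedgeBoost I (-(((σ : ℤ) : ℝ) * t))) g₁ := by
    simpa using hi g₁ 0
  rw [← sub_eq_zero]
  refine eq_zero_of_pairing hP _ fun Ψ hΨ => ?_
  have hΨm : MemLp Ψ 2 (shellMeasure P) := Ψ.continuous.memLp_of_hasCompactSupport hΨ
  set Ψ' : Hilb P := hΨm.toLp Ψ with hΨ'
  have hpair : ∀ g : Hilb P, ∫ p, g p * Ψ p ∂(shellMeasure P) = (pairing P).flip Ψ' g := by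
    intro g
    rw [ContinuousLinearMap.flip_apply, pairing_apply]
    refine integral_congr_ae ?_
    filter_upwards [hΨm.coeFn_toLp] with p hp
    rw [hΨ', hp]
  have hlow : ∀ t : ℝ, ∫ p, f t p * Ψ p ∂(shellMeasure P) =
      (pairing P).flip Ψ' (compOp hP (ortho_wedgeBoost I (-(((σ : ℤ) : ℝ) * t))) g₀) := by
    intro t
    rw [← hpair]
    refine integral_congr_ae ?_
    filter_upwards [ae_comp hP (ortho_wedgeBoost I (-(((σ : ℤ) : ℝ) * t))) hf.lower,
      coeFn_compOp hP (ortho_wedgeBoost I (-(((σ : ℤ) : ℝ) * t))) g₀] with p h1 h2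
    rw [h2, ← h1, ← hf.shift, zero_add]
  have hup : ∀ t : ℝ, ∫ p, f (t + Real.pi * Complex.I) p * Ψ p ∂(shellMeasure P) =
      (pairing P).flip Ψ' (compOp hP (ortho_wedgeBoost I (-(((σ : ℤ) : ℝ) * t))) g₁) := by
    intro t
    rw [← hpair]
    refine integral_congr_ae ?_
    filter_upwards [ae_comp hP (ortho_wedgeBoost I (-(((σ : ℤ) : ℝ) * t))) hf.upper,
      coeFn_compOp hP (ortho_wedgeBoost I (-(((σ : ℤ) : ℝ) * t))) g₁] with p h1 h2
    rw [h2, ← h1, ← hf.shift, add_comm]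
  have hbd : ∀ g : Hilb P, ∀ t : ℝ, ‖(pairing P).flip Ψ'
      (compOp hP (ortho_wedgeBoost I (-(((σ : ℤ) : ℝ) * t))) g)‖ ≤ ‖g‖ * ‖Ψ'‖ := by
    intro g t
    refine (norm_pairing_le _ _).trans_eq ?_
    rw [(compOp hP _).norm_map]
  have hdc : DiffContOnCl ℂ (fun τ => ∫ p, f τ p * Ψ p ∂(shellMeasure P)) strip :=
    ⟨hf.differentiableOn hP Ψ hΨ, by rw [closure_strip]; exact hf.continuousOn Ψ⟩
  obtain ⟨C, hC⟩ := hf.exists_growth hP Ψ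
  have hC0 : 0 ≤ C := by
    have := (norm_nonneg _).trans (hC 0 ⟨by simp, by simpa using Real.pi_pos.le⟩)
    simpa using this
  have hB := fun (z : ℂ) (hz : z.im ∈ Icc 0 Real.pi) => norm_le_of_edges hdc
    ⟨1 / 2, by norm_num, C, 8, fun z hz => (hC z ⟨hz.1.le, hz.2.le⟩).trans
      (mul_le_mul_of_nonneg_left (exp_sq_le z.re) hC0)⟩
    (C := max (‖g₀‖ * ‖Ψ'‖) (‖g₁‖ * ‖Ψ'‖))
    (fun t => by rw [hlow]; exact (hbd g₀ t).trans (le_max_left _ _))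
    (fun t => by rw [hup]; exact (hbd g₁ t).trans (le_max_right _ _)) hz
  have key := gauss_shift hdc hB hm
  simp only [hlow, hup] at key
  rw [hpair, map_sub, ← ContinuousLinearMap.integral_comp_comm _ hi0,
    ← ContinuousLinearMap.integral_comp_comm _ hi1, sub_eq_zero]
  simpa only [map_smul] using key

end Family

/-! ### From boundary values to modular invariance -/

section Converse

variable {P : ℝ} {n : ℕ} {K : PolyhedralRegion n} {σ : ℤˣ} {i : Fin n}
  {u : Mink → MinkC → ℂ} {φ : Hilb P}

/-- The boundary value family as a strip family. -/
lemma stripFamily_of_isBoundaryValue (hP : 0 < P) (hu : IsBoundaryValue P K σ i u φ)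
    (hbc : BoundaryCondition P K i u) {I : Lorentz} (hI : I ∈ interior (K.X i)) :
    StripFamily P σ I (phaseOp P (-K.vertex i) φ)
      (phaseOp P (-K.vertex i) (wedgeConjOp hP (K.vertex i) I φ))
      (fun τ p => phase (-K.vertex i) (shellPoint P 0) *
        u (shellPoint P 0) (orbit I (((σ : ℤ) : ℂ) * τ) p)) := by
  set a := K.vertex i with ha
  set p₁ := shellPoint P 0 with hp₁
  have hp₁m : p₁ ∈ massShell P := shellPoint_mem hP 0
  -- The phase rule makes e^{-i{p,a}} u_p independent of p. This allows one fixed reference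
  -- momentum, hence a single holomorphic function, while the pairing with the moving reference
  -- momentum p remains the one of the hypothesis.
  have hu' : ∀ p ∈ massShell P, ∀ ζ ∈ cplxManifold P K σ i ∪ realPoints P,
      phase (-a) p₁ * u p₁ ζ = phase (-a) p * u p ζ := by
    intro p hp ζ hζ
    have h := hu.phase p hp p₁ hp₁m ζ hζ
    change u p ζ = phase a (p - p₁) * u p₁ ζ at h
    rw [h, phase_sub_left, ← mul_assoc, ← mul_assoc, mul_comm (phase (-a) p), phase_mul_neg,
      one_mul]
  have horb : ∀ τ : ℂ, τ.im ∈ Icc 0 Real.pi → ∀ p ∈ massShell P,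
      phase (-a) p₁ * u p₁ (orbit I (((σ : ℤ) : ℂ) * τ) p) =
        phase (-a) p * u p (orbit I (((σ : ℤ) : ℂ) * τ) p) := fun τ hτ p hp =>
    hu' p hp _ (orbit_mem K σ i hP hI hτ hp)
  have haeq : ∀ τ : ℂ, τ.im ∈ Icc 0 Real.pi → ∀ Ψ Φ : SchwartzMap Mink ℂ,
      (∀ p, Φ p = phase (-a) p * Ψ p) →
      (fun p => u p (orbit I (((σ : ℤ) : ℂ) * τ) p) * Φ p) =ᵐ[shellMeasure P]
      (fun p => phase (-a) p₁ * u p₁ (orbit I (((σ : ℤ) : ℂ) * τ) p) * Ψ p) := by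
    intro τ hτ Ψ Φ hΦ
    filter_upwards [ae_mem_massShell hP] with p hp
    rw [horb τ hτ p hp, hΦ]; ring
  refine ⟨fun τ hτ Ψ => ?_, fun Ψ => ?_, fun τ t p => ?_, fun p hp => ?_, ?_, ?_, ?_⟩
  · obtain ⟨Φ, hΦ⟩ := exists_schwartz_phase (-a) Ψ
    exact (hu.integrable I hI Φ _ ((mem_closedStrip_iff σ τ).2 hτ)).congr (haeq τ hτ Ψ Φ hΦ)
  · obtain ⟨Φ, hΦ⟩ := exists_schwartz_phase (-a) Ψ
    have h := (hu.continuousOn I hI Φ).comp (s := Complex.im ⁻¹' Icc 0 Real.pi)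
      (f := fun τ : ℂ => ((σ : ℤ) : ℂ) * τ) (by fun_prop)
      (fun τ hτ => (mem_closedStrip_iff σ τ).2 hτ)
    refine h.congr fun τ hτ => ?_
    exact (integral_congr_ae (haeq τ hτ Ψ Φ hΦ)).symm
  · simp only [orbit_shift]
  · refine DifferentiableOn.const_mul ?_ _
    exact (hu.holomorphic p₁ hp₁m).differentiableOn_comp
      (γ := fun τ => orbit I (((σ : ℤ) : ℂ) * τ) p)
      ((differentiable_orbit I p).comp (differentiable_id.const_mul _)) isOpen_strip
      (fun τ hτ => orbit_mem_cplxManifold K σ i hI hτ hp)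
  · refine continuousOn_const.mul ?_
    refine (hu.holomorphic p₁ hp₁m).continuousOn.comp (Continuous.continuousOn ?_)
      (fun x hx => orbit_mem_cplxManifold K σ i hI hx.1 hx.2)
    exact continuous_orbit continuous_const (continuous_const.mul continuous_fst) continuous_snd
  · filter_upwards [ae_mem_massShell hP, hu.boundary, coeFn_phaseOp P (-a) φ] with p hp h1 h2
    rw [horb 0 ⟨by simp, by simpa using Real.pi_pos.le⟩ p hp, h2, ← h1]
    have := orbit_lower σ I 0 p
    simp only [Complex.ofReal_zero, mul_zero, neg_zero, wedgeBoost_zero, Matrix.one_mulVec] at this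
    simp only [mul_zero, this]
  · have hr := ortho_wedgeRot I
    have hop : phaseOp P (-a) (wedgeConjOp hP a I φ) = compOp hP hr (star (phaseOp P (-a) φ)) :=
      phaseOp_apply_neg P a _
    rw [hop]
    filter_upwards [ae_mem_massShell hP, hbc I (interior_subset hI), ae_comp hP hr hu.boundary,
      coeFn_compOp hP hr (star (phaseOp P (-a) φ)),
      ae_comp hP hr (Lp.coeFn_star (phaseOp P (-a) φ)),
      ae_comp hP hr (coeFn_phaseOp P (-a) φ)] with p hp h1 h2 h3 h4 h5
    rw [horb _ ⟨by simpa using Real.pi_pos.le, by simp⟩ p hp, h3, h4, Pi.star_apply, h5]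
    have h6 := orbit_upper σ I 0 p
    simp only [Complex.ofReal_zero, mul_zero, neg_zero, wedgeBoost_zero, Matrix.one_mulVec,
      zero_add] at h6
    have h7 := h1 ((wedgeRot I).mulVec p) rfl
    change u p (-toC ((wedgeRot I).mulVec p)) = phase a p * phase a ((wedgeRot I).mulVec p) *
      (starRingEnd ℂ) (u ((wedgeRot I).mulVec p) (toC ((wedgeRot I).mulVec p))) at h7
    rw [h6, h7, h2, star_mul', RCLike.star_def, conj_phase, neg_neg, ← mul_assoc, ← mul_assoc,
      mul_comm (phase (-a) p), phase_mul_neg, one_mul]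

/-- A vector that is a boundary value of a holomorphic family with the boundary condition is
invariant under the modular operators. -/
lemma modularMapsTo_of_isBoundaryValue (hP : 0 < P) (hu : IsBoundaryValue P K σ i u φ)
    (hbc : BoundaryCondition P K i u) {I : Lorentz} (hI : I ∈ K.X i) :
    ModularMapsTo P σ (K.vertex i) I φ φ := by
  rw [modularMapsTo_iff hP]
  refine mem_closure_entireGraph (isoGroup_wedgeOp hP σ _ I) ?_
  -- The strip argument is available only for wedges in the interior of X. The Gaussian identity is
  -- closed in I and so extends to the closure.
  have hcl := isClosed_gaussOrbit_eq hP σ (K.vertex i) φ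
  rw [← K.X_closure_interior i] at hI
  refine hcl.closure_subset_iff.2 (fun J hJ m hm => ?_) hI
  have h := (stripFamily_of_isBoundaryValue hP hu hbc hJ).gauss_eq hP hm
  have hV := isoGroup_wedgeOp hP σ (K.vertex i) J
  have e : ∀ (z : ℂ) (x : Hilb P), phaseOp P (-K.vertex i) (gaussOrbit (wedgeOp hP σ
      (K.vertex i) J) m z x) = ∫ t : ℝ, gauss m (t - z) •
      compOp hP (ortho_wedgeBoost J (-(((σ : ℤ) : ℝ) * t))) (phaseOp P (-K.vertex i) x) := by
    intro z x
    rw [gaussOrbit]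
    have := (phaseOp P (-K.vertex i)).toContinuousLinearMap.integral_comp_comm
      (integrable_gaussOrbit hV hm z x)
    refine this.symm.trans ?_
    refine integral_congr_ae (Eventually.of_forall fun t => ?_)
    change phaseOp P (-K.vertex i) (gauss m (t - z) • _) = _
    rw [map_smul, wedgeOp_apply, phaseOp_apply_neg]
  -- Removing the translation phase, an isometry, turns the wedge group into pure boosts, for which
  -- the identity was proved.
  apply (phaseOp P (-K.vertex i)).injective
  rw [e, e, h]
  simp only [sub_zero]

end Converse

/-! ### Holomorphic exponential vectors -/

/-- The exponential function `q ↦ e^{-{ζ,q}}`. -/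
def kern (ζ : MinkC) (q : Mink) : ℂ := Complex.exp (-form ζ (toC q))

lemma re_form_toC (ζ : MinkC) (q : Mink) : (form ζ (toC q)).re = form (reV ζ) q := by
  simp [form, toC, reV]

lemma norm_kern (ζ : MinkC) (q : Mink) : ‖kern ζ q‖ = Real.exp (-form (reV ζ) q) := by
  rw [kern, Complex.norm_exp, Complex.neg_re, re_form_toC]

lemma continuous_kern (ζ : MinkC) : Continuous (kern ζ) := by
  unfold kern form toC; fun_prop

lemma kern_add (ζ η : MinkC) (q : Mink) : kern (ζ + η) q = kern ζ q * kern η q := by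
  rw [kern, kern, kern, ← Complex.exp_add, form_add_left, neg_add]

lemma norm_kern_le {P : ℝ} (hP : 0 < P) (ζ : MinkC) {q : Mink} (hq : q ∈ massShell P) :
    ‖kern ζ q‖ ≤ Real.exp (-(reV ζ 0 - spatialNorm (reV ζ)) * ‖q‖) := by
  rw [norm_kern, norm_massShell hP hq]
  refine Real.exp_le_exp.2 ?_
  have := le_form (x := reV ζ) (mem_fwd_iff.1 (massShell_subset_fwd hP hq)).le
  linarith

lemma norm_form_toC_le (ζ : MinkC) (q : Mink) : ‖form ζ (toC q)‖ ≤ 4 * ‖ζ‖ * ‖q‖ := by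
  have h : ∀ j, ‖ζ j * toC q j‖ ≤ ‖ζ‖ * ‖q‖ := fun j => by
    rw [norm_mul]
    refine mul_le_mul (norm_le_pi_norm ζ j) ?_ (norm_nonneg _) (norm_nonneg _)
    rw [toC, Complex.norm_real]
    exact norm_le_pi_norm q j
  rw [form]
  refine (norm_sub_le _ _).trans ?_
  have h1 := norm_sub_le (ζ 0 * toC q 0 - ζ 1 * toC q 1) (ζ 2 * toC q 2)
  have h2 := norm_sub_le (ζ 0 * toC q 0) (ζ 1 * toC q 1)
  linarith [h 0, h 1, h 2, h 3]

lemma pow_le_exp (n : ℕ) {c x : ℝ} (hc : 0 < c) (hx : 0 ≤ x) :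
    x ^ n ≤ n.factorial / c ^ n * Real.exp (c * x) := by
  have h := Real.pow_div_factorial_le_exp (x := c * x) (by positivity) n
  rw [div_le_iff₀ (by positivity), mul_pow] at h
  rw [div_mul_eq_mul_div, le_div_iff₀ (by positivity)]
  linarith

lemma memLp_exp_neg_norm {P : ℝ} (hP : 0 < P) {c : ℝ} (hc : 0 < c) :
    MemLp (fun q : Mink => Real.exp (-c * ‖q‖)) 2 (shellMeasure P) := by
  refine (memLp_two_iff_integrable_sq (by fun_prop)).2 ?_
  refine ((integrable_shell_of_bound hP).const_mul
    ((Nat.factorial 4 : ℝ) / (2 * c) ^ 4 * Real.exp (2 * c))).mono'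
    (by fun_prop) (Eventually.of_forall fun q => ?_)
  have hq : (0 : ℝ) < 1 + ‖q‖ := by positivity
  have h := pow_le_exp 4 (by positivity : 0 < 2 * c) hq.le
  have e : (1 + ‖q‖) ^ (-(4 : ℕ) : ℝ) = ((1 + ‖q‖) ^ 4)⁻¹ := by
    rw [Real.rpow_neg hq.le, Real.rpow_natCast]
  rw [e, Real.norm_of_nonneg (by positivity), ← div_eq_mul_inv, le_div_iff₀ (by positivity)]
  calc Real.exp (-c * ‖q‖) ^ 2 * (1 + ‖q‖) ^ 4
      ≤ Real.exp (-c * ‖q‖) ^ 2 * ((Nat.factorial 4 : ℝ) / (2 * c) ^ 4 *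
        Real.exp (2 * c * (1 + ‖q‖))) := by gcongr
    _ = (Nat.factorial 4 : ℝ) / (2 * c) ^ 4 * (Real.exp (-c * ‖q‖) ^ 2 *
        Real.exp (2 * c * (1 + ‖q‖))) := by ring
    _ = (Nat.factorial 4 : ℝ) / (2 * c) ^ 4 * Real.exp (2 * c) := by
        rw [pow_two, ← Real.exp_add, ← Real.exp_add]; ring_nf

/-- The exponentially decreasing comparison vectors. -/
def expNorm {P : ℝ} (hP : 0 < P) {c : ℝ} (hc : 0 < c) : Lp ℝ 2 (shellMeasure P) :=
  (memLp_exp_neg_norm hP hc).toLp _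

lemma memLp_of_exp_bound {P : ℝ} (hP : 0 < P) {c : ℝ} (hc : 0 < c) {f : Mink → ℂ}
    (hf : AEStronglyMeasurable f (shellMeasure P)) {C : ℝ}
    (h : ∀ q ∈ massShell P, ‖f q‖ ≤ C * Real.exp (-c * ‖q‖)) : MemLp f 2 (shellMeasure P) := by
  refine (memLp_exp_neg_norm hP hc).of_le_mul (c := C) hf ?_
  filter_upwards [ae_mem_massShell hP] with q hq
  rw [Real.norm_of_nonneg (Real.exp_pos _).le]
  exact h q hq

lemma norm_le_of_exp_bound {P : ℝ} (hP : 0 < P) {c : ℝ} (hc : 0 < c) {f : Hilb P} {C : ℝ}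
    (h : ∀ᵐ q ∂(shellMeasure P), ‖f q‖ ≤ C * Real.exp (-c * ‖q‖)) :
    ‖f‖ ≤ C * ‖expNorm hP hc‖ := by
  refine Lp.norm_le_mul_norm_of_ae_le_mul ?_
  filter_upwards [h, (memLp_exp_neg_norm hP hc).coeFn_toLp] with q h1 h2
  rw [expNorm, h2, Real.norm_of_nonneg (Real.exp_pos _).le]
  exact h1

/-- The forward tube. -/
def tube : Set MinkC := reV ⁻¹' fwd

lemma isOpen_tube : IsOpen tube := isOpen_fwd.preimage continuous_reV

lemma memLp_kern {P : ℝ} (hP : 0 < P) {ζ : MinkC} (hζ : ζ ∈ tube) :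
    MemLp (kern ζ) 2 (shellMeasure P) := by
  have hκ : 0 < reV ζ 0 - spatialNorm (reV ζ) := sub_pos.2 (mem_fwd_iff.1 hζ)
  refine memLp_of_exp_bound hP hκ (continuous_kern ζ).aestronglyMeasurable (C := 1) fun q hq => ?_
  rw [one_mul]
  exact norm_kern_le hP ζ hq

open Classical in
/-- The exponential function `q ↦ e^{-{ζ,q}}` as an element of `L²`. -/
def expVec (P : ℝ) (ζ : MinkC) : Hilb P :=
  if h : MemLp (kern ζ) 2 (shellMeasure P) then h.toLp _ else 0

lemma coeFn_expVec {P : ℝ} (hP : 0 < P) {ζ : MinkC} (hζ : ζ ∈ tube) :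
    expVec P ζ =ᵐ[shellMeasure P] kern ζ := by
  rw [expVec, dif_pos (memLp_kern hP hζ)]
  exact MemLp.coeFn_toLp _

lemma norm_exp_remainder (a : ℂ) : ‖Complex.exp (-a) - 1 + a‖ ≤ ‖a‖ ^ 2 * Real.exp ‖a‖ := by
  have h := Complex.norm_exp_sub_sum_le_norm_mul_exp (-a) 2
  rw [norm_neg] at h
  convert! h using 2
  simp [Finset.sum_range_succ]
  ring

/-- The derivative in direction h is -{h,q} e^{-{ζ,q}}. The polynomial factor and the second order
remainder are absorbed by half of the exponential decay κ = Re ζ⁰ - |Re ζ|. -/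
lemma differentiableOn_expVec {P : ℝ} (hP : 0 < P) : DifferentiableOn ℂ (expVec P) tube := by
  intro ζ hζ
  refine DifferentiableAt.differentiableWithinAt ?_
  set κ := reV ζ 0 - spatialNorm (reV ζ) with hκd
  have hκ : 0 < κ := sub_pos.2 (mem_fwd_iff.1 hζ)
  have hv : ∀ h : MinkC, MemLp (fun q => -form h (toC q) * kern ζ q) 2 (shellMeasure P) := by
    intro h
    refine memLp_of_exp_bound hP (half_pos hκ) (C := 4 * ‖h‖ * (1 / (κ / 2))) ?_ fun q hq => ?_
    · refine Continuous.aestronglyMeasurable (.mul ?_ (continuous_kern ζ))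
      unfold form toC; fun_prop
    · rw [norm_mul, norm_neg]
      have h1 := pow_le_exp 1 (half_pos hκ) (norm_nonneg q)
      rw [pow_one, pow_one, Nat.factorial_one, Nat.cast_one] at h1
      calc ‖form h (toC q)‖ * ‖kern ζ q‖
          ≤ (4 * ‖h‖ * ‖q‖) * Real.exp (-κ * ‖q‖) :=
            mul_le_mul (norm_form_toC_le h q) (norm_kern_le hP ζ hq) (norm_nonneg _)
              (by positivity)
        _ ≤ (4 * ‖h‖ * (1 / (κ / 2) * Real.exp (κ / 2 * ‖q‖))) * Real.exp (-κ * ‖q‖) := by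
            gcongr
        _ = 4 * ‖h‖ * (1 / (κ / 2)) * (Real.exp (κ / 2 * ‖q‖) * Real.exp (-κ * ‖q‖)) := by ring
        _ = _ := by rw [← Real.exp_add]; ring_nf
  let D : MinkC →ₗ[ℂ] Hilb P :=
    { toFun := fun h => (hv h).toLp _
      map_add' := fun h h' => by
        rw [← MemLp.toLp_add]
        refine MemLp.toLp_congr _ _ (Eventually.of_forall fun q => ?_)
        simp only [form_add_left, Pi.add_apply]; ring
      map_smul' := fun c h => by
        rw [RingHom.id_apply, ← MemLp.toLp_const_smul]
        refine MemLp.toLp_congr _ _ (Eventually.of_forall fun q => ?_)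
        simp only [form_smul_left, Pi.smul_apply, smul_eq_mul]; ring }
  have hD : ∀ h, D h =ᵐ[shellMeasure P] fun q => -form h (toC q) * kern ζ q := fun h =>
    MemLp.coeFn_toLp (hv h)
  suffices HasFDerivAt (expVec P) (LinearMap.toContinuousLinearMap D) ζ from
    this.differentiableAt
  rw [hasFDerivAt_iff_isLittleO_nhds_zero]
  refine Asymptotics.IsBigO.trans_isLittleO (g := fun h : MinkC => ‖h‖ ^ 2) ?_
    (Asymptotics.isLittleO_norm_pow_id one_lt_two)
  refine Asymptotics.IsBigO.of_bound (16 * (2 / (κ / 4) ^ 2) * ‖expNorm hP (half_pos hκ)‖) ?_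
  have hUn : {h : MinkC | ζ + h ∈ tube} ∈ 𝓝 (0 : MinkC) := by
    refine (isOpen_tube.preimage (continuous_const.add continuous_id)).mem_nhds ?_
    simpa using hζ
  -- For ‖h‖ < κ/16 the remainder factor is at most e^{κ‖q‖/4}, as |{h,q}| ≤ 4‖h‖‖q‖. The factor
  -- ‖q‖² costs another κ/4, which leaves the decay rate κ/2.
  filter_upwards [hUn, Metric.ball_mem_nhds (0 : MinkC) (by positivity : 0 < κ / 16)] with h hh hs
  rw [mem_ball_zero_iff] at hs
  have hmain := norm_le_of_exp_bound hP (half_pos hκ)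
    (f := expVec P (ζ + h) - expVec P ζ - LinearMap.toContinuousLinearMap D h)
    (C := 16 * (2 / (κ / 4) ^ 2) * ‖h‖ ^ 2) ?_
  · refine hmain.trans_eq ?_
    rw [Real.norm_of_nonneg (by positivity)]; ring
  filter_upwards [Lp.coeFn_sub (expVec P (ζ + h) - expVec P ζ) (D h),
    Lp.coeFn_sub (expVec P (ζ + h)) (expVec P ζ), hD h, coeFn_expVec hP hζ,
    coeFn_expVec hP hh, ae_mem_massShell hP] with q h1 h2 h3 h4 h5 hq
  have e : (expVec P (ζ + h) - expVec P ζ - LinearMap.toContinuousLinearMap D h : Hilb P) q =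
      kern ζ q * (Complex.exp (-form h (toC q)) - 1 + form h (toC q)) := by
    rw [LinearMap.coe_toContinuousLinearMap', h1, Pi.sub_apply, h2, Pi.sub_apply, h3, h4, h5,
      kern_add, kern, kern]
    ring
  rw [e, norm_mul]
  have hb := norm_form_toC_le h q
  have h6 := pow_le_exp 2 (by positivity : 0 < κ / 4) (norm_nonneg q)
  have h7 : 4 * ‖h‖ * ‖q‖ ≤ κ / 4 * ‖q‖ := by
    refine mul_le_mul_of_nonneg_right ?_ (norm_nonneg _); linarith
  calc ‖kern ζ q‖ * ‖Complex.exp (-form h (toC q)) - 1 + form h (toC q)‖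
      ≤ Real.exp (-κ * ‖q‖) * (‖form h (toC q)‖ ^ 2 * Real.exp ‖form h (toC q)‖) :=
        mul_le_mul (norm_kern_le hP ζ hq) (norm_exp_remainder _) (norm_nonneg _) (Real.exp_pos _).le
    _ ≤ Real.exp (-κ * ‖q‖) * ((4 * ‖h‖ * ‖q‖) ^ 2 * Real.exp (κ / 4 * ‖q‖)) := by
        gcongr; exact hb.trans h7
    _ = 16 * ‖h‖ ^ 2 * Real.exp (-κ * ‖q‖) * Real.exp (κ / 4 * ‖q‖) * ‖q‖ ^ 2 := by ring
    _ ≤ 16 * ‖h‖ ^ 2 * Real.exp (-κ * ‖q‖) * Real.exp (κ / 4 * ‖q‖) *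
        ((Nat.factorial 2 : ℝ) / (κ / 4) ^ 2 * Real.exp (κ / 4 * ‖q‖)) := by gcongr
    _ = 16 * (2 / (κ / 4) ^ 2) * ‖h‖ ^ 2 * (Real.exp (-κ * ‖q‖) * Real.exp (κ / 4 * ‖q‖) *
        Real.exp (κ / 4 * ‖q‖)) := by simp only [Nat.factorial_two]; push_cast; ring
    _ = _ := by rw [← Real.exp_add, ← Real.exp_add]; ring_nf

lemma compOp_expVec {P : ℝ} (hP : 0 < P) {A : Matrix (Fin 4) (Fin 4) ℝ} (hA : Ortho A) {ζ : MinkC}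
    (hζ : ζ ∈ tube) : compOp hP hA (expVec P ((A.map Complex.ofReal).mulVec ζ)) = expVec P ζ := by
  have hAζ : (A.map Complex.ofReal).mulVec ζ ∈ tube := by
    rw [tube, mem_preimage, reV_map_mulVec]; exact hA.fwd _ hζ
  ext1
  filter_upwards [coeFn_compOp hP hA (expVec P ((A.map Complex.ofReal).mulVec ζ)),
    ae_comp hP hA (coeFn_expVec hP hAζ), coeFn_expVec hP hζ] with q h1 h2 h3
  rw [h1, h2, h3, kern, kern, toC_mulVec, presForm_map hA.pres]

lemma pairing_compOp {P : ℝ} (hP : 0 < P) {A : Matrix (Fin 4) (Fin 4) ℝ} (hA : Ortho A)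
    (f g : Hilb P) : pairing P (compOp hP hA f) (compOp hP hA g) = pairing P f g := by
  rw [pairing_apply, pairing_apply, ← integral_comp_mulVec hP hA (fun p => f p * g p)]
  refine integral_congr_ae ?_
  filter_upwards [coeFn_compOp hP hA f, coeFn_compOp hP hA g] with q h1 h2
  rw [h1, h2]

/-- Invariance of the measure and of the form transfers the Lorentz transformation from the vector
to the label ζ. -/
lemma pairing_expVec_comp {P : ℝ} (hP : 0 < P) {A : Matrix (Fin 4) (Fin 4) ℝ} (hA : Ortho A)
    {ζ : MinkC} (hζ : ζ ∈ tube) (f : Hilb P) :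
    pairing P (expVec P ζ) (compOp hP hA f) =
      pairing P (expVec P ((A.map Complex.ofReal).mulVec ζ)) f := by
  rw [← compOp_expVec hP hA hζ, pairing_compOp]

/-! ### Continuation of the regularized vectors along complex orbits -/

/-- `F` continues the boosted functions of `ψ` holomorphically to the strip. -/
structure WedgeOrbit {P : ℝ} (hP : 0 < P) (σ : ℤˣ) (I : Lorentz) (ψ : Hilb P) (F : ℂ → Hilb P) :
    Prop where
  holo : DiffContOnCl ℂ F strip
  lower : F 0 = ψ
  shift : ∀ z : ℂ, z.im ∈ Icc 0 Real.pi → ∀ t : ℝ,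
    F (z + t) = compOp hP (ortho_wedgeBoost I (-(((σ : ℤ) : ℝ) * t))) (F z)

/-- The regularized continuation at `ζ`, computed with the parameter `τ`. -/
def contVal {P : ℝ} (σ : ℤˣ) (I : Lorentz) (F : ℂ → Hilb P) (τ : ℂ) (ζ : MinkC) : ℂ :=
  pairing P (expVec P ((wedgeBoostC I (((σ : ℤ) : ℂ) * τ)).mulVec ζ)) (F τ)

/-- The imaginary point of the closed strip at height `θ`. -/
def imPt (θ : ℝ) : ℂ := (θ : ℂ) * Complex.I

@[simp] lemma imPt_im (θ : ℝ) : (imPt θ).im = θ := by simp [imPt]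

@[simp] lemma imPt_zero : imPt 0 = 0 := by simp [imPt]

lemma continuous_imPt : Continuous imPt := by unfold imPt; fun_prop

/-! ### Independence of the angle and continuation along an orbit -/

section Path

variable {P : ℝ} {hP : 0 < P} {σ : ℤˣ} {I I' : Lorentz} {ψ : Hilb P} {F F' : ℂ → Hilb P}

lemma WedgeOrbit.continuousOn (hF : WedgeOrbit hP σ I ψ F) :
    ContinuousOn F (Complex.im ⁻¹' Icc 0 Real.pi) :=
  closure_strip ▸ hF.holo.continuousOn

/-- A real shift boosts both the label ζ and the vector F(τ), and the two boosts cancel in the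
invariant pairing. -/
lemma contVal_shift (hF : WedgeOrbit hP σ I ψ F) {τ : ℂ} (hτ : τ.im ∈ Icc 0 Real.pi) {ζ : MinkC}
    (hζ : (wedgeBoostC I (((σ : ℤ) : ℂ) * τ)).mulVec ζ ∈ tube) (t : ℝ) :
    contVal σ I F (τ + t) ζ = contVal σ I F τ ζ := by
  have e1 : (wedgeBoostC I (((σ : ℤ) : ℂ) * (τ + t))).mulVec ζ =
      ((wedgeBoost I (((σ : ℤ) : ℝ) * t)).map Complex.ofReal).mulVec
        ((wedgeBoostC I (((σ : ℤ) : ℂ) * τ)).mulVec ζ) := by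
    rw [← wedgeBoostC_ofReal, Matrix.mulVec_mulVec, ← wedgeBoostC_add]
    congr 2
    push_cast; ring
  have h1 : ((wedgeBoost I (((σ : ℤ) : ℝ) * t)).map Complex.ofReal).mulVec
        ((wedgeBoostC I (((σ : ℤ) : ℂ) * τ)).mulVec ζ) ∈ tube := by
    rw [tube, mem_preimage, reV_map_mulVec]; exact (ortho_wedgeBoost I _).fwd _ hζ
  rw [contVal, contVal, hF.shift τ hτ t, e1, pairing_expVec_comp hP _ h1, Matrix.mulVec_mulVec,
    ← wedgeBoostC_ofReal, ← wedgeBoostC_ofReal, ← wedgeBoostC_add]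
  simp [wedgeBoostC_zero]

lemma differentiableAt_contVal (hF : WedgeOrbit hP σ I ψ F) {τ : ℂ} (hτ : τ ∈ strip) {ζ : MinkC}
    (hζ : (wedgeBoostC I (((σ : ℤ) : ℂ) * τ)).mulVec ζ ∈ tube) :
    DifferentiableAt ℂ (fun τ => contVal σ I F τ ζ) τ := by
  have h1 : DifferentiableAt ℂ (fun τ => (wedgeBoostC I (((σ : ℤ) : ℂ) * τ)).mulVec ζ) τ :=
    ((differentiable_wedgeBoostC_mulVec I ζ).comp (differentiable_id.const_mul _)) τ
  have h2 : DifferentiableAt ℂ (fun τ => expVec P ((wedgeBoostC I (((σ : ℤ) : ℂ) * τ)).mulVec ζ)) τ :=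
    DifferentiableAt.comp (g := expVec P)
      (f := fun τ => (wedgeBoostC I (((σ : ℤ) : ℂ) * τ)).mulVec ζ) τ
      ((differentiableOn_expVec hP).differentiableAt (isOpen_tube.mem_nhds hζ)) h1
  exact ((pairing P).differentiableAt.comp τ h2).clm_apply
    (hF.holo.differentiableOn.differentiableAt (isOpen_strip.mem_nhds hτ))

lemma continuous_boosted (I : Lorentz) (σ : ℤˣ) {X : Type*} [TopologicalSpace X] {f : X → ℂ}
    {g : X → MinkC} (hf : Continuous f) (hg : Continuous g) :
    Continuous fun x => (wedgeBoostC I (((σ : ℤ) : ℂ) * f x)).mulVec (g x) :=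
  (continuous_wedgeBoostC continuous_const (continuous_const.mul hf)).matrix_mulVec hg

lemma continuousOn_contVal (hF : WedgeOrbit hP σ I ψ F) (ζ : MinkC) {S : Set ℝ}
    (hS : S ⊆ Icc 0 Real.pi)
    (hζ : ∀ θ ∈ S, (wedgeBoostC I (((σ : ℤ) : ℂ) * imPt θ)).mulVec ζ ∈ tube) :
    ContinuousOn (fun θ : ℝ => contVal σ I F (imPt θ) ζ) S := by
  have h1 : Continuous fun θ : ℝ => (wedgeBoostC I (((σ : ℤ) : ℂ) * imPt θ)).mulVec ζ :=
    continuous_boosted I σ continuous_imPt continuous_const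
  have h2 : ContinuousOn (fun θ : ℝ => expVec P ((wedgeBoostC I (((σ : ℤ) : ℂ) *
      imPt θ)).mulVec ζ)) S :=
    (differentiableOn_expVec hP).continuousOn.comp h1.continuousOn hζ
  exact ((pairing P).continuous.comp_continuousOn h2).clm_apply
    (hF.continuousOn.comp continuous_imPt.continuousOn
      fun θ hθ => by rw [mem_preimage, imPt_im]; exact hS hθ)

/-- The function is holomorphic in τ and constant in the real direction, so its complex derivative
vanishes and it is stationary in the imaginary direction too. -/
lemma hasDerivAt_contVal_zero (hF : WedgeOrbit hP σ I ψ F) {θ : ℝ} (hθ : θ ∈ Ioo 0 Real.pi)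
    {ζ : MinkC} (hζ : (wedgeBoostC I (((σ : ℤ) : ℂ) * imPt θ)).mulVec ζ ∈ tube) :
    HasDerivAt (fun θ : ℝ => contVal σ I F (imPt θ) ζ) 0 θ := by
  have hs : imPt θ ∈ strip := by rw [strip, mem_preimage, imPt_im]; exact hθ
  have hd := (differentiableAt_contVal hF hs hζ).hasDerivAt
  set D := deriv (fun τ => contVal σ I F τ ζ) (imPt θ) with hD
  have h1 : HasDerivAt (fun t : ℝ => contVal σ I F (imPt θ + t) ζ) D 0 := by
    have hg : HasDerivAt (fun t : ℝ => imPt θ + (t : ℂ)) 1 0 :=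
      (Complex.ofRealCLM.hasDerivAt (x := (0 : ℝ))).const_add _
    have hd' : HasDerivAt (fun τ => contVal σ I F τ ζ) D (imPt θ + ((0 : ℝ) : ℂ)) := by
      simpa using hd
    have := hd'.scomp (0 : ℝ) hg
    rwa [one_smul] at this
  have h2 : (fun t : ℝ => contVal σ I F (imPt θ + t) ζ) = fun _ => contVal σ I F (imPt θ) ζ := by
    ext1 t
    exact contVal_shift hF (by rw [imPt_im]; exact ⟨hθ.1.le, hθ.2.le⟩) hζ t
  have h3 : D = 0 := by
    rw [h2] at h1
    exact h1.unique (hasDerivAt_const _ _)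
  have hg : HasDerivAt imPt Complex.I θ := by
    have := (Complex.ofRealCLM.hasDerivAt (x := θ)).mul_const Complex.I
    rwa [Complex.ofRealCLM_apply, Complex.ofReal_one, one_mul] at this
  have := hd.scomp θ hg
  rwa [h3, smul_zero] at this

/-- The derivative is available only inside the strip. The left end may lie on the edge, where `F`
is merely continuous, and is reached as a limit. -/
lemma contVal_eq_of_lt (hF : WedgeOrbit hP σ I ψ F) {ζ : MinkC} {x y : ℝ} (hx : 0 ≤ x)
    (hy : y < Real.pi) (hxy : x < y)
    (h : ∀ θ ∈ Icc x y, (wedgeBoostC I (((σ : ℤ) : ℂ) * imPt θ)).mulVec ζ ∈ tube) :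
    contVal σ I F (imPt x) ζ = contVal σ I F (imPt y) ζ := by
  have hc := continuousOn_contVal hF ζ (S := Icc x y)
    (fun θ hθ => ⟨hx.trans hθ.1, hθ.2.trans hy.le⟩) h
  have h1 : ∀ z ∈ Ioo x y, contVal σ I F (imPt y) ζ = contVal σ I F (imPt z) ζ := by
    intro z hz
    refine constant_of_has_deriv_right_zero (a := z) (b := y)
      (hc.mono (Icc_subset_Icc_left hz.1.le)) (fun θ hθ => ?_) y ⟨hz.2.le, le_rfl⟩
    exact (hasDerivAt_contVal_zero hF ⟨lt_of_le_of_lt hx (hz.1.trans_le hθ.1), hθ.2.trans hy⟩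
      (h θ ⟨hz.1.le.trans hθ.1, hθ.2.le⟩)).hasDerivWithinAt
  have h2 := (hc x ⟨le_rfl, hxy.le⟩).tendsto.mono_left
    (nhdsWithin_mono x (Ioo_subset_Icc_self (a := x) (b := y)))
  have : (𝓝[Ioo x y] x).NeBot := left_nhdsWithin_Ioo_neBot hxy
  refine tendsto_nhds_unique h2 (tendsto_const_nhds.congr' ?_)
  filter_upwards [self_mem_nhdsWithin] with z hz using h1 z hz

lemma contVal_eq_of_uIcc (hF : WedgeOrbit hP σ I ψ F) {ζ : MinkC} {x y : ℝ}
    (hx : x ∈ Ico 0 Real.pi) (hy : y ∈ Ico 0 Real.pi)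
    (h : ∀ θ ∈ uIcc x y, (wedgeBoostC I (((σ : ℤ) : ℂ) * imPt θ)).mulVec ζ ∈ tube) :
    contVal σ I F (imPt x) ζ = contVal σ I F (imPt y) ζ := by
  rcases lt_trichotomy x y with hxy | rfl | hxy
  · rw [uIcc_of_le hxy.le] at h
    exact contVal_eq_of_lt hF hx.1 hy.2 hxy h
  · rfl
  · rw [uIcc_of_ge hxy.le] at h
    exact (contVal_eq_of_lt hF hy.1 hx.2 hxy h).symm

lemma boost_orbit (I : Lorentz) (τ : ℂ) (p : Mink) :
    (wedgeBoostC I τ).mulVec (orbit I τ p) = toC p := by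
  rw [orbit_eq, Matrix.mulVec_mulVec, ← wedgeBoostC_add, add_neg_cancel, wedgeBoostC_zero,
    Matrix.one_mulVec]

lemma contVal_orbit (τ : ℂ) (p : Mink) :
    contVal σ I F τ (orbit I (((σ : ℤ) : ℂ) * τ) p) = pairing P (expVec P (toC p)) (F τ) := by
  rw [contVal, boost_orbit]

lemma contVal_zero (hF : WedgeOrbit hP σ I ψ F) (ζ : MinkC) :
    contVal σ I F (imPt 0) ζ = pairing P (expVec P ζ) ψ := by
  rw [contVal, imPt_zero, mul_zero, wedgeBoostC_zero, Matrix.one_mulVec, hF.lower]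

lemma continuous_path (I I' : Lorentz) (σ : ℤˣ) (p : Mink) : Continuous fun x : ℝ × ℝ =>
    (wedgeBoostC I' (((σ : ℤ) : ℂ) * imPt x.1)).mulVec (orbit I (((σ : ℤ) : ℂ) * imPt x.2) p) := by
  refine continuous_boosted I' σ (continuous_imPt.comp continuous_fst) ?_
  exact continuous_orbit continuous_const
    (continuous_const.mul (continuous_imPt.comp continuous_snd)) continuous_const

lemma analyticAt_ofReal_comp {h : ℂ → ℂ} {s : ℝ} {g : ℝ → ℂ} {U : Set ℂ} (hU : IsOpen U)
    (hd : DifferentiableOn ℂ h U) (hs : (s : ℂ) ∈ U) (hg : g =ᶠ[𝓝 s] fun t : ℝ => h t) :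
    AnalyticAt ℝ g s := by
  have h1 : AnalyticAt ℝ h (s : ℂ) := (hd.analyticAt (hU.mem_nhds hs)).restrictScalars
  have h2 : AnalyticAt ℝ (fun t : ℝ => h t) s :=
    AnalyticAt.comp (g := h) (f := fun t : ℝ => (t : ℂ)) h1 (Complex.ofRealCLM.analyticAt s)
  exact h2.congr hg.symm

/-- Two continuations agree at the end of an orbit segment that stays in the domain of both. -/
lemma contVal_eq_of_path (hF : WedgeOrbit hP σ I ψ F) (hF' : WedgeOrbit hP σ I' ψ F')
    {p : Mink} (hp : p ∈ fwd) {a : ℝ → ℝ} {θ₁ : ℝ} (hθ₁ : θ₁ ∈ Ioo 0 Real.pi) (ha0 : a 0 = 0)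
    (hac : ∀ s ∈ Icc 0 θ₁, ContinuousAt a s) (ha : ∀ s ∈ Ioc 0 θ₁, a s ∈ Ioo 0 Real.pi)
    (ht : ∀ s ∈ Ioc 0 θ₁, (wedgeBoostC I' (((σ : ℤ) : ℂ) * imPt (a s))).mulVec
      (orbit I (((σ : ℤ) : ℂ) * imPt s) p) ∈ tube) :
    pairing P (expVec P (toC p)) (F (imPt θ₁)) =
      contVal σ I' F' (imPt (a θ₁)) (orbit I (((σ : ℤ) : ℂ) * imPt θ₁) p) := by
  set γ : ℝ → MinkC := fun s => orbit I (((σ : ℤ) : ℂ) * imPt s) p with hγ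
  have hpt : toC p ∈ tube := hp
  have hopen : ∀ J : Lorentz, IsOpen {x : ℝ × ℝ |
      (wedgeBoostC J (((σ : ℤ) : ℂ) * imPt x.1)).mulVec (γ x.2) ∈ tube} := fun J =>
    isOpen_tube.preimage (continuous_path I J σ p)
  have hf1 : AnalyticOnNhd ℝ (fun s : ℝ => pairing P (expVec P (toC p)) (F (imPt s))) (Ioc 0 θ₁) := by
    intro s hs
    refine analyticAt_ofReal_comp
      (h := fun z : ℂ => pairing P (expVec P (toC p)) (F (z * Complex.I)))
      (U := (fun z : ℂ => z * Complex.I) ⁻¹' strip)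
      (isOpen_strip.preimage (by fun_prop)) ?_ ?_ (Eventually.of_forall fun t => rfl)
    · exact ((pairing P (expVec P (toC p))).differentiable.comp_differentiableOn
        (hF.holo.differentiableOn)).comp
        (Differentiable.differentiableOn (by fun_prop)) (fun z hz => hz)
    · change imPt s ∈ strip
      rw [strip, mem_preimage, imPt_im]
      exact ⟨hs.1, hs.2.trans_lt hθ₁.2⟩
  -- The angle a(s) is only continuous. Since the value is locally independent of the angle, it can
  -- be frozen at a(s₀), and what remains is analytic in s.
  have hloc : ∀ s₀ ∈ Ioc 0 θ₁, (fun s => contVal σ I' F' (imPt (a s)) (γ s)) =ᶠ[𝓝 s₀]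
      fun s => contVal σ I' F' (imPt (a s₀)) (γ s) := by
    intro s₀ hs₀
    obtain ⟨ε, hε, hball⟩ := Metric.isOpen_iff.1 (hopen I') (a s₀, s₀) (ht s₀ hs₀)
    have hat := hac s₀ ⟨hs₀.1.le, hs₀.2⟩
    filter_upwards [Metric.ball_mem_nhds s₀ hε, hat.preimage_mem_nhds (Metric.ball_mem_nhds _ hε),
      hat.preimage_mem_nhds (isOpen_Ioo.mem_nhds (ha s₀ hs₀))] with s h1 h2 h3
    refine contVal_eq_of_uIcc hF' ⟨h3.1.le, h3.2⟩ ⟨(ha s₀ hs₀).1.le, (ha s₀ hs₀).2⟩ fun θ hθ => ?_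
    have hθ' : θ ∈ Metric.ball (a s₀) ε :=
      ((convex_ball (a s₀) ε).ordConnected.uIcc_subset h2 (Metric.mem_ball_self hε)) hθ
    have h4 : ((θ, s) : ℝ × ℝ) ∈ Metric.ball (a s₀, s₀) ε := by
      rw [← ball_prod_same]; exact ⟨hθ', h1⟩
    have h5 := hball h4
    rwa [mem_ofPred_eq] at h5
  have hf2 : AnalyticOnNhd ℝ (fun s => contVal σ I' F' (imPt (a s)) (γ s)) (Ioc 0 θ₁) := by
    intro s hs
    have hd : Differentiable ℂ fun z : ℂ => (wedgeBoostC I' (((σ : ℤ) : ℂ) * imPt (a s))).mulVec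
        (orbit I (((σ : ℤ) : ℂ) * (z * Complex.I)) p) :=
      (differentiable_mulVecC _).comp ((differentiable_orbit I p).comp (by fun_prop))
    refine analyticAt_ofReal_comp
      (h := fun z : ℂ => contVal σ I' F' (imPt (a s)) (orbit I (((σ : ℤ) : ℂ) * (z * Complex.I)) p))
      (U := (fun z : ℂ => (wedgeBoostC I' (((σ : ℤ) : ℂ) * imPt (a s))).mulVec
        (orbit I (((σ : ℤ) : ℂ) * (z * Complex.I)) p)) ⁻¹' tube)
      (isOpen_tube.preimage hd.continuous) ?_ (ht s hs) (hloc s hs)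
    have h2 := (differentiableOn_expVec hP).comp hd.differentiableOn (fun z hz => hz)
    exact ((pairing P).flip (F' (imPt (a s)))).differentiable.comp_differentiableOn h2
  -- At angle 0 and s = 0 the point is p itself, which lies in the open tube. For small s both
  -- continuations can therefore be carried back to angle 0 within the tube, where both equal ⟨e_ζ,
  -- ψ⟩.
  have hev : ∃ ε > 0, ∀ J : Lorentz, J = I ∨ J = I' → ∀ x ∈ Metric.ball (0 : ℝ) ε,
      ∀ s ∈ Metric.ball (0 : ℝ) ε, (wedgeBoostC J (((σ : ℤ) : ℂ) * imPt x)).mulVec (γ s) ∈ tube := by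
    have h0 : ∀ J : Lorentz, ((0, 0) : ℝ × ℝ) ∈ {x : ℝ × ℝ |
        (wedgeBoostC J (((σ : ℤ) : ℂ) * imPt x.1)).mulVec (γ x.2) ∈ tube} := by
      intro J
      simp only [mem_ofPred_eq, hγ, imPt_zero, mul_zero, wedgeBoostC_zero, Matrix.one_mulVec]
      rw [orbit_eq, neg_zero, wedgeBoostC_zero, Matrix.one_mulVec]
      exact hpt
    obtain ⟨ε, hε, hb⟩ := Metric.isOpen_iff.1 (hopen I) (0, 0) (h0 I)
    obtain ⟨ε', hε', hb'⟩ := Metric.isOpen_iff.1 (hopen I') (0, 0) (h0 I')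
    refine ⟨min ε ε', lt_min hε hε', ?_⟩
    rintro J (rfl | rfl) x hx s hs
    · have h4 : ((x, s) : ℝ × ℝ) ∈ Metric.ball (0, 0) ε := by
        rw [← ball_prod_same]
        exact ⟨Metric.ball_subset_ball (min_le_left _ _) hx,
          Metric.ball_subset_ball (min_le_left _ _) hs⟩
      have h5 := hb h4
      rwa [mem_ofPred_eq] at h5
    · have h4 : ((x, s) : ℝ × ℝ) ∈ Metric.ball (0, 0) ε' := by
        rw [← ball_prod_same]
        exact ⟨Metric.ball_subset_ball (min_le_right _ _) hx,
          Metric.ball_subset_ball (min_le_right _ _) hs⟩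
      have h5 := hb' h4
      rwa [mem_ofPred_eq] at h5
  obtain ⟨ε, hε, hev⟩ := hev
  have hsmall : ∀ᶠ s in 𝓝[>] (0 : ℝ), s ∈ Ioo 0 θ₁ ∧ s ∈ Metric.ball (0 : ℝ) ε ∧
      a s ∈ Metric.ball (0 : ℝ) ε := by
    have hat := hac 0 ⟨le_rfl, hθ₁.1.le⟩
    have h1 : a ⁻¹' Metric.ball 0 ε ∈ 𝓝 (0 : ℝ) :=
      hat.preimage_mem_nhds (by rw [ha0]; exact Metric.ball_mem_nhds _ hε)
    filter_upwards [Ioo_mem_nhdsGT hθ₁.1, mem_nhdsWithin_of_mem_nhds (Metric.ball_mem_nhds 0 hε),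
      mem_nhdsWithin_of_mem_nhds h1] with s h2 h3 h4 using ⟨h2, h3, h4⟩
  have heq : ∀ s, s ∈ Ioo 0 θ₁ → s ∈ Metric.ball (0 : ℝ) ε → a s ∈ Metric.ball (0 : ℝ) ε →
      pairing P (expVec P (toC p)) (F (imPt s)) = contVal σ I' F' (imPt (a s)) (γ s) := by
    intro s hs hs1 hs2
    have hpi := hθ₁.2
    have hI : contVal σ I F (imPt 0) (γ s) = contVal σ I F (imPt s) (γ s) := by
      refine contVal_eq_of_uIcc hF ⟨le_rfl, Real.pi_pos⟩ ⟨hs.1.le, hs.2.trans hpi⟩ fun θ hθ =>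
        hev I (Or.inl rfl) θ ?_ s hs1
      exact ((convex_ball (0 : ℝ) ε).ordConnected.uIcc_subset (Metric.mem_ball_self hε) hs1) hθ
    have hI' : contVal σ I' F' (imPt 0) (γ s) = contVal σ I' F' (imPt (a s)) (γ s) := by
      have := ha s ⟨hs.1, hs.2.le⟩
      refine contVal_eq_of_uIcc hF' ⟨le_rfl, Real.pi_pos⟩ ⟨this.1.le, this.2⟩ fun θ hθ =>
        hev I' (Or.inr rfl) θ ?_ s hs1
      exact ((convex_ball (0 : ℝ) ε).ordConnected.uIcc_subset (Metric.mem_ball_self hε) hs2) hθ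
    rw [← hI', contVal_zero hF', ← contVal_zero hF, hI, hγ, contVal_orbit]
  obtain ⟨s₀, hs₀⟩ := (hsmall.and self_mem_nhdsWithin).exists
  have hnear : (fun s : ℝ => pairing P (expVec P (toC p)) (F (imPt s))) =ᶠ[𝓝 s₀]
      fun s => contVal σ I' F' (imPt (a s)) (γ s) := by
    have hat := hac s₀ ⟨hs₀.1.1.1.le, hs₀.1.1.2.le⟩
    filter_upwards [isOpen_Ioo.mem_nhds hs₀.1.1, Metric.isOpen_ball.mem_nhds hs₀.1.2.1,
      hat.preimage_mem_nhds (Metric.isOpen_ball.mem_nhds hs₀.1.2.2)] with s h1 h2 h3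
    exact heq s h1 h2 h3
  -- Identity theorem for real analytic functions on (0, θ₁]. The point 0 is left out because it
  -- sits on the edge of the strip.
  exact hf1.eqOn_of_preconnected_of_eventuallyEq hf2 isPreconnected_Ioc
    ⟨hs₀.1.1.1, hs₀.1.1.2.le⟩ hnear ⟨hθ₁.1, le_rfl⟩

end Path

/-! ### Independence of the representation of a point -/

lemma cosh_unit_imPt (σ : ℤˣ) (a : ℝ) :
    Complex.cosh (((σ : ℤ) : ℂ) * imPt a) = ((Real.cos a : ℝ) : ℂ) := by
  rcases Int.units_eq_one_or σ with h | h <;> subst h <;> simp [imPt, Complex.cosh_mul_I]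

lemma sinh_unit_imPt (σ : ℤˣ) (a : ℝ) :
    Complex.sinh (((σ : ℤ) : ℂ) * imPt a) =
      ((((σ : ℤ) : ℝ) * Real.sin a : ℝ) : ℂ) * Complex.I := by
  rcases Int.units_eq_one_or σ with h | h <;> subst h <;> simp [imPt, Complex.sinh_mul_I]

lemma reV_boostC (σ : ℤˣ) (a : ℝ) (y : MinkC) :
    reV ((boostC (((σ : ℤ) : ℂ) * imPt a)).mulVec y) =
      ![Real.cos a * (y 0).re + ((σ : ℤ) : ℝ) * Real.sin a * (y 3).im, (y 1).re, (y 2).re,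
        Real.cos a * (y 3).re + ((σ : ℤ) : ℝ) * Real.sin a * (y 0).im] := by
  ext j
  fin_cases j <;>
    simp [reV, boostC, Matrix.mulVec, dotProduct, Fin.sum_univ_four, cosh_unit_imPt,
      sinh_unit_imPt, -Complex.ofReal_cos, -Complex.ofReal_sin, -Complex.ofReal_mul,
      Complex.mul_re, Complex.mul_im]
  ring

lemma boostC_neg_toC (σ : ℤˣ) (a : ℝ) (q : Mink) :
    (boostC (-(((σ : ℤ) : ℂ) * imPt a))).mulVec (toC q) = fun j =>
      ((![Real.cos a * q 0, q 1, q 2, Real.cos a * q 3] j : ℝ) : ℂ) +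
      ((((σ : ℤ) : ℝ) * Real.sin a * ![q 3, 0, 0, q 0] j : ℝ) : ℂ) * Complex.I := by
  ext j
  fin_cases j <;>
    simp [toC, boostC, Matrix.mulVec, dotProduct, Fin.sum_univ_four, cosh_unit_imPt,
      sinh_unit_imPt, Complex.cosh_neg, Complex.sinh_neg] <;> ring

lemma frame_boost (I : Lorentz) (τ : ℂ) (ζ : MinkC) :
    (wedgeBoostC I τ).mulVec ζ = (I.1.map Complex.ofReal).mulVec
      ((boostC τ).mulVec ((I.1⁻¹.map Complex.ofReal).mulVec ζ)) := by
  rw [wedgeBoostC, Matrix.mulVec_mulVec, Matrix.mulVec_mulVec, Matrix.mul_assoc]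

lemma mem_tube_boost (I : Lorentz) (τ : ℂ) (ζ : MinkC)
    (h : reV ((boostC τ).mulVec ((I.1⁻¹.map Complex.ofReal).mulVec ζ)) ∈ fwd) :
    (wedgeBoostC I τ).mulVec ζ ∈ tube := by
  rw [frame_boost, tube, mem_preimage, reV_map_mulVec]
  exact I.ortho.fwd _ h

lemma frame_orbit (I : Lorentz) (τ : ℂ) (p : Mink) :
    (I.1⁻¹.map Complex.ofReal).mulVec (orbit I τ p) =
      (boostC (-τ)).mulVec (toC (I.1⁻¹.mulVec p)) := by
  rw [orbit_eq, frame_boost, Matrix.mulVec_mulVec, map_mul_map, I.inv_mul, map_one_ofReal,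
    Matrix.one_mulVec, toC_mulVec]

lemma mulVec_ofReal_add_mul_I (A : Matrix (Fin 4) (Fin 4) ℝ) (x y : Mink) (c : ℝ) :
    (A.map Complex.ofReal).mulVec (fun j => ((x j : ℝ) : ℂ) + ((c * y j : ℝ) : ℂ) * Complex.I) =
      fun j => ((A.mulVec x j : ℝ) : ℂ) + ((c * A.mulVec y j : ℝ) : ℂ) * Complex.I := by
  ext j
  simp only [Matrix.mulVec, dotProduct, Matrix.map_apply, Fin.sum_univ_four]
  push_cast
  ring

lemma arg_mem_Ioo {z : ℂ} (hz : 0 < z.im) : Complex.arg z ∈ Ioo 0 Real.pi := by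
  constructor
  · refine lt_of_le_of_ne (Complex.arg_nonneg_iff.2 hz.le) fun h => ?_
    have := (Complex.arg_eq_zero_iff.1 h.symm).2
    exact hz.ne' this
  · exact Complex.arg_lt_pi_iff.2 (Or.inr hz.ne')

lemma cos_arg_mul_add {z : ℂ} (hz : z ≠ 0) :
    Real.cos (Complex.arg z) * z.re + Real.sin (Complex.arg z) * z.im = ‖z‖ := by
  have h := norm_pos_iff.2 hz
  rw [Complex.cos_arg hz, Complex.sin_arg, div_mul_eq_mul_div, div_mul_eq_mul_div, ← add_div,
    div_eq_iff h.ne', ← Complex.normSq_eq_norm_sq z |>.trans (pow_two _) , Complex.normSq_apply]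

section Indep

variable {P : ℝ} {hP : 0 < P} {σ : ℤˣ} {I I' : Lorentz} {ψ : Hilb P} {F F' : ℂ → Hilb P}

/-- The regularized continuation depends only on the point, not on its representation. -/
lemma pairing_eq_of_orbit_eq (hF : WedgeOrbit hP σ I ψ F) (hF' : WedgeOrbit hP σ I' ψ F')
    {p p' : Mink} (hp : p ∈ fwd) (hp' : p' ∈ fwd) {θ θ' : ℝ} (hθ : θ ∈ Ioo 0 Real.pi)
    (hθ' : θ' ∈ Ioo 0 Real.pi)
    (h : orbit I (((σ : ℤ) : ℂ) * imPt θ) p = orbit I' (((σ : ℤ) : ℂ) * imPt θ') p') :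
    pairing P (expVec P (toC p)) (F (imPt θ)) = pairing P (expVec P (toC p')) (F' (imPt θ')) := by
  set q := I.1⁻¹.mulVec p with hq
  set q' := I'.1⁻¹.mulVec p' with hq'
  have hqf : q ∈ fwd := I.ortho_inv.fwd _ hp
  have hqf' : q' ∈ fwd := I'.ortho_inv.fwd _ hp'
  set G := I'.1⁻¹ * I.1 with hG
  have hGo : Ortho G := I'.ortho_inv.mul I.ortho
  have hsθ := Real.sin_pos_of_mem_Ioo hθ
  have hsθ' := Real.sin_pos_of_mem_Ioo hθ'
  -- In the frame of I' the orbit at angle s has real part X(s) and imaginary part σ sin s · V. The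
  -- hypothesis on the endpoint fixes V up to the factor c = sin θ'/sin θ: it is c(q'³,0,0,q'⁰).
  set X : ℝ → Mink := fun s => G.mulVec ![Real.cos s * q 0, q 1, q 2, Real.cos s * q 3] with hX
  set V : Mink := G.mulVec ![q 3, 0, 0, q 0] with hV
  have hframe : ∀ s : ℝ, (I'.1⁻¹.map Complex.ofReal).mulVec
      (orbit I (((σ : ℤ) : ℂ) * imPt s) p) = fun j =>
      ((X s j : ℝ) : ℂ) + ((((σ : ℤ) : ℝ) * Real.sin s * V j : ℝ) : ℂ) * Complex.I := by
    intro s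
    rw [hX, hV, ← mulVec_ofReal_add_mul_I, ← boostC_neg_toC, hq, hG, ← map_mul_map,
      ← Matrix.mulVec_mulVec, ← frame_orbit, Matrix.mulVec_mulVec (orbit I _ p), map_mul_map,
      I.mul_inv, map_one_ofReal, Matrix.one_mulVec]
  have hend := hframe θ
  rw [h, frame_orbit, boostC_neg_toC] at hend
  have hre : ∀ j, X θ j = ![Real.cos θ' * q' 0, q' 1, q' 2, Real.cos θ' * q' 3] j := by
    intro j
    have := congrArg Complex.re (congrFun hend j)
    simpa using this.symm
  have him : ∀ j, Real.sin θ * V j = Real.sin θ' * ![q' 3, 0, 0, q' 0] j := by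
    intro j
    have := congrArg Complex.im (congrFun hend j)
    simp only [Complex.add_im, Complex.ofReal_im, Complex.mul_im, Complex.ofReal_re, Complex.I_re,
      Complex.I_im, mul_zero, mul_one, zero_add, add_zero] at this
    rw [mul_assoc, mul_assoc] at this
    have h2 := congrArg (fun x => ((σ : ℤ) : ℝ) * x) this
    simp only [unit_mul_mul] at h2
    exact h2.symm
  set c := Real.sin θ' / Real.sin θ with hc
  have hc0 : 0 < c := div_pos hsθ' hsθ
  have hVj : ∀ j, V j = c * ![q' 3, 0, 0, q' 0] j := by
    intro j
    rw [hc, div_mul_eq_mul_div, ← him j, mul_div_cancel_left₀ _ hsθ.ne']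
  have hV0 : V 0 = c * q' 3 := by simpa using hVj 0
  have hV1 : V 1 = 0 := by simpa using hVj 1
  have hV2 : V 2 = 0 := by simpa using hVj 2
  have hV3 : V 3 = c * q' 0 := by simpa using hVj 3
  have hq0 : 0 < q' 0 := hqf'.2
  have horth : ∀ s, form (X s) V = 0 := by
    intro s
    rw [hX, hV, hGo.pres]
    simp [form]; ring
  have hXX : ∀ s, form (X s) (X s) - Real.sin s ^ 2 * form V V = form q q := by
    intro s
    rw [hX, hV, hGo.pres, hGo.pres]
    have := Real.sin_sq_add_cos_sq s
    simp [form]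
    linear_combination (q 0 * q 0 - q 3 * q 3) * this
  -- X(s) is orthogonal to V because this holds in the frame of I and G preserves the form. Given
  -- the shape of V, this forces the (0,3)-part of X(s) to be a multiple ξ(s) of that of q'.
  set ξ : ℝ → ℝ := fun s => X s 0 / q' 0 with hξ
  have hX0 : ∀ s, X s 0 = ξ s * q' 0 := fun s => by rw [hξ]; field_simp
  have hX3 : ∀ s, X s 3 = ξ s * q' 3 := by
    intro s
    have h1 := horth s
    rw [form, hV0, hV1, hV2, hV3, hX0] at h1
    have h2 : c * q' 0 * (ξ s * q' 3 - X s 3) = 0 := by linear_combination h1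
    have h3 := (mul_eq_zero.1 h2).resolve_left (mul_pos hc0 hq0).ne'
    linarith
  have hnorm : ∀ s, (ξ s ^ 2 + (c * Real.sin s) ^ 2) * (q' 0 ^ 2 - q' 3 ^ 2) =
      form q q + X s 1 ^ 2 + X s 2 ^ 2 := by
    intro s
    have h1 := hXX s
    rw [form, form, hX0, hX3, hV0, hV1, hV2, hV3] at h1
    linear_combination h1
  have hqq : 0 < q' 0 ^ 2 - q' 3 ^ 2 := by
    have h1 := hqf'.1
    rw [form] at h1
    nlinarith [sq_nonneg (q' 1), sq_nonneg (q' 2)]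
  -- Boosting back by the angle α gives the real (0,3)-part (ξ cos α + c sin s sin α)(q'⁰, q'³). The
  -- coefficient is maximal at α = arg z, with value |z|. There the real part has form {q,q} > 0, so
  -- the path stays in the tube. Moreover arg z starts at 0 and, as z(θ) = e^{iθ'}, ends at θ'.
  set z : ℝ → ℂ := fun s => ⟨ξ s, c * Real.sin s⟩ with hz
  have hXc : Continuous X := by
    refine (continuous_mulVec G).comp (continuous_pi fun j => ?_)
    fin_cases j <;> simp <;> fun_prop
  have hξc : Continuous ξ := ((continuous_apply 0).comp hXc).div_const _
  have hzc : Continuous z := by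
    have : z = fun s => ((ξ s : ℝ) : ℂ) + ((c * Real.sin s : ℝ) : ℂ) * Complex.I := by
      ext1 s; apply Complex.ext <;> simp [hz, -Complex.ofReal_sin, -Complex.ofReal_mul]
    rw [this]; fun_prop
  have hX00 : X 0 = I'.1⁻¹.mulVec p := by
    have : ![Real.cos 0 * q 0, q 1, q 2, Real.cos 0 * q 3] = q := by
      ext j; fin_cases j <;> simp
    rw [hX]
    simp only [this]
    rw [hG, hq, Matrix.mulVec_mulVec, Matrix.mul_assoc, I.mul_inv, Matrix.mul_one]
  have hξ0 : 0 < ξ 0 := by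
    have h1 := (I'.ortho_inv.fwd _ hp).2
    rw [← hX00] at h1
    exact div_pos h1 hq0
  have hsin : ∀ s ∈ Ioc 0 θ, 0 < c * Real.sin s := fun s hs =>
    mul_pos hc0 (Real.sin_pos_of_pos_of_lt_pi hs.1 (hs.2.trans_lt hθ.2))
  have key := contVal_eq_of_path hF hF' hp (a := fun s => Complex.arg (z s)) hθ ?_ ?_ ?_ ?_
  · have hzθ : z θ = Complex.cos θ' + Complex.sin θ' * Complex.I := by
      have h1 : ξ θ = Real.cos θ' := by
        rw [hξ]
        simp only [hre]
        simp [hq0.ne']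
      have h2 : c * Real.sin θ = Real.sin θ' := by rw [hc]; field_simp
      rw [hz, ← Complex.ofReal_cos, ← Complex.ofReal_sin]
      apply Complex.ext <;> simp [h1, h2, -Complex.ofReal_cos, -Complex.ofReal_sin]
    have ha : Complex.arg (z θ) = θ' := by
      rw [hzθ]
      exact Complex.arg_cos_add_sin_mul_I ⟨by linarith [hθ'.1, Real.pi_pos], hθ'.2.le⟩
    rw [key]
    simp only [ha]
    rw [h, contVal_orbit]
  · refine Complex.arg_eq_zero_iff.2 ⟨?_, ?_⟩
    · exact hξ0.le
    · simp [hz]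
  · intro s hs
    refine (Complex.continuousAt_arg ?_).comp hzc.continuousAt
    rcases eq_or_lt_of_le hs.1 with h0 | h0
    · rw [← h0]; exact Or.inl hξ0
    · exact Or.inr (hsin s ⟨h0, hs.2⟩).ne'
  · exact fun s hs => arg_mem_Ioo (hsin s hs)
  · intro s hs
    refine mem_tube_boost _ _ _ ?_
    have him0 := hsin s hs
    have hz0 : z s ≠ 0 := fun h0 => by
      have := congrArg Complex.im h0
      exact him0.ne' this
    have hκ := cos_arg_mul_add hz0
    have hn0 := norm_pos_iff.2 hz0
    have hn2 : ‖z s‖ ^ 2 = ξ s ^ 2 + (c * Real.sin s) ^ 2 := by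
      rw [← Complex.normSq_eq_norm_sq, Complex.normSq_apply]; simp only [hz]; ring
    rw [reV_boostC, hframe s]
    have e : ![Real.cos (Complex.arg (z s)) * X s 0 +
          ((σ : ℤ) : ℝ) * Real.sin (Complex.arg (z s)) * (((σ : ℤ) : ℝ) * Real.sin s * V 3),
        X s 1, X s 2, Real.cos (Complex.arg (z s)) * X s 3 +
          ((σ : ℤ) : ℝ) * Real.sin (Complex.arg (z s)) * (((σ : ℤ) : ℝ) * Real.sin s * V 0)] =
        ![‖z s‖ * q' 0, X s 1, X s 2, ‖z s‖ * q' 3] := by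
      have hu := unit_sq σ
      rw [hX0, hX3, hV0, hV3, ← hκ]
      congr 1
      · linear_combination (Real.sin (Complex.arg (z s)) * Real.sin s * c * q' 0) * hu
      · congr 3
        linear_combination (Real.sin (Complex.arg (z s)) * Real.sin s * c * q' 3) * hu
    have e2 : ∀ j, (((X s j : ℝ) : ℂ) + ((((σ : ℤ) : ℝ) * Real.sin s * V j : ℝ) : ℂ) *
        Complex.I).re = X s j := fun j => by simp
    have e3 : ∀ j, (((X s j : ℝ) : ℂ) + ((((σ : ℤ) : ℝ) * Real.sin s * V j : ℝ) : ℂ) *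
        Complex.I).im = ((σ : ℤ) : ℝ) * Real.sin s * V j := fun j => by
      simp [-Complex.ofReal_sin, -Complex.ofReal_mul]
    simp only [e2, e3, e]
    refine ⟨?_, ?_⟩
    · have h1 := hnorm s
      have h2 := hqf.1
      rw [← hn2] at h1
      simp only [form, Matrix.cons_val]
      nlinarith
    · exact mul_pos hn0 hq0

end Indep

/-! ### The regularizing operators -/

/-- The mass shell is a homogeneous space. -/
lemma exists_ortho_mulVec_eq {P : ℝ} (hP : 0 < P) {p p' : Mink} (hp : p ∈ massShell P)
    (hp' : p' ∈ massShell P) : ∃ A, Ortho A ∧ A.mulVec p = p' := by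
  have hpf := massShell_subset_fwd hP hp
  have hpf' := massShell_subset_fwd hP hp'
  set n := p + p' with hn
  have hpp := form_pos hpf hpf'
  have h1 : form p p = P := hp.1
  have h2 : form p' p' = P := hp'.1
  have hnn : form n n = 2 * (P + form p p') := by
    rw [hn, form_add_left, form_add_right, form_add_right, h1, h2, form_comm p' p]; ring
  have hnn0 : 0 < form n n := by rw [hnn]; linarith
  have hnf : n ∈ fwd := ⟨hnn0, add_pos hpf.2 hpf'.2⟩
  -- The half turn about the axis n = p + p': it fixes n and negates the orthogonal complement. It
  -- exchanges p and p' since both have the same form value.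
  let L : Mink →ₗ[ℝ] Mink :=
    { toFun := fun x => (2 * form x n / form n n) • n - x
      map_add' := fun x y => by
        rw [form_add_left, mul_add, add_div, add_smul]; abel
      map_smul' := fun c x => by
        rw [form_smul_left, RingHom.id_apply, smul_sub, smul_smul]
        congr 2; ring }
  have hL : ∀ x, (LinearMap.toMatrix' L).mulVec x = (2 * form x n / form n n) • n - x := fun x => by
    rw [LinearMap.toMatrix'_mulVec]; rfl
  have hpres : PresForm (LinearMap.toMatrix' L) := by
    intro x y
    rw [hL, hL, form_sub_left, form_sub_right, form_sub_right, form_smul_left, form_smul_left,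
      form_smul_right, form_smul_right, form_comm n y]
    field_simp
    ring
  refine ⟨LinearMap.toMatrix' L, ⟨hpres, fun x hx => mem_fwd_of_form hnf ?_ ?_⟩, ?_⟩
  · rw [hpres]; exact hx.1
  · have := form_pos hx hnf
    rw [hL, form_sub_left, form_smul_left, div_mul_cancel₀ _ hnn0.ne']
    linarith
  · rw [hL]
    have e : 2 * form p n / form n n = 1 := by
      rw [hnn, hn, form_add_right, h1, div_self (by linarith)]
    rw [e, one_smul, hn]; abel

/-- With spatial parts p and q, (p⁰q⁰)² - (P + p·q)² = P|p-q|² + |p×q|². So the kernel e^{-b{p,q}}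
has its strict maximum at q = p. -/
lemma lt_form_of_ne {P : ℝ} (hP : 0 < P) {p q : Mink} (hp : p ∈ massShell P) (hq : q ∈ massShell P)
    (h : q ≠ p) : P < form p q := by
  have h1 : p 0 * p 0 - p 1 * p 1 - p 2 * p 2 - p 3 * p 3 = P := hp.1
  have h2 : q 0 * q 0 - q 1 * q 1 - q 2 * q 2 - q 3 * q 3 = P := hq.1
  have hne : 0 < (p 1 - q 1) ^ 2 + (p 2 - q 2) ^ 2 + (p 3 - q 3) ^ 2 := by
    by_contra hcon
    have e1 : q 1 = p 1 := by nlinarith [sq_nonneg (p 1 - q 1), sq_nonneg (p 2 - q 2), sq_nonneg (p 3 - q 3)]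
    have e2 : q 2 = p 2 := by nlinarith [sq_nonneg (p 1 - q 1), sq_nonneg (p 2 - q 2), sq_nonneg (p 3 - q 3)]
    have e3 : q 3 = p 3 := by nlinarith [sq_nonneg (p 1 - q 1), sq_nonneg (p 2 - q 2), sq_nonneg (p 3 - q 3)]
    have e0 : q 0 = p 0 := by
      have hp0 := hp.2
      have hq0 := hq.2
      rw [e1, e2, e3] at h2
      nlinarith
    apply h
    ext j
    fin_cases j <;> assumption
  have hsq : (P + (p 1 * q 1 + p 2 * q 2 + p 3 * q 3)) ^ 2 < (p 0 * q 0) ^ 2 := by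
    have e : (p 0 * q 0) ^ 2 = (P + p 1 * p 1 + p 2 * p 2 + p 3 * p 3) *
        (P + q 1 * q 1 + q 2 * q 2 + q 3 * q 3) := by
      rw [mul_pow]; congr 1 <;> linarith
    rw [e]
    nlinarith [mul_pos hP hne, sq_nonneg (p 1 * q 2 - p 2 * q 1), sq_nonneg (p 1 * q 3 - p 3 * q 1),
      sq_nonneg (p 2 * q 3 - p 3 * q 2)]
  have h3 := abs_lt_of_sq_lt_sq' hsq (mul_pos hp.2 hq.2).le
  rw [form]
  linarith [h3.2]

/-- The real regularizing kernel. -/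
def expKer (b : ℝ) (p q : Mink) : ℝ := Real.exp (-(b * form p q))

lemma expKer_pos (b : ℝ) (p q : Mink) : 0 < expKer b p q := Real.exp_pos _

lemma continuous_expKer (b : ℝ) : Continuous fun x : Mink × Mink => expKer b x.1 x.2 := by
  unfold expKer form; fun_prop

lemma expKer_comm (b : ℝ) (p q : Mink) : expKer b p q = expKer b q p := by
  rw [expKer, expKer, form_comm]

lemma integrable_expKer {P : ℝ} (hP : 0 < P) {b : ℝ} (hb : 0 < b) {p : Mink}
    (hp : p ∈ massShell P) : Integrable (expKer b p) (shellMeasure P) := by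
  have hκ : 0 < p 0 - spatialNorm p := sub_pos.2 (mem_fwd_iff.1 (massShell_subset_fwd hP hp))
  have h := (memLp_two_iff_integrable_sq (by fun_prop)).1
    (memLp_exp_neg_norm hP (by positivity : 0 < b * (p 0 - spatialNorm p) / 2))
  refine h.mono' ((continuous_expKer b).comp (Continuous.prodMk_right p)).aestronglyMeasurable ?_
  filter_upwards [ae_mem_massShell hP] with q hq
  rw [Real.norm_of_nonneg (expKer_pos b p q).le, expKer, pow_two, ← Real.exp_add]
  refine Real.exp_le_exp.2 ?_
  have := le_form (x := p) (mem_fwd_iff.1 (massShell_subset_fwd hP hq)).le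
  rw [norm_massShell hP hq]
  nlinarith

/-- The normalization of the regularizing kernel. -/
def kerMass (P b : ℝ) : ℝ := ∫ q, expKer b (shellPoint P 0) q ∂(shellMeasure P)

/-- The Lorentz group acts transitively on the mass shell and preserves kernel and measure. The
constant mass is what makes the Schur test give a contraction. -/
lemma integral_expKer {P : ℝ} (hP : 0 < P) (b : ℝ) {p : Mink} (hp : p ∈ massShell P) :
    ∫ q, expKer b p q ∂(shellMeasure P) = kerMass P b := by
  obtain ⟨A, hA, rfl⟩ := exists_ortho_mulVec_eq hP (shellPoint_mem hP 0) hp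
  rw [← integral_comp_mulVec hP hA, kerMass]
  simp only [expKer, hA.pres _ _]

lemma shellMeasure_pos {P : ℝ} (hP : 0 < P) {p : Mink} (hp : p ∈ massShell P) {u : Set Mink}
    (hu : u ∈ 𝓝 p) : 0 < shellMeasure P u := by
  obtain ⟨v, hvu, hvo, hpv⟩ := mem_nhds_iff.1 hu
  refine lt_of_lt_of_le ?_ (measure_mono hvu)
  rw [shellMeasure_eq, Measure.map_apply (continuous_shellPoint P).measurable hvo.measurableSet]
  have hopen : IsOpen (shellPoint P ⁻¹' v) := hvo.preimage (continuous_shellPoint P)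
  have hne : (shellPoint P ⁻¹' v).Nonempty := ⟨_, by
    rw [mem_preimage, shellPoint_tail hP hp]; exact hpv⟩
  rw [pos_iff_ne_zero, Ne, withDensity_apply_eq_zero (measurable_density P)]
  have e : {x | ENNReal.ofReal (1 / energy P x) ≠ 0} ∩ shellPoint P ⁻¹' v = shellPoint P ⁻¹' v := by
    refine inter_eq_right.2 fun x _ => ?_
    have := energy_pos hP x
    have h2 : ENNReal.ofReal (1 / energy P x) ≠ 0 := by
      rw [Ne, ENNReal.ofReal_eq_zero, not_le]; positivity
    exact h2
  rw [e]
  exact (hopen.measure_pos volume hne).ne'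

lemma kerMass_pos {P : ℝ} (hP : 0 < P) {b : ℝ} (hb : 0 < b) : 0 < kerMass P b := by
  have := shellMeasure_pos hP (shellPoint_mem hP 0) univ_mem
  have hi := integrable_expKer hP hb (shellPoint_mem hP 0)
  rw [kerMass, integral_pos_iff_support_of_nonneg (fun q => (expKer_pos b _ q).le) hi]
  have e : Function.support (expKer b (shellPoint P 0)) = univ :=
    eq_univ_of_forall fun q => (expKer_pos b _ q).ne'
  rwa [e]

/-- Away from `p`, the form `{p, q}` is bounded away from its minimum `P`. -/
lemma exists_form_gap {P : ℝ} (hP : 0 < P) {p : Mink} (hp : p ∈ massShell P) {u : Set Mink}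
    (hu : u ∈ 𝓝 p) : ∃ δ > 0, ∀ q ∈ massShell P, q ∉ u → P + δ ≤ form p q := by
  obtain ⟨v, hvu, hvo, hpv⟩ := mem_nhds_iff.1 hu
  have hκ : 0 < p 0 - spatialNorm p := sub_pos.2 (mem_fwd_iff.1 (massShell_subset_fwd hP hp))
  set S := massShell P ∩ vᶜ ∩ {q | form p q ≤ P + 1} with hS
  have hcl : IsClosed S := ((isClosed_massShell hP).inter hvo.isClosed_compl).inter
    (isClosed_le (continuous_form_right p) continuous_const)
  have hbd : S ⊆ Metric.closedBall 0 ((P + 1) / (p 0 - spatialNorm p)) := by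
    intro q hq
    rw [mem_closedBall_zero_iff, norm_massShell hP hq.1.1, le_div_iff₀ hκ]
    have := le_form (x := p) (mem_fwd_iff.1 (massShell_subset_fwd hP hq.1.1)).le
    have h2 : form p q ≤ P + 1 := hq.2
    linarith
  have hc : IsCompact S := (isCompact_closedBall _ _).of_isClosed_subset hcl hbd
  rcases S.eq_empty_or_nonempty with he | hne
  · refine ⟨1, one_pos, fun q hq hqu => ?_⟩
    by_contra hcon
    exact notMem_empty q (he ▸ ⟨⟨hq, fun h => hqu (hvu h)⟩, (not_le.1 hcon).le⟩)
  · obtain ⟨q₀, hq₀, hmin⟩ := hc.exists_isMinOn hne (continuous_form_right p).continuousOn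
    have h1 : P < form p q₀ := lt_form_of_ne hP hp hq₀.1.1 fun h => hq₀.1.2 (h ▸ hpv)
    refine ⟨min 1 (form p q₀ - P), lt_min one_pos (by linarith), fun q hq hqu => ?_⟩
    by_cases h2 : form p q ≤ P + 1
    · have h3 := hmin (show q ∈ S from ⟨⟨hq, fun h => hqu (hvu h)⟩, h2⟩)
      have h4 : form p q₀ ≤ form p q := h3
      have := min_le_right 1 (form p q₀ - P)
      linarith
    · have := min_le_left 1 (form p q₀ - P)
      linarith

/-- The regularizing kernels concentrate at the diagonal. -/
lemma tendsto_tail {P : ℝ} (hP : 0 < P) {p : Mink} (hp : p ∈ massShell P) {u : Set Mink}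
    (hu : u ∈ 𝓝 p) (hum : MeasurableSet u) :
    Tendsto (fun n : ℕ => (∫ q in uᶜ, expKer ((n : ℝ) + 1) p q ∂(shellMeasure P)) /
      kerMass P ((n : ℝ) + 1)) atTop (𝓝 0) := by
  have := isLocallyFiniteMeasure_shellMeasure hP
  obtain ⟨δ, hδ, hgap⟩ := exists_form_gap hP hp hu
  have hform : form p p = P := hp.1
  -- Outside u the form exceeds P + δ, while on v it stays below P + δ/2. The gap makes the ratio of
  -- the two integrals decay like e^{-nδ/2}. The ball keeps the measure of v finite.
  set v : Set Mink := Metric.ball p 1 ∩ {q | form p q < P + δ / 2} with hv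
  have hvo : IsOpen v := Metric.isOpen_ball.inter
    (isOpen_lt (continuous_form_right p) continuous_const)
  have hpv : p ∈ v := ⟨Metric.mem_ball_self one_pos, by
    rw [mem_ofPred_eq, hform]; linarith⟩
  have hvpos := shellMeasure_pos hP hp (hvo.mem_nhds hpv)
  have hvfin : shellMeasure P v ≠ ⊤ := ne_top_of_le_ne_top
    (isCompact_closedBall p 1).measure_lt_top.ne
    (measure_mono (inter_subset_left.trans Metric.ball_subset_closedBall))
  set m := (shellMeasure P).real v with hm
  have hm0 : 0 < m := ENNReal.toReal_pos hvpos.ne' hvfin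
  set C := ∫ q, expKer 1 p q ∂(shellMeasure P) with hC
  have hi : ∀ n : ℕ, Integrable (expKer ((n : ℝ) + 1) p) (shellMeasure P) := fun n =>
    integrable_expKer hP (by positivity) hp
  -- Of the exponent n+1 one unit is kept in the kernel for integrability; the other n provide the
  -- decay.
  have hup : ∀ n : ℕ, ∫ q in uᶜ, expKer ((n : ℝ) + 1) p q ∂(shellMeasure P) ≤
      Real.exp (-(n * (P + δ))) * C := by
    intro n
    rw [hC, ← integral_const_mul]
    have hi1 := (integrable_expKer hP one_pos hp).const_mul (Real.exp (-(n * (P + δ))))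
    refine (setIntegral_mono_on_ae (hi n).integrableOn hi1.integrableOn hum.compl ?_).trans
      (setIntegral_le_integral hi1 (Eventually.of_forall fun q =>
        (mul_pos (Real.exp_pos _) (expKer_pos _ _ _)).le))
    filter_upwards [ae_mem_massShell hP] with q hq hqu
    rw [expKer, expKer, ← Real.exp_add]
    refine Real.exp_le_exp.2 ?_
    have := mul_le_mul_of_nonneg_left (hgap q hq hqu) (n.cast_nonneg (α := ℝ))
    linarith
  have hlow : ∀ n : ℕ, Real.exp (-((n + 1) * (P + δ / 2))) * m ≤ kerMass P ((n : ℝ) + 1) := by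
    intro n
    rw [← integral_expKer hP _ hp]
    refine le_trans ?_ (setIntegral_le_integral (s := v) (hi n)
      (Eventually.of_forall fun q => (expKer_pos _ _ _).le))
    rw [mul_comm, ← smul_eq_mul, ← setIntegral_const]
    refine setIntegral_mono_on (integrableOn_const hvfin) (hi n).integrableOn hvo.measurableSet
      fun q hq => ?_
    rw [expKer]
    refine Real.exp_le_exp.2 ?_
    have h2 : form p q < P + δ / 2 := hq.2
    have : ((n : ℝ) + 1) * form p q ≤ (n + 1) * (P + δ / 2) :=
      mul_le_mul_of_nonneg_left h2.le (by positivity)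
    linarith
  have hlim : Tendsto (fun n : ℕ => Real.exp (P + δ / 2) * C / m * Real.exp (-(n * (δ / 2)))) atTop
      (𝓝 0) := by
    have h1 : Tendsto (fun n : ℕ => -((n : ℝ) * (δ / 2))) atTop atBot :=
      tendsto_neg_atTop_atBot.comp (tendsto_natCast_atTop_atTop.atTop_mul_const (by linarith))
    simpa using (Real.tendsto_exp_atBot.comp h1).const_mul (Real.exp (P + δ / 2) * C / m)
  refine squeeze_zero (fun n => div_nonneg (setIntegral_nonneg hum.compl
    fun q _ => (expKer_pos _ _ _).le) (kerMass_pos hP (by positivity)).le) (fun n => ?_) hlim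
  have hC0 : 0 ≤ C := integral_nonneg fun q => (expKer_pos _ _ _).le
  calc _ ≤ Real.exp (-(n * (P + δ))) * C / (Real.exp (-((n + 1) * (P + δ / 2))) * m) := by
        refine div_le_div₀ (by positivity) (hup n) (by positivity) (hlow n)
    _ = _ := by
        have e : Real.exp (-(n * (P + δ))) = Real.exp (P + δ / 2) *
            Real.exp (-(n * (δ / 2))) * Real.exp (-((n + 1) * (P + δ / 2))) := by
          rw [← Real.exp_add, ← Real.exp_add]; ring_nf
        have := Real.exp_pos (-((n + 1) * (P + δ / 2)))
        rw [e]; field_simp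

lemma norm_average_le {P : ℝ} (hP : 0 < P) {b : ℝ} (hb : 0 < b) {p : Mink} (hp : p ∈ massShell P)
    {g : Mink → ℂ} {G : ℝ} (hG : ∀ q, ‖g q‖ ≤ G) :
    ‖(∫ q, (expKer b p q : ℂ) * g q ∂(shellMeasure P)) / (kerMass P b : ℂ)‖ ≤ G := by
  have hJ := kerMass_pos hP hb
  rw [norm_div, Complex.norm_real, Real.norm_of_nonneg hJ.le, div_le_iff₀ hJ, mul_comm,
    ← integral_expKer hP b hp, ← integral_mul_const]
  refine norm_integral_le_of_norm_le ((integrable_expKer hP hb hp).mul_const G)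
    (Eventually.of_forall fun q => ?_)
  rw [norm_mul, Complex.norm_real, Real.norm_of_nonneg (expKer_pos b p q).le]
  exact mul_le_mul_of_nonneg_left (hG q) (expKer_pos b p q).le

lemma tendsto_average {P : ℝ} (hP : 0 < P) {p : Mink} (hp : p ∈ massShell P) {g : Mink → ℂ}
    (hg : Continuous g) {G : ℝ} (hG : ∀ q, ‖g q‖ ≤ G) :
    Tendsto (fun n : ℕ => (∫ q, (expKer ((n : ℝ) + 1) p q : ℂ) * g q ∂(shellMeasure P)) /
      (kerMass P ((n : ℝ) + 1) : ℂ)) atTop (𝓝 (g p)) := by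
  have hG0 : 0 ≤ G := (norm_nonneg _).trans (hG 0)
  rw [Metric.tendsto_atTop]
  intro ε hε
  have hb : ∀ n : ℕ, (0 : ℝ) < (n : ℝ) + 1 := fun n => by positivity
  set u : Set Mink := {q | ‖g q - g p‖ < ε / 2} with hu
  have huo : IsOpen u := isOpen_lt (hg.sub continuous_const).norm continuous_const
  have hpu : p ∈ u := by simp [hu, hε]
  have ht := tendsto_tail hP hp (huo.mem_nhds hpu) huo.measurableSet
  -- Chosen so that 2G times this number is less than ε/2, also when G = 0.
  obtain ⟨N, hN⟩ := Metric.tendsto_atTop.1 ht (ε / (2 * (2 * G + 1))) (by positivity)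
  refine ⟨N, fun n hn => ?_⟩
  have hJ := kerMass_pos hP (hb n)
  set b := (n : ℝ) + 1 with hbd
  have hi := integrable_expKer hP (hb n) hp
  have hic : Integrable (fun q => (expKer b p q : ℂ)) (shellMeasure P) := hi.ofReal
  have hig : Integrable (fun q => (expKer b p q : ℂ) * g q) (shellMeasure P) :=
    hic.mul_bdd (c := G) hg.aestronglyMeasurable (Eventually.of_forall hG)
  have e1 : (∫ q, (expKer b p q : ℂ) * g q ∂(shellMeasure P)) / (kerMass P b : ℂ) - g p =
      (∫ q, (expKer b p q : ℂ) * (g q - g p) ∂(shellMeasure P)) / (kerMass P b : ℂ) := by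
    simp only [mul_sub]
    rw [integral_sub hig (hic.mul_const _), integral_mul_const, integral_complex_ofReal,
      integral_expKer hP b hp, sub_div, mul_div_cancel_left₀]
    exact_mod_cast hJ.ne'
  have hpt : ∀ q, ‖(expKer b p q : ℂ) * (g q - g p)‖ ≤
      ε / 2 * expKer b p q + 2 * G * (uᶜ).indicator (expKer b p) q := by
    intro q
    have hk := expKer_pos b p q
    rw [norm_mul, Complex.norm_real, Real.norm_of_nonneg hk.le]
    by_cases hq : q ∈ u
    · rw [indicator_of_notMem (by simpa using hq)]
      have : ‖g q - g p‖ < ε / 2 := hq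
      nlinarith
    · rw [indicator_of_mem (by simpa using hq)]
      have := (norm_sub_le (g q) (g p)).trans (add_le_add (hG q) (hG p))
      nlinarith
  have h2 : ‖∫ q, (expKer b p q : ℂ) * (g q - g p) ∂(shellMeasure P)‖ ≤
      ε / 2 * kerMass P b + 2 * G * ∫ q in uᶜ, expKer b p q ∂(shellMeasure P) := by
    have hind : Integrable ((uᶜ).indicator (expKer b p)) (shellMeasure P) :=
      hi.indicator huo.measurableSet.compl
    refine (norm_integral_le_of_norm_le ((hi.const_mul _).add (hind.const_mul _))
      (Eventually.of_forall hpt)).trans_eq ?_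
    simp only [Pi.add_apply]
    rw [integral_add (hi.const_mul _) (hind.const_mul _), integral_const_mul, integral_const_mul,
      integral_expKer hP b hp, integral_indicator huo.measurableSet.compl]
  rw [dist_eq_norm, e1, norm_div, Complex.norm_real, Real.norm_of_nonneg hJ.le, div_lt_iff₀ hJ]
  have h3 := hN n hn
  rw [dist_zero_right, Real.norm_of_nonneg (div_nonneg (setIntegral_nonneg huo.measurableSet.compl
    fun q _ => (expKer_pos _ _ _).le) hJ.le), div_lt_iff₀ hJ] at h3
  have h4 : 2 * G * (ε / (2 * (2 * G + 1))) < ε / 2 := by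
    rw [mul_div_assoc', div_lt_iff₀ (by positivity)]; nlinarith
  have h5 : 2 * G * ∫ q in uᶜ, expKer b p q ∂(shellMeasure P) ≤
      2 * G * (ε / (2 * (2 * G + 1)) * kerMass P b) := by gcongr
  nlinarith

/-- Cauchy–Schwarz after splitting the kernel as K^{1/2} · K^{1/2} g. -/
lemma lintegral_mul_sq_le {α : Type*} [MeasurableSpace α] {μ : Measure α} {K g : α → ENNReal}
    (hK : Measurable K) (hg : Measurable g) :
    (∫⁻ a, K a * g a ∂μ) ^ 2 ≤ (∫⁻ a, K a ∂μ) * ∫⁻ a, K a * g a ^ 2 ∂μ := by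
  have h := ENNReal.lintegral_mul_le_Lp_mul_Lq μ Real.HolderConjugate.two_two
    (f := fun a => K a ^ (1 / 2 : ℝ)) (g := fun a => K a ^ (1 / 2 : ℝ) * g a)
    (hK.pow_const _).aemeasurable ((hK.pow_const _).mul hg).aemeasurable
  have e0 : ∀ a, K a ^ (1 / 2 : ℝ) * K a ^ (1 / 2 : ℝ) = K a := fun a => by
    rw [← ENNReal.rpow_add_of_nonneg _ _ (by norm_num) (by norm_num)]; norm_num
  have e1 : ∀ a, ((fun a => K a ^ (1 / 2 : ℝ)) * fun a => K a ^ (1 / 2 : ℝ) * g a) a =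
      K a * g a := fun a => by
    rw [Pi.mul_apply, ← mul_assoc, e0]
  have e2 : ∀ a, (K a ^ (1 / 2 : ℝ)) ^ (2 : ℝ) = K a := fun a => by
    rw [← ENNReal.rpow_mul]; norm_num
  have e3 : ∀ a, (K a ^ (1 / 2 : ℝ) * g a) ^ (2 : ℝ) = K a * g a ^ 2 := fun a => by
    rw [ENNReal.mul_rpow_of_nonneg _ _ (by norm_num), e2, ENNReal.rpow_two]
  simp only [e1, e2, e3] at h
  calc (∫⁻ a, K a * g a ∂μ) ^ 2
      ≤ ((∫⁻ a, K a ∂μ) ^ (1 / 2 : ℝ) * (∫⁻ a, K a * g a ^ 2 ∂μ) ^ (1 / 2 : ℝ)) ^ 2 := by gcongr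
    _ = _ := by
      rw [mul_pow, ← ENNReal.rpow_natCast, ← ENNReal.rpow_natCast, ← ENNReal.rpow_mul,
        ← ENNReal.rpow_mul]
      norm_num

/-- Schur's test for a symmetric kernel with constant mass. -/
lemma lintegral_sq_le_of_symm_kernel {α : Type*} [MeasurableSpace α] {μ : Measure α} [SFinite μ]
    {K : α → α → ENNReal} {g h : α → ENNReal} {J : ENNReal} (hJ0 : J ≠ 0) (hJt : J ≠ ⊤)
    (hK : Measurable (Function.uncurry K)) (hg : Measurable g) (hsymm : ∀ p q, K p q = K q p)
    (hmass : ∀ᵐ p ∂μ, ∫⁻ q, K p q ∂μ = J)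
    (hh : ∀ᵐ p ∂μ, h p ≤ J⁻¹ * ∫⁻ q, K p q * g q ∂μ) :
    ∫⁻ p, h p ^ 2 ∂μ ≤ ∫⁻ p, g p ^ 2 ∂μ := by
  have hK1 : ∀ p, Measurable (K p) := fun p => hK.comp measurable_prodMk_left
  have hK2 : ∀ q, Measurable fun p => K p q := fun q => hK.comp measurable_prodMk_right
  have hpt : ∀ᵐ p ∂μ, h p ^ 2 ≤ J⁻¹ * ∫⁻ q, K p q * g q ^ 2 ∂μ := by
    filter_upwards [hmass, hh] with p hp h1
    calc h p ^ 2 ≤ (J⁻¹ * ∫⁻ q, K p q * g q ∂μ) ^ 2 := by gcongr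
      _ = J⁻¹ ^ 2 * (∫⁻ q, K p q * g q ∂μ) ^ 2 := by rw [mul_pow]
      _ ≤ J⁻¹ ^ 2 * (J * ∫⁻ q, K p q * g q ^ 2 ∂μ) := by
          gcongr
          exact (lintegral_mul_sq_le (hK1 p) hg).trans_eq (by rw [hp])
      _ = _ := by
          rw [pow_two, ← mul_assoc, mul_assoc J⁻¹, ENNReal.inv_mul_cancel hJ0 hJt, mul_one]
  have hmeas : AEMeasurable (Function.uncurry fun p q => K p q * g q ^ 2) (μ.prod μ) :=
    (hK.mul ((hg.pow_const 2).comp measurable_snd)).aemeasurable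
  calc ∫⁻ p, h p ^ 2 ∂μ ≤ ∫⁻ p, J⁻¹ * ∫⁻ q, K p q * g q ^ 2 ∂μ ∂μ := lintegral_mono_ae hpt
    _ = J⁻¹ * ∫⁻ q, ∫⁻ p, K p q * g q ^ 2 ∂μ ∂μ := by
        rw [lintegral_const_mul' _ _ (ENNReal.inv_ne_top.2 hJ0), lintegral_lintegral_swap hmeas]
    _ = J⁻¹ * ∫⁻ q, J * g q ^ 2 ∂μ := by
        congr 1
        refine lintegral_congr_ae ?_
        filter_upwards [hmass] with q hq
        rw [lintegral_mul_const _ (hK2 q)]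
        simp only [hsymm _ q, hq]
    _ = _ := by
        rw [lintegral_const_mul _ (hg.pow_const 2), ← mul_assoc, ENNReal.inv_mul_cancel hJ0 hJt,
          one_mul]

/-! ### The regularizations as contractions converging to the identity -/

section Reg

variable {P : ℝ}

/-- The regularization of a vector, as a function on the mass shell. -/
def regFn (P : ℝ) (n : ℕ) (f : Hilb P) (p : Mink) : ℂ :=
  pairing P (expVec P (toC (((n : ℝ) + 1) • p))) f / (kerMass P ((n : ℝ) + 1) : ℂ)

lemma smul_mem_fwd {b : ℝ} (hb : 0 < b) {p : Mink} (hp : p ∈ fwd) : b • p ∈ fwd :=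
  ⟨by rw [form_smul_left, form_smul_right]; have := hp.1; positivity, mul_pos hb hp.2⟩

lemma regFn_eq (hP : 0 < P) (n : ℕ) (f : Hilb P) {p : Mink} (hp : p ∈ massShell P) :
    regFn P n f p = (∫ q, (expKer ((n : ℝ) + 1) p q : ℂ) * f q ∂(shellMeasure P)) /
      (kerMass P ((n : ℝ) + 1) : ℂ) := by
  rw [regFn, pairing_apply]
  congr 1
  have ht : toC (((n : ℝ) + 1) • p) ∈ tube :=
    smul_mem_fwd (by positivity) (massShell_subset_fwd hP hp)
  refine integral_congr_ae ?_
  filter_upwards [coeFn_expVec hP ht] with q hq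
  rw [hq, kern, form_toC, form_smul_left, expKer, Complex.ofReal_exp, Complex.ofReal_neg]

lemma regFn_sub (n : ℕ) (f g : Hilb P) (p : Mink) :
    regFn P n (f - g) p = regFn P n f p - regFn P n g p := by
  rw [regFn, regFn, regFn, map_sub, sub_div]

lemma continuousOn_regFn (hP : 0 < P) (n : ℕ) (f : Hilb P) :
    ContinuousOn (regFn P n f) (massShell P) := by
  refine ContinuousOn.div_const ?_ _
  have h : ContinuousOn (fun p : Mink => expVec P (toC (((n : ℝ) + 1) • p))) (massShell P) :=
    (differentiableOn_expVec hP).continuousOn.comp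
      (continuous_toC.comp (continuous_const_smul _)).continuousOn
      fun p hp => smul_mem_fwd (by positivity) (massShell_subset_fwd hP hp)
  exact ((pairing P).continuous.comp_continuousOn h).clm_apply continuousOn_const

lemma shellMeasure_restrict (hP : 0 < P) :
    (shellMeasure P).restrict (massShell P) = shellMeasure P :=
  Measure.restrict_eq_self_of_ae_mem (ae_mem_massShell hP)

lemma aestronglyMeasurable_regFn (hP : 0 < P) (n : ℕ) (f : Hilb P) :
    AEStronglyMeasurable (regFn P n f) (shellMeasure P) := by
  rw [← shellMeasure_restrict hP]
  exact (continuousOn_regFn hP n f).aestronglyMeasurable (measurableSet_massShell P)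

lemma lintegral_regFn_sq_le (hP : 0 < P) (n : ℕ) (f : Hilb P) :
    ∫⁻ p, ‖regFn P n f p‖ₑ ^ 2 ∂(shellMeasure P) ≤ ∫⁻ p, ‖f p‖ₑ ^ 2 ∂(shellMeasure P) := by
  have := isLocallyFiniteMeasure_shellMeasure hP
  have hb0 : (0 : ℝ) < (n : ℝ) + 1 := by positivity
  generalize hb : (n : ℝ) + 1 = b at hb0
  have hJ := kerMass_pos hP hb0
  refine lintegral_sq_le_of_symm_kernel (K := fun p q => ENNReal.ofReal (expKer b p q))
    (J := ENNReal.ofReal (kerMass P b)) (by rw [Ne, ENNReal.ofReal_eq_zero, not_le]; exact hJ)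
    ENNReal.ofReal_ne_top (continuous_expKer b).measurable.ennreal_ofReal
    (Lp.stronglyMeasurable f).measurable.enorm (fun p q => by rw [expKer_comm]) ?_ ?_
  · filter_upwards [ae_mem_massShell hP] with p hp
    rw [← integral_expKer hP b hp, ofReal_integral_eq_lintegral_ofReal
      (integrable_expKer hP hb0 hp) (Eventually.of_forall fun q => (expKer_pos b p q).le)]
  · filter_upwards [ae_mem_massShell hP] with p hp
    rw [regFn_eq hP n f hp, hb, div_eq_mul_inv, mul_comm, enorm_mul]
    refine mul_le_mul' (le_of_eq ?_) ?_
    · rw [enorm_inv (by exact_mod_cast hJ.ne'), ← ofReal_norm, Complex.norm_real,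
        Real.norm_of_nonneg hJ.le]
    · refine (enorm_integral_le_lintegral_enorm _).trans_eq (lintegral_congr fun q => ?_)
      rw [enorm_mul, ← ofReal_norm, Complex.norm_real,
        Real.norm_of_nonneg (expKer_pos b p q).le]

lemma eLpNorm_two_eq {α : Type*} [MeasurableSpace α] {μ : Measure α} (f : α → ℂ) :
    eLpNorm f 2 μ = (∫⁻ a, ‖f a‖ₑ ^ 2 ∂μ) ^ (1 / 2 : ℝ) := by
  rw [eLpNorm_eq_lintegral_rpow_enorm_toReal (by norm_num) (by norm_num)]
  simp

lemma eLpNorm_regFn_le (hP : 0 < P) (n : ℕ) (f : Hilb P) :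
    eLpNorm (regFn P n f) 2 (shellMeasure P) ≤ eLpNorm f 2 (shellMeasure P) := by
  rw [eLpNorm_two_eq, eLpNorm_two_eq]
  exact ENNReal.rpow_le_rpow (lintegral_regFn_sq_le hP n f) (by norm_num)

lemma memLp_regFn (hP : 0 < P) (n : ℕ) (f : Hilb P) : MemLp (regFn P n f) 2 (shellMeasure P) :=
  ⟨aestronglyMeasurable_regFn hP n f, (eLpNorm_regFn_le hP n f).trans_lt (Lp.memLp f).2⟩

/-- The regularization of a vector. -/
def reg (hP : 0 < P) (n : ℕ) (f : Hilb P) : Hilb P := (memLp_regFn hP n f).toLp _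

lemma coeFn_reg (hP : 0 < P) (n : ℕ) (f : Hilb P) :
    reg hP n f =ᵐ[shellMeasure P] regFn P n f := MemLp.coeFn_toLp _

lemma norm_reg_le (hP : 0 < P) (n : ℕ) (f : Hilb P) : ‖reg hP n f‖ ≤ ‖f‖ := by
  rw [reg, Lp.norm_toLp, Lp.norm_def]
  exact ENNReal.toReal_mono (Lp.memLp f).2.ne (eLpNorm_regFn_le hP n f)

lemma reg_sub (hP : 0 < P) (n : ℕ) (f g : Hilb P) :
    reg hP n (f - g) = reg hP n f - reg hP n g := by
  ext1
  filter_upwards [coeFn_reg hP n (f - g), coeFn_reg hP n f, coeFn_reg hP n g,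
    Lp.coeFn_sub (reg hP n f) (reg hP n g)] with p h1 h2 h3 h4
  rw [h1, h4, Pi.sub_apply, h2, h3, regFn_sub]

/-- Pointwise convergence and compact support of g give ⟨γ, reg γ⟩ → ‖γ‖². Together with the
contraction property this forces norm convergence, without control of the tails of the regularized
function. -/
lemma tendsto_reg_of_continuous (hP : 0 < P) {g : Mink → ℂ} (hg : Continuous g)
    (hgc : HasCompactSupport g) (hm : MemLp g 2 (shellMeasure P)) :
    Tendsto (fun n => reg hP n (hm.toLp g)) atTop (𝓝 (hm.toLp g)) := by
  have := isLocallyFiniteMeasure_shellMeasure hP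
  obtain ⟨G, hG⟩ := hg.bounded_above_of_compact_support hgc
  set γ : Hilb P := hm.toLp g with hγ
  have hcoe : γ =ᵐ[shellMeasure P] g := hm.coeFn_toLp
  have hav : ∀ n : ℕ, ∀ p ∈ massShell P, regFn P n γ p =
      (∫ q, (expKer ((n : ℝ) + 1) p q : ℂ) * g q ∂(shellMeasure P)) /
        (kerMass P ((n : ℝ) + 1) : ℂ) := by
    intro n p hp
    rw [regFn_eq hP n γ hp]
    congr 1
    refine integral_congr_ae ?_
    filter_upwards [hcoe] with q hq
    rw [hq]
  have hinner : Tendsto (fun n => inner ℂ γ (reg hP n γ)) atTop (𝓝 (inner ℂ γ γ)) := by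
    simp only [L2.inner_def]
    refine tendsto_integral_of_dominated_convergence (fun p => ‖g p‖ * G) ?_ ?_ ?_ ?_
    · exact fun n => ((Lp.aestronglyMeasurable γ).inner (Lp.aestronglyMeasurable (reg hP n γ)))
    · exact ((hg.integrable_of_hasCompactSupport hgc).norm.mul_const G)
    · intro n
      filter_upwards [coeFn_reg hP n γ, hcoe, ae_mem_massShell hP] with p h1 h2 hp
      refine (norm_inner_le_norm _ _).trans ?_
      rw [h1, h2, hav n p hp]
      exact mul_le_mul_of_nonneg_left (norm_average_le hP (by positivity) hp hG) (norm_nonneg _)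
    · have hall : ∀ᵐ p ∂(shellMeasure P), ∀ n, reg hP n γ p = regFn P n γ p :=
        ae_all_iff.2 fun n => coeFn_reg hP n γ
      filter_upwards [hall, hcoe, ae_mem_massShell hP] with p h1 h2 hp
      simp only [h1, h2, hav _ p hp]
      exact ((continuous_const.inner continuous_id).tendsto (g p)).comp
        (tendsto_average hP hp hg hG)
  have hsq : ∀ n, ‖reg hP n γ - γ‖ ^ 2 ≤
      2 * ‖γ‖ ^ 2 - 2 * RCLike.re (inner ℂ γ (reg hP n γ)) := by
    intro n
    rw [norm_sub_sq (𝕜 := ℂ), ← inner_re_symm]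
    have := pow_le_pow_left₀ (norm_nonneg _) (norm_reg_le hP n γ) 2
    linarith
  have hlim : Tendsto (fun n => 2 * ‖γ‖ ^ 2 - 2 * RCLike.re (inner ℂ γ (reg hP n γ))) atTop
      (𝓝 0) := by
    have h1 := ((RCLike.continuous_re.tendsto _).comp hinner).const_mul 2 |>.const_sub (2 * ‖γ‖ ^ 2)
    rw [inner_self_eq_norm_sq, sub_self] at h1
    exact h1
  have h0 := squeeze_zero (fun n => sq_nonneg _) hsq hlim
  rw [tendsto_iff_norm_sub_tendsto_zero]
  have := h0.sqrt
  simpa [Real.sqrt_sq] using this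

/-- The regularizations converge strongly to the identity. -/
lemma tendsto_reg (hP : 0 < P) (f : Hilb P) : Tendsto (fun n => reg hP n f) atTop (𝓝 f) := by
  have := isLocallyFiniteMeasure_shellMeasure hP
  rw [Metric.tendsto_atTop]
  intro ε hε
  obtain ⟨g, hgc, hfg, hg, hm⟩ := (Lp.memLp f).exists_hasCompactSupport_eLpNorm_sub_le
    (by norm_num) (ε := ENNReal.ofReal (ε / 3)) (by simpa using hε)
  set γ : Hilb P := hm.toLp g with hγ
  have hd : ‖f - γ‖ ≤ ε / 3 := by
    have e : f - γ = ((Lp.memLp f).sub hm).toLp _ := by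
      rw [MemLp.toLp_sub (Lp.memLp f) hm, Lp.toLp_coeFn]
    rw [e, Lp.norm_toLp]
    exact ENNReal.toReal_le_of_le_ofReal (by positivity) hfg
  obtain ⟨N, hN⟩ := Metric.tendsto_atTop.1 (tendsto_reg_of_continuous hP hg hgc hm) (ε / 3)
    (by positivity)
  refine ⟨N, fun n hn => ?_⟩
  have h1 := hN n hn
  rw [dist_eq_norm] at h1 ⊢
  have e : reg hP n f - f = reg hP n (f - γ) + (reg hP n γ - γ) - (f - γ) := by
    rw [reg_sub]; abel
  rw [e]
  have h2 := norm_sub_le (reg hP n (f - γ) + (reg hP n γ - γ)) (f - γ)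
  have h3 := norm_add_le (reg hP n (f - γ)) (reg hP n γ - γ)
  have h4 := norm_reg_le hP n (f - γ)
  linarith

end Reg

/-! ### Holomorphic functions of several variables -/

section Several

variable {ι : Type*} [Fintype ι]

lemma measurePreserving_circle_smul (a : Circle) :
    MeasurePreserving (fun v : ι → ℂ => (a : ℂ) • v) volume volume := by
  have h : MeasurePreserving (fun z : ℂ => (a : ℂ) * z) volume volume :=
    (rotation a).measurePreserving
  exact volume_preserving_pi (fun _ => h)

lemma enorm_le_circle_lintegral {f : ℂ → ℂ} (hf : DiffContOnCl ℂ f (Metric.ball 0 1)) :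
    ENNReal.ofReal (2 * Real.pi) * ‖f 0‖ₑ ≤
      ∫⁻ α in Ioc 0 (2 * Real.pi), ‖f (Circle.exp α)‖ₑ := by
  have h := DiffContOnCl.circleAverage (c := 0) (R := 1) (f := f) (by simpa using hf)
  have hpi : (0 : ℝ) ≤ 2 * Real.pi := by positivity
  rw [Real.circleAverage_def, intervalIntegral.integral_of_le hpi] at h
  have h1 : ENNReal.ofReal (2 * Real.pi) * ‖f 0‖ₑ =
      ‖∫ α in Ioc 0 (2 * Real.pi), f (circleMap 0 1 α)‖ₑ := by
    rw [← h, enorm_smul, ← mul_assoc, ← ofReal_norm, ← ENNReal.ofReal_mul hpi,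
      Real.norm_of_nonneg (by positivity), mul_inv_cancel₀ (by positivity), ENNReal.ofReal_one,
      one_mul]
  rw [h1]
  refine (enorm_integral_le_lintegral_enorm _).trans_eq (lintegral_congr fun α => ?_)
  rw [circleMap_zero, Complex.ofReal_one, one_mul, Circle.coe_exp]

/-- The sub-mean value property on polydiscs. -/
lemma enorm_mul_volume_le {g : (ι → ℂ) → ℂ} {z : ι → ℂ} {r R : ℝ} (hrR : r ≤ R)
    (hg : DifferentiableOn ℂ g (Metric.ball z R)) :
    ‖g z‖ₑ * volume (Metric.ball (0 : ι → ℂ) r) ≤ ∫⁻ w in Metric.ball z r, ‖g w‖ₑ := by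
  classical
  set G : (ι → ℂ) → ENNReal := (Metric.ball z R).piecewise (fun w => ‖g w‖ₑ) 0 with hG
  have hGm : Measurable G :=
    ContinuousOn.measurable_piecewise hg.continuousOn.enorm continuousOn_const measurableSet_ball
  have hGeq : ∀ w ∈ Metric.ball z R, G w = ‖g w‖ₑ := fun w hw => piecewise_eq_of_mem _ _ _ hw
  have hpt : ∀ v ∈ Metric.ball (0 : ι → ℂ) r, ENNReal.ofReal (2 * Real.pi) * ‖g z‖ₑ ≤
      ∫⁻ α in Ioc 0 (2 * Real.pi), G (z + ((Circle.exp α : Circle) : ℂ) • v) := by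
    intro v hv
    rw [mem_ball_zero_iff] at hv
    have hmem : ∀ w : ℂ, ‖w‖ ≤ 1 → z + w • v ∈ Metric.ball z R := by
      intro w hw
      rw [Metric.mem_ball, dist_eq_norm, add_sub_cancel_left, norm_smul]
      have := mul_le_mul_of_nonneg_right hw (norm_nonneg v)
      linarith
    have hd : DifferentiableOn ℂ (fun w : ℂ => g (z + w • v)) (Metric.closedBall 0 1) := by
      refine hg.comp (Differentiable.differentiableOn (by fun_prop)) fun w hw => hmem w ?_
      simpa using hw
    have := enorm_le_circle_lintegral (hd.diffContOnCl_ball le_rfl)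
    simp only [zero_smul, add_zero] at this
    refine this.trans_eq (lintegral_congr fun α => (hGeq _ (hmem _ ?_)).symm)
    rw [Circle.norm_coe]
  have hGm2 : Measurable fun x : (ι → ℂ) × ℝ => G (z + ((Circle.exp x.2 : Circle) : ℂ) • x.1) := by
    refine hGm.comp (Continuous.measurable ?_)
    fun_prop
  -- The polydisc is invariant under multiplication of v by a common phase, so averaging the
  -- one-variable mean value over v gives the same integral for every angle of the circle.
  have hrot : ∀ α : ℝ, ∫⁻ v in Metric.ball (0 : ι → ℂ) r,
      G (z + ((Circle.exp α : Circle) : ℂ) • v) = ∫⁻ w in Metric.ball z r, ‖g w‖ₑ := by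
    intro α
    set a := Circle.exp α
    have h1 : (fun v : ι → ℂ => (a : ℂ) • v) ⁻¹' Metric.ball 0 r = Metric.ball 0 r := by
      ext v
      rw [mem_preimage, mem_ball_zero_iff, mem_ball_zero_iff, norm_smul, Circle.norm_coe, one_mul]
    have h2 := (measurePreserving_circle_smul (ι := ι) a).setLIntegral_comp_preimage
      (measurableSet_ball (x := (0 : ι → ℂ)) (ε := r))
      (f := fun v => G (z + v)) (hGm.comp (measurable_const_add z))
    rw [h1] at h2
    rw [h2]
    have h3 : (fun v : ι → ℂ => z + v) ⁻¹' Metric.ball z r = Metric.ball 0 r := by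
      ext v; simp
    rw [← h3, (measurePreserving_add_left volume z).setLIntegral_comp_preimage measurableSet_ball hGm]
    exact setLIntegral_congr_fun measurableSet_ball fun w hw =>
      hGeq w (Metric.ball_subset_ball hrR hw)
  have hfin : ENNReal.ofReal (2 * Real.pi) ≠ ⊤ := ENNReal.ofReal_ne_top
  have hne : ENNReal.ofReal (2 * Real.pi) ≠ 0 := by
    rw [Ne, ENNReal.ofReal_eq_zero, not_le]; positivity
  have key : ENNReal.ofReal (2 * Real.pi) * (‖g z‖ₑ * volume (Metric.ball (0 : ι → ℂ) r)) ≤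
      ENNReal.ofReal (2 * Real.pi) * ∫⁻ w in Metric.ball z r, ‖g w‖ₑ := by
    calc _ = ∫⁻ v in Metric.ball (0 : ι → ℂ) r, ENNReal.ofReal (2 * Real.pi) * ‖g z‖ₑ := by
          rw [setLIntegral_const, mul_assoc]
      _ ≤ ∫⁻ v in Metric.ball (0 : ι → ℂ) r, ∫⁻ α in Ioc 0 (2 * Real.pi),
          G (z + ((Circle.exp α : Circle) : ℂ) • v) := setLIntegral_mono' measurableSet_ball hpt
      _ = ∫⁻ α in Ioc 0 (2 * Real.pi), ∫⁻ v in Metric.ball (0 : ι → ℂ) r,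
          G (z + ((Circle.exp α : Circle) : ℂ) • v) :=
          lintegral_lintegral_swap hGm2.aemeasurable
      _ = _ := by
          simp only [hrot]
          rw [setLIntegral_const, Real.volume_Ioc, sub_zero, mul_comm]
  exact (ENNReal.mul_le_mul_iff_right hne hfin).1 key

/-- A locally uniform Cauchy sequence of holomorphic functions has a holomorphic limit. -/
lemma differentiableAt_of_uniformCauchy {E : Type*} [NormedAddCommGroup E] [NormedSpace ℂ E]
    {h : ℕ → E → ℂ} {g : E → ℂ} {z : E} {R : ℝ} (hR : 0 < R)
    (hd : ∀ n, DifferentiableOn ℂ (h n) (Metric.ball z R))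
    (hC : UniformCauchySeqOn h atTop (Metric.ball z R))
    (hg : ∀ w ∈ Metric.ball z R, Tendsto (fun n => h n w) atTop (𝓝 (g w))) :
    DifferentiableOn ℂ g (Metric.ball z (R / 2)) := by
  have hR2 : 0 < R / 2 := by linarith
  have hda : ∀ n, ∀ w ∈ Metric.ball z R, DifferentiableAt ℂ (h n) w := fun n w hw =>
    (hd n).differentiableAt (Metric.isOpen_ball.mem_nhds hw)
  have hsub : ∀ w ∈ Metric.ball z (R / 2), Metric.ball w (R / 2) ⊆ Metric.ball z R := by
    intro w hw
    refine Metric.ball_subset_ball' ?_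
    have := Metric.mem_ball.1 hw
    linarith
  have hsub0 : Metric.ball z (R / 2) ⊆ Metric.ball z R := Metric.ball_subset_ball (by linarith)
  -- The Cauchy estimate on balls of radius R/2 carries the uniform Cauchy property over to the
  -- derivatives.
  have hC' : UniformCauchySeqOn (fun n w => fderiv ℂ (h n) w) atTop (Metric.ball z (R / 2)) := by
    rw [Metric.uniformCauchySeqOn_iff] at hC ⊢
    intro ε hε
    obtain ⟨N, hN⟩ := hC (ε * (R / 2) / 4) (by positivity)
    refine ⟨N, fun m hm n hn w hw => ?_⟩
    have hbd : ∀ y ∈ Metric.ball z R, ‖h m y - h n y‖ ≤ ε * (R / 2) / 4 := fun y hy => by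
      rw [← dist_eq_norm]; exact (hN m hm n hn y hy).le
    rw [dist_eq_norm, ← fderiv_sub (hda m w (hsub0 hw)) (hda n w (hsub0 hw))]
    have h1 := Complex.norm_fderiv_le_div_of_mapsTo_ball (f := h m - h n) (c := w) (R₁ := R / 2)
      (R₂ := 2 * (ε * (R / 2) / 4)) (((hd m).sub (hd n)).mono (hsub w hw)) (fun y hy => by
        rw [Metric.mem_closedBall, dist_eq_norm]
        refine (norm_sub_le _ _).trans ?_
        have h2 := hbd y (hsub w hw hy)
        have h3 := hbd w (hsub0 hw)
        simp only [Pi.sub_apply]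
        linarith) hR2
    refine h1.trans_lt ?_
    rw [div_lt_iff₀ hR2]
    nlinarith [mul_pos hε hR2]
  have hlim : ∀ w ∈ Metric.ball z (R / 2), ∃ D, Tendsto (fun n => fderiv ℂ (h n) w) atTop (𝓝 D) :=
    fun w hw => cauchySeq_tendsto_of_complete (hC'.cauchySeq hw)
  choose! D hD using hlim
  have hU : TendstoUniformlyOn (fun n w => fderiv ℂ (h n) w) D atTop (Metric.ball z (R / 2)) :=
    hC'.tendstoUniformlyOn_of_tendsto hD
  intro w hw
  exact (hasFDerivAt_of_tendstoUniformlyOn Metric.isOpen_ball hU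
    (fun n x hx => (hda n x (hsub0 hx)).hasFDerivAt) (fun x hx => hg x (hsub0 hx))
    hw).differentiableAt.differentiableWithinAt

/-- A sequence of holomorphic functions that is Cauchy in `L²` of a polydisc converges to a
holomorphic function on a smaller polydisc. -/
lemma exists_holomorphic_limit {h : ℕ → (ι → ℂ) → ℂ} {z : ι → ℂ} {R : ℝ} (hR : 0 < R)
    (hd : ∀ n, DifferentiableOn ℂ (h n) (Metric.ball z R))
    (hC : Tendsto (fun x : ℕ × ℕ => ∫⁻ w in Metric.ball z R, ‖h x.1 w - h x.2 w‖ₑ ^ 2)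
      (atTop ×ˢ atTop) (𝓝 0)) :
    ∃ g : (ι → ℂ) → ℂ, DifferentiableOn ℂ g (Metric.ball z (R / 4)) ∧
      ∀ w ∈ Metric.ball z (R / 4), Tendsto (fun n => h n w) atTop (𝓝 (g w)) := by
  have hR2 : 0 < R / 2 := by linarith
  set v := volume (Metric.ball (0 : ι → ℂ) (R / 2)) with hv
  have hv0 : v ≠ 0 := (Metric.measure_ball_pos volume _ hR2).ne'
  have hvt : v ≠ ⊤ := measure_ball_lt_top.ne
  have hpt : ∀ m n, ∀ w ∈ Metric.ball z (R / 2), ‖h m w - h n w‖ₑ ^ 2 ≤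
      v⁻¹ * ∫⁻ w in Metric.ball z R, ‖h m w - h n w‖ₑ ^ 2 := by
    intro m n w hw
    have hsub : Metric.ball w (R / 2) ⊆ Metric.ball z R := by
      refine Metric.ball_subset_ball' ?_
      have := Metric.mem_ball.1 hw
      linarith
    -- The sub-mean value property is applied to the holomorphic function (h_m - h_n)², which gives
    -- the L² bound directly.
    have h1 := enorm_mul_volume_le (g := fun w => (h m w - h n w) ^ 2) (z := w) le_rfl
      ((((hd m).sub (hd n)).pow 2).mono hsub)
    simp only [enorm_pow] at h1
    rw [mul_comm, ← div_eq_mul_inv, ENNReal.le_div_iff_mul_le (Or.inl hv0) (Or.inl hvt)]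
    exact h1.trans (lintegral_mono_set hsub)
  have hUC : UniformCauchySeqOn h atTop (Metric.ball z (R / 2)) := by
    rw [Metric.uniformCauchySeqOn_iff]
    intro ε hε
    have hC2 : Tendsto (fun x : ℕ × ℕ => v⁻¹ * ∫⁻ w in Metric.ball z R, ‖h x.1 w - h x.2 w‖ₑ ^ 2)
        (atTop ×ˢ atTop) (𝓝 0) := by
      simpa using ENNReal.Tendsto.const_mul hC (Or.inr (ENNReal.inv_ne_top.2 hv0))
    have hev := hC2.eventually (gt_mem_nhds (show (0 : ENNReal) < ENNReal.ofReal ε ^ 2 by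
      have := ENNReal.ofReal_pos.2 hε
      positivity))
    rw [prod_atTop_atTop_eq, eventually_atTop] at hev
    obtain ⟨⟨N₁, N₂⟩, hN⟩ := hev
    refine ⟨max N₁ N₂, fun m hm n hn w hw => ?_⟩
    have h2 := (hpt m n w hw).trans_lt (hN (m, n) ⟨(le_max_left _ _).trans hm,
      (le_max_right _ _).trans hn⟩)
    have h3 : ‖h m w - h n w‖ₑ < ENNReal.ofReal ε := lt_of_pow_lt_pow_left' 2 h2
    rw [dist_eq_norm]
    rw [← ofReal_norm] at h3
    exact (ENNReal.ofReal_lt_ofReal_iff hε).1 h3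
  have hlim : ∀ w ∈ Metric.ball z (R / 2), ∃ y, Tendsto (fun n => h n w) atTop (𝓝 y) :=
    fun w hw => cauchySeq_tendsto_of_complete (hUC.cauchySeq hw)
  choose! g hg using hlim
  have hd' : ∀ n, DifferentiableOn ℂ (h n) (Metric.ball z (R / 2)) := fun n =>
    (hd n).mono (Metric.ball_subset_ball (by linarith))
  have h4 := differentiableAt_of_uniformCauchy hR2 hd' hUC hg
  rw [div_div] at h4
  norm_num at h4
  exact ⟨g, h4, fun w hw => hg w (Metric.ball_subset_ball (by linarith) hw)⟩

/-- Fubini with the imaginary parts outermost: the inner integrals then run over real momenta, where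
the L² norm of a single vector controls them. -/
lemma lintegral_complex_pi (G : (ι → ℂ) → ENNReal) (hG : Measurable G) :
    ∫⁻ z, G z = ∫⁻ s : ι → ℝ, ∫⁻ k : ι → ℝ, G fun j => (k j : ℂ) + (s j : ℂ) * Complex.I := by
  have h1 : MeasurePreserving (fun z : ι → ℂ => fun j => Complex.measurableEquivRealProd (z j))
      volume volume := volume_preserving_pi fun _ => Complex.volume_preserving_equiv_real_prod
  have h2 := (volume_measurePreserving_arrowProdEquivProdArrow ℝ ℝ ι).comp h1
  set T : (ι → ℝ) × (ι → ℝ) → (ι → ℂ) := fun x j => (x.1 j : ℂ) + (x.2 j : ℂ) * Complex.I with hT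
  have hTm : Measurable T := by
    refine measurable_pi_lambda _ fun j => ?_
    fun_prop
  have hcomp : ∀ z, G z = (G ∘ T) (((MeasurableEquiv.arrowProdEquivProdArrow ℝ ℝ ι) ∘
      fun z : ι → ℂ => fun j => Complex.measurableEquivRealProd (z j)) z) := by
    intro z
    have : T (((MeasurableEquiv.arrowProdEquivProdArrow ℝ ℝ ι) ∘
      fun z : ι → ℂ => fun j => Complex.measurableEquivRealProd (z j)) z) = z := by
      ext j
      exact Complex.re_add_im (z j)
    rw [Function.comp_apply, this]
  have h3 : ∫⁻ z, G z = ∫⁻ x : (ι → ℝ) × (ι → ℝ), (G ∘ T) x := by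
    rw [← h2.lintegral_comp (hG.comp hTm)]
    exact lintegral_congr hcomp
  rw [h3, Measure.volume_eq_prod, lintegral_prod_symm' _ (hG.comp hTm)]
  rfl

end Several

/-! ### Integration in a chart -/

/-- A map with continuous injective derivative transports integrals near a point. -/
lemma exists_chart {E : Type*} [NormedAddCommGroup E] [NormedSpace ℝ E] [FiniteDimensional ℝ E]
    [MeasurableSpace E] [BorelSpace E] (μ : Measure E) [μ.IsAddHaarMeasure] {c : E → E} {x : E}
    (hc : ContDiffAt ℝ 1 c x) (hinj : ∀ v, fderiv ℝ c x v = 0 → v = 0) {N : Set E} (hN : N ∈ 𝓝 x) :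
    ∃ B ⊆ N, IsOpen B ∧ x ∈ B ∧ ContinuousOn c B ∧ ∃ R > 0, Metric.ball (c x) R ⊆ c '' B ∧
      ∃ D : ENNReal, D ≠ ⊤ ∧ ∀ G : E → ENNReal,
        ∫⁻ y in Metric.ball (c x) R, G y ∂μ ≤ D * ∫⁻ y in B, G (c y) ∂μ := by
  have : CompleteSpace E := FiniteDimensional.complete ℝ E
  let L : E ≃L[ℝ] E := (LinearEquiv.ofInjectiveEndo (fderiv ℝ c x).toLinearMap
    ((injective_iff_map_eq_zero _).2 hinj)).toContinuousLinearEquiv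
  have hL : (L : E →L[ℝ] E) = fderiv ℝ c x := by
    ext v; rfl
  have hd : HasFDerivAt c (L : E →L[ℝ] E) x := by
    rw [hL]; exact (hc.differentiableAt one_ne_zero).hasFDerivAt
  let e := hc.toOpenPartialHomeomorph c hd one_ne_zero
  have hec : ⇑e = c := hc.toOpenPartialHomeomorph_coe hd one_ne_zero
  have hxe : x ∈ e.source := hc.mem_toOpenPartialHomeomorph_source hd one_ne_zero
  have h1 : ∀ᶠ y in 𝓝 x, ContDiffAt ℝ 1 c y := hc.eventually (by simp)
  have h2 : ContinuousAt (fun y => |(fderiv ℝ c y).det|) x :=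
    (ContinuousLinearMap.continuous_det.continuousAt.comp
      (hc.continuousAt_fderiv one_ne_zero)).abs
  have h3 : ∀ᶠ y in 𝓝 x, |(fderiv ℝ c y).det| < |(fderiv ℝ c x).det| + 1 :=
    h2.eventually_lt_const (lt_add_one _)
  obtain ⟨B, hBs, hBo, hxB⟩ := mem_nhds_iff.1
    (Filter.inter_mem (Filter.inter_mem hN (e.open_source.mem_nhds hxe)) (h1.and h3))
  have hBe : B ⊆ e.source := fun y hy => (hBs hy).1.2
  have himg : IsOpen (c '' B) := by
    rw [← hec]; exact e.isOpen_image_of_subset_source hBo hBe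
  have hinjB : InjOn c B := by
    rw [← hec]; exact e.injOn.mono hBe
  obtain ⟨R, hR, hball⟩ := Metric.isOpen_iff.1 himg (c x) (mem_image_of_mem c hxB)
  refine ⟨B, fun y hy => (hBs hy).1.1, hBo, hxB,
    fun y hy => (hBs hy).2.1.continuousAt.continuousWithinAt, R, hR, hball,
    ENNReal.ofReal (|(fderiv ℝ c x).det| + 1), ENNReal.ofReal_ne_top, fun G => ?_⟩
  calc ∫⁻ y in Metric.ball (c x) R, G y ∂μ ≤ ∫⁻ y in c '' B, G y ∂μ := lintegral_mono_set hball
    _ = ∫⁻ y in B, ENNReal.ofReal |(fderiv ℝ c y).det| * G (c y) ∂μ :=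
      lintegral_image_eq_lintegral_abs_det_fderiv_mul μ hBo.measurableSet
        (fun y hy => ((hBs hy).2.1.differentiableAt one_ne_zero).hasFDerivAt.hasFDerivWithinAt)
        hinjB G
    _ ≤ ∫⁻ y in B, ENNReal.ofReal (|(fderiv ℝ c x).det| + 1) * G (c y) ∂μ := by
      refine setLIntegral_mono' hBo.measurableSet fun y hy => ?_
      gcongr
      exact (hBs hy).2.2.le
    _ = _ := lintegral_const_mul' _ _ ENNReal.ofReal_ne_top

/-- Real parts of the coordinates. -/
def reT (x : Fin 3 → ℂ) : Fin 3 → ℝ := fun j => (x j).re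

/-- Imaginary parts of the coordinates. -/
def imT (x : Fin 3 → ℂ) : Fin 3 → ℝ := fun j => (x j).im

lemma continuous_reT : Continuous reT := by unfold reT; fun_prop

lemma continuous_imT : Continuous imT := by unfold imT; fun_prop

lemma reT_add (k s : Fin 3 → ℝ) : reT (fun j => (k j : ℂ) + (s j : ℂ) * Complex.I) = k := by
  ext j; simp [reT]

lemma imT_add (k s : Fin 3 → ℝ) : imT (fun j => (k j : ℂ) + (s j : ℂ) * Complex.I) = s := by
  ext j; simp [imT]

/-- The square integral over a bounded set of momenta is controlled by the invariant norm. -/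
lemma lintegral_shellPoint_le {P : ℝ} (hP : 0 < P) {A : Matrix (Fin 4) (Fin 4) ℝ} (hA : Ortho A)
    {S : Set (Fin 3 → ℝ)} (hS : MeasurableSet S) {e : ℝ} (he : ∀ k ∈ S, energy P k ≤ e)
    (f : Hilb P) {g : Mink → ℂ} (hg : f =ᵐ[shellMeasure P] g) (hgc : ContinuousOn g (massShell P)) :
    ∫⁻ k in S, ‖g (A.mulVec (shellPoint P k))‖ₑ ^ 2 ≤ ENNReal.ofReal e * ‖f‖ₑ ^ 2 := by
  classical
  have hms := measurableSet_massShell P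
  set G : Mink → ENNReal := (massShell P).piecewise (fun p => ‖g p‖ₑ) 0 with hG
  have hGm : Measurable G :=
    ContinuousOn.measurable_piecewise hgc.enorm continuousOn_const hms
  have hGeq : ∀ p ∈ massShell P, G p = ‖g p‖ₑ := fun p hp => piecewise_eq_of_mem _ _ _ hp
  have h1 : ‖f‖ₑ ^ 2 = ∫⁻ p, G p ^ 2 ∂(shellMeasure P) := by
    rw [Lp.enorm_def, eLpNorm_two_eq, ← ENNReal.rpow_natCast, ← ENNReal.rpow_mul]
    norm_num
    refine lintegral_congr_ae ?_
    filter_upwards [hg, ae_mem_massShell hP] with p h1 h2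
    rw [hGeq p h2, h1]
  have h2 : ∫⁻ p, G p ^ 2 ∂(shellMeasure P) = ∫⁻ p, G (A.mulVec p) ^ 2 ∂(shellMeasure P) :=
    ((measurePreserving_mulVec hP hA).lintegral_comp (hGm.pow_const 2)).symm
  have hAm : Measurable fun p : Mink => A.mulVec p :=
    (measurePreserving_mulVec hP hA).measurable
  rw [h1, h2, lintegral_shellMeasure P (f := fun p => G (A.mulVec p) ^ 2) ((hGm.comp hAm).pow_const 2), ← lintegral_const_mul' _ _
    ENNReal.ofReal_ne_top]
  calc _ ≤ ∫⁻ k in S, ENNReal.ofReal e * (ENNReal.ofReal (1 / energy P k) *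
        G (A.mulVec (shellPoint P k)) ^ 2) := by
        refine setLIntegral_mono' hS fun k hk => ?_
        have hpos := energy_pos hP k
        have hm := hA.massShell hP (shellPoint_mem hP k)
        rw [← mul_assoc, hGeq _ hm, ← ENNReal.ofReal_mul (hpos.le.trans (he k hk))]
        refine le_mul_of_one_le_left (zero_le) ?_
        rw [ENNReal.one_le_ofReal, mul_one_div, le_div_iff₀ hpos, one_mul]
        exact he k hk
    _ ≤ _ := setLIntegral_le_lintegral _ _

/-- Square mean convergence near a point of functions that are regularizations in a chart. -/
lemma exists_tendsto_lintegral_ball {P : ℝ} (hP : 0 < P) {c : (Fin 3 → ℂ) → Fin 3 → ℂ}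
    {x : Fin 3 → ℂ} (hc : ContDiffAt ℝ 1 c x) (hinj : ∀ v, fderiv ℝ c x v = 0 → v = 0)
    {h : ℕ → (Fin 3 → ℂ) → ℂ} {f : (Fin 3 → ℝ) → Hilb P}
    {A : (Fin 3 → ℝ) → Matrix (Fin 4) (Fin 4) ℝ} (hA : ∀ s, Ortho (A s))
    {C : NNReal} (hC : ∀ᶠ y in 𝓝 x, ‖f (imT y)‖ₑ ≤ C)
    (hh : ∀ᶠ y in 𝓝 x, ∀ n, ContinuousAt (h n) (c y))
    (heq : ∀ᶠ y in 𝓝 x, ∀ n,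
      h n (c y) = regFn P n (f (imT y)) ((A (imT y)).mulVec (shellPoint P (reT y)))) 
    {N : Set (Fin 3 → ℂ)} (hN : N ∈ 𝓝 x) :
    ∃ R > 0, Metric.ball (c x) R ⊆ c '' N ∧
      Tendsto (fun i : ℕ × ℕ => ∫⁻ w in Metric.ball (c x) R, ‖h i.1 w - h i.2 w‖ₑ ^ 2)
        (atTop ×ˢ atTop) (𝓝 0) := by
  classical
  obtain ⟨B, hBs, hBo, hxB, hcB, R, hR, hball, D, hD, hint⟩ := exists_chart volume hc hinj
    (Filter.inter_mem (Filter.inter_mem hN (Metric.ball_mem_nhds x one_pos))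
      (hC.and (hh.and heq)))
  refine ⟨R, hR, hball.trans (image_mono fun y hy => (hBs hy).1.1), ?_⟩
  have hre : ∀ y ∈ B, reT y ∈ Metric.closedBall (reT x) 1 := by
    intro y hy
    rw [Metric.mem_closedBall, dist_pi_le_iff zero_le_one]
    intro j
    have h1 := (dist_pi_le_iff zero_le_one).1 (Metric.mem_ball.1 (hBs hy).1.2).le j
    rw [Real.dist_eq, show reT y j - reT x j = (y j - x j).re from rfl]
    exact (Complex.abs_re_le_norm _).trans (by rwa [← dist_eq_norm])
  have him : ∀ y ∈ B, imT y ∈ Metric.closedBall (imT x) 1 := by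
    intro y hy
    rw [Metric.mem_closedBall, dist_pi_le_iff zero_le_one]
    intro j
    have h1 := (dist_pi_le_iff zero_le_one).1 (Metric.mem_ball.1 (hBs hy).1.2).le j
    rw [Real.dist_eq, show imT y j - imT x j = (y j - x j).im from rfl]
    exact (Complex.abs_im_le_norm _).trans (by rwa [← dist_eq_norm])
  obtain ⟨e, he⟩ := (isCompact_closedBall (reT x) 1).exists_bound_of_continuousOn
    (continuous_energy P).continuousOn
  have he' : ∀ k ∈ Metric.closedBall (reT x) 1, energy P k ≤ e := fun k hk =>
    (le_abs_self _).trans (he k hk)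
  set G : ℕ × ℕ → (Fin 3 → ℂ) → ENNReal := fun i =>
    B.piecewise (fun y => ‖h i.1 (c y) - h i.2 (c y)‖ₑ ^ 2) 0 with hG
  have hGm : ∀ i, Measurable (G i) := by
    intro i
    have h1 : ∀ n, ContinuousOn (fun y => h n (c y)) B := fun n y hy =>
      ((hBs hy).2.2.1 n).comp_continuousWithinAt (hcB y hy)
    refine ContinuousOn.measurable_piecewise ?_ continuousOn_const hBo.measurableSet
    exact (ENNReal.continuous_pow 2).comp_continuousOn ((h1 i.1).sub (h1 i.2)).enorm
  -- For fixed imaginary part s the slice involves only the one vector f(s). Its integral is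
  -- controlled by the squared norm of reg_m f(s) - reg_n f(s), which tends to zero.
  set J : ℕ × ℕ → (Fin 3 → ℝ) → ENNReal := fun i s =>
    ∫⁻ k : Fin 3 → ℝ, G i (fun j => k j + s j * Complex.I) with hJ
  have hJm : ∀ i, Measurable (J i) := by
    intro i
    have : Measurable fun q : (Fin 3 → ℝ) × (Fin 3 → ℝ) =>
        G i (fun j => (q.2 j : ℂ) + (q.1 j : ℂ) * Complex.I) := by
      refine (hGm i).comp (Continuous.measurable ?_)
      fun_prop
    exact this.lintegral_prod_right'
  have hJle : ∀ i s, J i s ≤ ENNReal.ofReal e *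
      ‖reg hP i.1 (f s) - reg hP i.2 (f s)‖ₑ ^ 2 := by
    intro i s
    have hc1 : ContinuousOn (fun p => regFn P i.1 (f s) p - regFn P i.2 (f s) p) (massShell P) :=
      (continuousOn_regFn hP _ _).sub (continuousOn_regFn hP _ _)
    have h1 := lintegral_shellPoint_le hP (hA s) Metric.isClosed_closedBall.measurableSet he'
      (reg hP i.1 (f s) - reg hP i.2 (f s)) (g := fun p => regFn P i.1 (f s) p - regFn P i.2 (f s) p)
      (by
        filter_upwards [coeFn_reg hP i.1 (f s), coeFn_reg hP i.2 (f s),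
          Lp.coeFn_sub (reg hP i.1 (f s)) (reg hP i.2 (f s))] with p h1 h2 h3
        rw [h3, Pi.sub_apply, h1, h2]) hc1
    refine le_trans ?_ h1
    rw [← lintegral_indicator Metric.isClosed_closedBall.measurableSet]
    refine lintegral_mono fun k => ?_
    by_cases hk : (fun j => (k j : ℂ) + (s j : ℂ) * Complex.I) ∈ B
    · have h2 := hre _ hk
      have h3 := (hBs hk).2.2.2
      rw [reT_add] at h2
      rw [reT_add, imT_add] at h3
      rw [indicator_of_mem h2, hG]
      simp only
      rw [piecewise_eq_of_mem _ _ _ hk, h3, h3]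
    · rw [hG]
      simp only
      rw [piecewise_eq_of_notMem _ _ _ hk]
      exact zero_le
  -- Regularization is a contraction, so the uniform bound C on f(s) dominates all slices. Dominated
  -- convergence then requires no uniformity in s, and no regularity of s ↦ f(s).
  have hJC : ∀ i s, J i s ≤ (Metric.closedBall (imT x) 1).indicator
      (fun _ => ENNReal.ofReal e * (2 * C) ^ 2) s := by
    intro i s
    by_cases hs : ∃ y ∈ B, imT y = s
    · obtain ⟨y, hy, rfl⟩ := hs
      rw [indicator_of_mem (him y hy)]
      refine (hJle i _).trans ?_
      gcongr
      have h2 : ∀ n, ‖reg hP n (f (imT y))‖ₑ ≤ C := fun n => by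
        refine le_trans ?_ (hBs hy).2.1
        rw [← ofReal_norm, ← ofReal_norm]
        exact ENNReal.ofReal_le_ofReal (norm_reg_le hP n _)
      refine (enorm_sub_le).trans ?_
      rw [two_mul]
      exact add_le_add (h2 _) (h2 _)
    · have : J i s = 0 := by
        rw [hJ]
        simp only
        rw [lintegral_eq_zero_of_ae_eq_zero]
        refine Eventually.of_forall fun k => ?_
        have hk : (fun j => (k j : ℂ) + (s j : ℂ) * Complex.I) ∉ B := fun hk =>
          hs ⟨_, hk, imT_add _ _⟩
        rw [hG]
        simp only
        rw [piecewise_eq_of_notMem _ _ _ hk]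
        rfl
      rw [this]
      exact zero_le
  have hJlim : Tendsto (fun i => ∫⁻ s, J i s) (atTop ×ˢ atTop) (𝓝 0) := by
    have h0 : (0 : ENNReal) = ∫⁻ s : Fin 3 → ℝ, 0 := by simp
    rw [h0]
    refine tendsto_lintegral_filter_of_dominated_convergence _ (Eventually.of_forall hJm)
      (Eventually.of_forall fun i => Eventually.of_forall (hJC i)) ?_
      (Eventually.of_forall fun s => ?_)
    · rw [lintegral_indicator Metric.isClosed_closedBall.measurableSet, setLIntegral_const]
      refine ENNReal.mul_ne_top (ENNReal.mul_ne_top ENNReal.ofReal_ne_top ?_)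
        measure_closedBall_lt_top.ne
      finiteness
    · refine tendsto_of_tendsto_of_tendsto_of_le_of_le tendsto_const_nhds ?_
        (fun _ => zero_le) (fun i => hJle i s)
      have h1 : Tendsto (fun i : ℕ × ℕ => reg hP i.1 (f s) - reg hP i.2 (f s)) (atTop ×ˢ atTop)
          (𝓝 0) := by
        have := ((tendsto_reg hP (f s)).comp (tendsto_fst (f := (atTop : Filter ℕ))
          (g := (atTop : Filter ℕ)))).sub ((tendsto_reg hP (f s)).comp tendsto_snd)
        rwa [sub_self] at this
      have h2 := (ENNReal.continuous_pow 2).tendsto _ |>.comp h1.enorm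
      have h3 := ENNReal.Tendsto.const_mul (a := ENNReal.ofReal e) h2
        (Or.inr ENNReal.ofReal_ne_top)
      simpa using h3
  have hfin : Tendsto (fun i => D * ∫⁻ s, J i s) (atTop ×ˢ atTop) (𝓝 0) := by
    have := ENNReal.Tendsto.const_mul (a := D) hJlim (Or.inr hD)
    rwa [mul_zero] at this
  refine tendsto_of_tendsto_of_tendsto_of_le_of_le tendsto_const_nhds hfin
    (fun _ => zero_le) (fun i => ?_)
  refine (hint _).trans ?_
  gcongr
  rw [← lintegral_complex_pi (G i) (hGm i), ← lintegral_indicator hBo.measurableSet]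
  refine lintegral_mono fun y => ?_
  by_cases hy : y ∈ B
  · rw [indicator_of_mem hy, hG]
    simp only
    rw [piecewise_eq_of_mem _ _ _ hy]
  · rw [indicator_of_notMem hy]
    exact zero_le

/-! ### A chart of the complex mass shell by turned wedges -/

/-- The rotation by `s` in the plane of `x²` and `x³`. -/
def rotA (s : ℝ) : Matrix (Fin 4) (Fin 4) ℝ :=
  !![1, 0, 0, 0; 0, 1, 0, 0; 0, 0, Real.cos s, -Real.sin s; 0, 0, Real.sin s, Real.cos s]

/-- The rotation by `s` in the plane of `x¹` and `x³`. -/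
def rotB (s : ℝ) : Matrix (Fin 4) (Fin 4) ℝ :=
  !![1, 0, 0, 0; 0, Real.cos s, 0, -Real.sin s; 0, 0, 1, 0; 0, Real.sin s, 0, Real.cos s]

lemma rotA_zero : rotA 0 = 1 := by
  ext i j; fin_cases i <;> fin_cases j <;> simp [rotA]

lemma rotB_zero : rotB 0 = 1 := by
  ext i j; fin_cases i <;> fin_cases j <;> simp [rotB]

lemma continuous_rotA : Continuous rotA := by
  unfold rotA
  refine continuous_matrix fun i j => ?_
  fin_cases i <;> fin_cases j <;> simp <;> fun_prop

lemma continuous_rotB : Continuous rotB := by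
  unfold rotB
  refine continuous_matrix fun i j => ?_
  fin_cases i <;> fin_cases j <;> simp <;> fun_prop

lemma presForm_rotA (s : ℝ) : PresForm (rotA s) := by
  intro x y
  have := Real.sin_sq_add_cos_sq s
  simp [rotA, form, Matrix.mulVec, dotProduct, Fin.sum_univ_four]
  linear_combination (-x 2 * y 2 - x 3 * y 3) * this

lemma presForm_rotB (s : ℝ) : PresForm (rotB s) := by
  intro x y
  have := Real.sin_sq_add_cos_sq s
  simp [rotB, form, Matrix.mulVec, dotProduct, Fin.sum_univ_four]
  linear_combination (-x 1 * y 1 - x 3 * y 3) * this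

lemma det_rotA (s : ℝ) : (rotA s).det = 1 := by
  have := Real.sin_sq_add_cos_sq s
  simp [rotA, Matrix.det_succ_row_zero, Fin.sum_univ_succ, Fin.succAbove]
  linear_combination this

lemma det_rotB (s : ℝ) : (rotB s).det = 1 := by
  have := Real.sin_sq_add_cos_sq s
  simp [rotB, Matrix.det_succ_row_zero, Fin.sum_univ_succ, Fin.succAbove]
  linear_combination this

/-- The frame `I` turned by two small angles. -/
def turn (I : Lorentz) (s : Fin 3 → ℝ) : Lorentz :=
  ⟨I.1 * (rotA (s 0) * rotB (s 1)), by
    refine ⟨?_, ?_, ?_⟩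
    · exact presForm_iff.1 (I.ortho.pres.mul ((presForm_rotA _).mul (presForm_rotB _)))
    · rw [Matrix.det_mul, Matrix.det_mul, det_rotA, det_rotB, I.2.2.1]; norm_num
    · have : (I.1 * (rotA (s 0) * rotB (s 1))) 0 0 = I.1 0 0 := by
        simp [Matrix.mul_apply, Fin.sum_univ_four, rotA, rotB]
      rw [this]; exact I.2.2.2⟩

lemma turn_zero (I : Lorentz) : turn I 0 = I := by
  apply Subtype.ext
  simp [turn, rotA_zero, rotB_zero]

lemma continuous_turn (I : Lorentz) : Continuous (turn I) := by
  refine Continuous.subtype_mk ?_ _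
  exact continuous_const.matrix_mul ((continuous_rotA.comp (continuous_apply 0)).matrix_mul
    (continuous_rotB.comp (continuous_apply 1)))

/-- The boosted orbit point of a turned wedge, in the frame of the wedge that is not turned. -/
def chartVec (P : ℝ) (σ : ℤˣ) (θ : ℝ) (x : Fin 3 → ℂ) : MinkC :=
  (boostC (((σ : ℤ) : ℂ) * imPt θ)).mulVec
    (((rotA (imT x 0) * rotB (imT x 1)).map Complex.ofReal).mulVec
      ((boostC (-(((σ : ℤ) : ℂ) * imPt (θ + imT x 2)))).mulVec (toC (shellPoint P (reT x)))))

lemma map_chartVec (P : ℝ) (σ : ℤˣ) (θ : ℝ) (I : Lorentz) (x : Fin 3 → ℂ) :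
    (I.1.map Complex.ofReal).mulVec (chartVec P σ θ x) =
      (wedgeBoostC I (((σ : ℤ) : ℂ) * imPt θ)).mulVec
        (orbit (turn I (imT x)) (((σ : ℤ) : ℂ) * imPt (θ + imT x 2))
          ((turn I (imT x)).1.mulVec (shellPoint P (reT x)))) := by
  have h1 : ∀ (J : Lorentz) (τ : ℂ) (q : Mink), orbit J τ (J.1.mulVec q) =
      (J.1.map Complex.ofReal).mulVec ((boostC (-τ)).mulVec (toC q)) := by
    intro J τ q
    rw [orbit_eq, frame_boost, ← toC_mulVec, Matrix.mulVec_mulVec q, J.inv_mul, Matrix.one_mulVec]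
  rw [h1, frame_boost, Matrix.mulVec_mulVec _ (I.1⁻¹.map Complex.ofReal), map_mul_map, chartVec]
  congr 3
  rw [turn, ← Matrix.mul_assoc, I.inv_mul, Matrix.one_mul]

/-- Real part of the spatial chart. -/
def chartRe (r θ : ℝ) (k s : Fin 3 → ℝ) : Fin 3 → ℝ :=
  ![Real.cos (s 1) * k 0 - Real.sin (s 1) * (Real.cos (θ + s 2) * k 2),
    Real.cos (s 0) * k 1 - Real.sin (s 0) * (Real.sin (s 1) * k 0 +
      Real.cos (s 1) * (Real.cos (θ + s 2) * k 2)),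
    Real.cos θ * (Real.sin (s 0) * k 1 + Real.cos (s 0) * (Real.sin (s 1) * k 0 +
      Real.cos (s 1) * (Real.cos (θ + s 2) * k 2))) +
      r * Real.sin θ * (r * Real.sin (θ + s 2) * k 2)]

/-- Imaginary part of the spatial chart. -/
def chartIm (r θ e : ℝ) (s : Fin 3 → ℝ) : Fin 3 → ℝ :=
  ![-Real.sin (s 1) * (r * Real.sin (θ + s 2)) * e,
    -Real.sin (s 0) * Real.cos (s 1) * (r * Real.sin (θ + s 2)) * e,
    (Real.cos θ * Real.cos (s 0) * Real.cos (s 1) * (r * Real.sin (θ + s 2)) -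
      r * Real.sin θ * Real.cos (θ + s 2)) * e]

/-- The spatial components of `chartVec`. -/
def chart (P : ℝ) (σ : ℤˣ) (θ : ℝ) (x : Fin 3 → ℂ) : Fin 3 → ℂ := fun j =>
  (chartRe ((σ : ℤ) : ℝ) θ (reT x) (imT x) j : ℂ) +
    (chartIm ((σ : ℤ) : ℝ) θ (energy P (reT x)) (imT x) j : ℂ) * Complex.I

lemma chartVec_succ (P : ℝ) (σ : ℤˣ) (θ : ℝ) (x : Fin 3 → ℂ) (j : Fin 3) :
    chartVec P σ θ x j.succ = chart P σ θ x j := by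
  have h0 : shellPoint P (reT x) 0 = energy P (reT x) := rfl
  have h1 : shellPoint P (reT x) 1 = reT x 0 := rfl
  have h2 : shellPoint P (reT x) 2 = reT x 1 := rfl
  have h3 : shellPoint P (reT x) 3 = reT x 2 := rfl
  rw [chartVec, boostC_neg_toC, mulVec_ofReal_add_mul_I]
  generalize hθ : θ + imT x 2 = φ
  rw [chart, h0, h1, h2, h3]
  generalize reT x = k
  fin_cases j <;>
    apply Complex.ext <;>
    simp [boostC, Matrix.mulVec, dotProduct, Fin.sum_univ_four, cosh_unit_imPt, sinh_unit_imPt,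
      chartRe, chartIm, rotA, rotB, Matrix.mul_apply, hθ, -Complex.ofReal_cos,
      -Complex.ofReal_sin, -Complex.ofReal_mul] <;> ring

lemma contDiff_energy {P : ℝ} (hP : 0 < P) : ContDiff ℝ 1 (energy P) := by
  unfold energy
  refine ContDiff.sqrt (by fun_prop) fun k => ?_
  have : 0 ≤ ∑ i, k i ^ 2 := Finset.sum_nonneg fun i _ => sq_nonneg _
  positivity

lemma contDiff_chart {P : ℝ} (hP : 0 < P) (σ : ℤˣ) (θ : ℝ) : ContDiff ℝ 1 (chart P σ θ) := by
  have hre : ∀ j, ContDiff ℝ 1 fun x : Fin 3 → ℂ => reT x j := fun j =>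
    Complex.reCLM.contDiff.comp (contDiff_apply ℝ ℂ j)
  have him : ∀ j, ContDiff ℝ 1 fun x : Fin 3 → ℂ => imT x j := fun j =>
    Complex.imCLM.contDiff.comp (contDiff_apply ℝ ℂ j)
  have he : ContDiff ℝ 1 fun x : Fin 3 → ℂ => energy P (reT x) :=
    (contDiff_energy hP).comp (contDiff_pi.2 hre)
  have h0 := him 0
  have h1 := him 1
  have h2 := him 2
  have k0 := hre 0
  have k1 := hre 1
  have k2 := hre 2
  refine contDiff_pi.2 fun j => ContDiff.add ?_ (ContDiff.mul ?_ contDiff_const)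
  · refine Complex.ofRealCLM.contDiff.comp
      (f := fun x => chartRe ((σ : ℤ) : ℝ) θ (reT x) (imT x) j) ?_
    fin_cases j <;> simp only [chartRe] <;> simp <;> fun_prop
  · refine Complex.ofRealCLM.contDiff.comp
      (f := fun x => chartIm ((σ : ℤ) : ℝ) θ (energy P (reT x)) (imT x) j) ?_
    fin_cases j <;> simp only [chartIm] <;> simp <;> fun_prop

/-- At vanishing parameters the wedge is not turned and the two boosts cancel, so the chart is the
identity on real momenta. -/
lemma chart_real (P : ℝ) (σ : ℤˣ) (θ : ℝ) {x : Fin 3 → ℂ} (hx : imT x = 0) :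
    chart P σ θ x = x := by
  have h : ∀ j, ((reT x j : ℝ) : ℂ) = x j := by
    intro j
    apply Complex.ext
    · rfl
    · exact (congrFun hx j).symm
  have hσ := unit_sq σ
  have hs := Real.sin_sq_add_cos_sq θ
  ext j
  rw [chart, hx, ← h j]
  have h1 : chartRe ((σ : ℤ) : ℝ) θ (reT x) 0 j = reT x j := by
    fin_cases j <;> simp [chartRe]
    linear_combination reT x 2 * (hs + Real.sin θ ^ 2 * hσ)
  have h2 : chartIm ((σ : ℤ) : ℝ) θ (energy P (reT x)) 0 j = 0 := by
    fin_cases j <;> simp [chartIm]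
    left; ring
  rw [h1, h2]
  simp

/-- At s = 0 the derivative of the imaginary part of the chart is E σ (-s₁ sin θ, -s₀ sin θ, s₂),
which vanishes only for s = 0 because sin θ ≠ 0. In the remaining real directions the chart is the
identity. -/
lemma fderiv_chart_injective {P : ℝ} (hP : 0 < P) (σ : ℤˣ) {θ : ℝ} (hθ : θ ∈ Ioo 0 Real.pi)
    {x : Fin 3 → ℂ} (hx : imT x = 0) (v : Fin 3 → ℂ) (hv : fderiv ℝ (chart P σ θ) x v = 0) :
    v = 0 := by
  have hline : HasDerivAt (fun t : ℝ => x + t • v) v 0 := by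
    simpa using ((hasDerivAt_id (0 : ℝ)).smul_const v).const_add x
  have hd : HasDerivAt (fun t : ℝ => chart P σ θ (x + t • v)) 0 0 := by
    have h1 : HasFDerivAt (chart P σ θ) (fderiv ℝ (chart P σ θ) x) (x + (0 : ℝ) • v) := by
      rw [zero_smul, add_zero]
      exact ((contDiff_chart hP σ θ).differentiable one_ne_zero x).hasFDerivAt
    have := h1.comp_hasDerivAt (0 : ℝ) hline
    rwa [hv] at this
  have hre : ∀ t : ℝ, reT (x + t • v) = reT x + t • reT v := fun t => by
    ext j; simp [reT]
  have him : ∀ t : ℝ, imT (x + t • v) = t • imT v := fun t => by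
    ext j
    have := congrFun hx j
    simp only [imT, Pi.zero_apply] at this
    simp [imT, this]
  obtain ⟨e', he'⟩ : ∃ e', HasDerivAt (fun t : ℝ => energy P (reT x + t • reT v)) e' 0 := by
    refine ⟨_, (DifferentiableAt.comp (g := energy P) (f := fun t : ℝ => reT x + t • reT v) (0 : ℝ)
      ((contDiff_energy hP).differentiable one_ne_zero _) ?_).hasDerivAt⟩
    fun_prop
  have he0 := energy_pos hP (reT x)
  have hIm : ∀ j, HasDerivAt (fun t : ℝ => chartIm ((σ : ℤ) : ℝ) θ
      (energy P (reT x + t • reT v)) (t • imT v) j) 0 0 := by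
    intro j
    have h1 := (hasDerivAt_pi.1 hd) j
    have h2 := (Complex.imCLM.hasFDerivAt (x := chart P σ θ (x + (0 : ℝ) • v) j)).comp_hasDerivAt
      (0 : ℝ) h1
    convert! h2 using 1
    · ext1 t
      simp [chart, hre, him]
  have hsin := (Real.sin_pos_of_mem_Ioo hθ).ne'
  have hσ := unit_sq σ
  have hσ0 : ((σ : ℤ) : ℝ) ≠ 0 := fun h => by rw [h] at hσ; norm_num at hσ
  have hlin : ∀ a : ℝ, HasDerivAt (fun t : ℝ => t * a) a 0 := fun a => by
    simpa using (hasDerivAt_id (0 : ℝ)).mul_const a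
  have hsn : ∀ a : ℝ, HasDerivAt (fun t : ℝ => Real.sin (t * a)) a 0 := fun a => by
    simpa using (hlin a).sin
  have hcs : ∀ a : ℝ, HasDerivAt (fun t : ℝ => Real.cos (t * a)) 0 0 := fun a => by
    simpa using (hlin a).cos
  have hsθ : ∀ a : ℝ, HasDerivAt (fun t : ℝ => Real.sin (θ + t * a)) (Real.cos θ * a) 0 :=
    fun a => by simpa using ((hlin a).const_add θ).sin
  have hcθ : ∀ a : ℝ, HasDerivAt (fun t : ℝ => Real.cos (θ + t * a)) (-Real.sin θ * a) 0 :=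
    fun a => by simpa using ((hlin a).const_add θ).cos
  have hb : imT v = 0 := by
    ext j
    fin_cases j
    · have h := (((hsn (imT v 0)).neg.mul (hcs (imT v 1))).mul
        ((hsθ (imT v 2)).const_mul ((σ : ℤ) : ℝ))).mul he'
      have h2 := h.unique (hIm 1)
      simp at h2
      simpa [hsin, hσ0, he0.ne'] using h2
    · have h := ((hsn (imT v 1)).neg.mul ((hsθ (imT v 2)).const_mul ((σ : ℤ) : ℝ))).mul he'
      have h2 := h.unique (hIm 0)
      simp at h2
      simpa [hsin, hσ0, he0.ne'] using h2
    · have h := (((((hcs (imT v 0)).const_mul (Real.cos θ)).mul (hcs (imT v 1))).mul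
        ((hsθ (imT v 2)).const_mul ((σ : ℤ) : ℝ))).sub
          ((hcθ (imT v 2)).const_mul (((σ : ℤ) : ℝ) * Real.sin θ))).mul he'
      have h2 := h.unique (hIm 2)
      have h3 : ((σ : ℤ) : ℝ) * imT v 2 * energy P (reT x) = 0 := by
        have hs := Real.sin_sq_add_cos_sq θ
        simp at h2
        linear_combination h2 - ((σ : ℤ) : ℝ) * imT v 2 * energy P (reT x) * hs
      simpa [hσ0, he0.ne'] using h3
  have hid : (fun t : ℝ => chart P σ θ (x + t • v)) = fun t => x + t • v := by
    ext1 t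
    exact chart_real P σ θ (by rw [him, hb, smul_zero])
  rw [hid] at hd
  exact hline.unique hd

/-! ### Local limits of the regularized continuations -/

lemma toC_smul (b : ℝ) (p : Mink) : toC (b • p) = (b : ℂ) • toC p := by
  ext j; simp [toC]

lemma orbit_smul (I : Lorentz) (τ : ℂ) (b : ℝ) (p : Mink) :
    orbit I τ (b • p) = (b : ℂ) • orbit I τ p := by
  rw [orbit_eq, orbit_eq, toC_smul, Matrix.mulVec_smul]

lemma smul_mem_tube {b : ℝ} (hb : 0 < b) {ζ : MinkC} (hζ : ζ ∈ tube) : (b : ℂ) • ζ ∈ tube := by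
  have : reV ((b : ℂ) • ζ) = b • reV ζ := by ext j; simp [reV]
  rw [tube, mem_preimage, this]
  exact smul_mem_fwd hb hζ

lemma toC_mem_tube {p : Mink} (hp : p ∈ fwd) : toC p ∈ tube := hp

lemma continuous_boost_orbit (I₀ : Lorentz) (σ : ℤˣ) :
    Continuous fun z : (Lorentz × Mink × ℝ) × ℝ => (wedgeBoostC I₀ (((σ : ℤ) : ℂ) * imPt z.2)).mulVec
      (orbit z.1.1 (((σ : ℤ) : ℂ) * imPt z.1.2.2) z.1.2.1) := by
  refine continuous_boosted I₀ σ (continuous_imPt.comp continuous_snd) ?_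
  exact continuous_orbit (by fun_prop) (continuous_const.mul (continuous_imPt.comp (by fun_prop)))
    (by fun_prop)

/-- Near a given wedge, momentum and angle, the continuations of all wedges are given by the
continuation of that wedge. -/
lemma eventually_pairing_eq {P : ℝ} {hP : 0 < P} {σ : ℤˣ} {ψ : Hilb P} {S : Set Lorentz}
    {F : Lorentz → ℂ → Hilb P} (hF : ∀ I ∈ S, WedgeOrbit hP σ I ψ (F I)) {I₀ : Lorentz}
    (hI₀ : I₀ ∈ S) {p₀ : Mink} (hp₀ : p₀ ∈ fwd) {θ₀ : ℝ} (hθ₀ : θ₀ ∈ Ioo 0 Real.pi) :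
    ∀ᶠ x : Lorentz × Mink × ℝ in 𝓝 (I₀, p₀, θ₀), x.1 ∈ S → ∀ b : ℝ, 0 < b →
      pairing P (expVec P (toC (b • x.2.1))) (F x.1 (imPt x.2.2)) =
        pairing P (expVec P ((b : ℂ) • (wedgeBoostC I₀ (((σ : ℤ) : ℂ) * imPt θ₀)).mulVec
          (orbit x.1 (((σ : ℤ) : ℂ) * imPt x.2.2) x.2.1))) (F I₀ (imPt θ₀)) := by
  have hbase : ∀ s : ℝ, (wedgeBoostC I₀ (((σ : ℤ) : ℂ) * imPt s)).mulVec
      (orbit I₀ (((σ : ℤ) : ℂ) * imPt s) p₀) ∈ tube := fun s => by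
    rw [boost_orbit]; exact hp₀
  have hdiag : Continuous fun z : (Lorentz × Mink × ℝ) × ℝ =>
      (wedgeBoostC I₀ (((σ : ℤ) : ℂ) * imPt z.2)).mulVec
        (orbit z.1.1 (((σ : ℤ) : ℂ) * imPt z.2) z.1.2.1) := by
    refine continuous_boosted I₀ σ (continuous_imPt.comp continuous_snd) ?_
    exact continuous_orbit (by fun_prop) (continuous_const.mul (continuous_imPt.comp (by fun_prop)))
      (by fun_prop)
  -- The orbit of I₀ boosted back by its own angle is p₀, inside the tube. Compactness of [0,π]
  -- keeps the whole path in the tube for nearby data, so the angle function a(s) = s can be used.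
  have h1 : ∀ᶠ x : Lorentz × Mink × ℝ in 𝓝 (I₀, p₀, θ₀), ∀ s ∈ Icc 0 Real.pi,
      (wedgeBoostC I₀ (((σ : ℤ) : ℂ) * imPt s)).mulVec
        (orbit x.1 (((σ : ℤ) : ℂ) * imPt s) x.2.1) ∈ tube := by
    refine isCompact_Icc.eventually_forall_of_forall_eventually fun s _ => ?_
    exact hdiag.continuousAt.preimage_mem_nhds (isOpen_tube.mem_nhds (hbase s))
  have h2 : ∀ᶠ z : (Lorentz × Mink × ℝ) × ℝ in 𝓝 ((I₀, p₀, θ₀), θ₀),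
      (wedgeBoostC I₀ (((σ : ℤ) : ℂ) * imPt z.2)).mulVec
        (orbit z.1.1 (((σ : ℤ) : ℂ) * imPt z.1.2.2) z.1.2.1) ∈ tube :=
    (continuous_boost_orbit I₀ σ).continuousAt.preimage_mem_nhds (isOpen_tube.mem_nhds (hbase θ₀))
  rw [nhds_prod_eq, eventually_prod_iff] at h2
  obtain ⟨pa, hpa, pb, hpb, h2⟩ := h2
  obtain ⟨ε, hε, hball⟩ := Metric.eventually_nhds_iff_ball.1 hpb
  have hθ : ∀ᶠ x : Lorentz × Mink × ℝ in 𝓝 (I₀, p₀, θ₀), x.2.2 ∈ Ioo 0 Real.pi ∩ Metric.ball θ₀ ε :=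
    (continuous_snd.comp continuous_snd).continuousAt.preimage_mem_nhds
      (inter_mem (isOpen_Ioo.mem_nhds hθ₀) (Metric.ball_mem_nhds θ₀ hε))
  have hp : ∀ᶠ x : Lorentz × Mink × ℝ in 𝓝 (I₀, p₀, θ₀), x.2.1 ∈ fwd :=
    (continuous_fst.comp continuous_snd).continuousAt.preimage_mem_nhds (isOpen_fwd.mem_nhds hp₀)
  filter_upwards [h1, hpa, hθ, hp] with x h1 h3 h4 h5 hxS b hb
  -- The tube is a cone, so scaling the momentum by b keeps the path inside it: one neighbourhood
  -- serves all b, as needed for b → ∞.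
  have key := contVal_eq_of_path (hF x.1 hxS) (hF I₀ hI₀) (p := b • x.2.1) (smul_mem_fwd hb h5)
    (a := fun s => s) h4.1 rfl (fun s _ => continuousAt_id)
    (fun s hs => ⟨hs.1, hs.2.trans_lt h4.1.2⟩) (fun s hs => by
      rw [orbit_smul, Matrix.mulVec_smul]
      exact smul_mem_tube hb (h1 s ⟨hs.1.le, hs.2.trans h4.1.2.le⟩))
  have key2 := contVal_eq_of_uIcc (hF I₀ hI₀)
    (ζ := orbit x.1 (((σ : ℤ) : ℂ) * imPt x.2.2) (b • x.2.1)) (x := x.2.2) (y := θ₀)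
    ⟨h4.1.1.le, h4.1.2⟩ ⟨hθ₀.1.le, hθ₀.2⟩ (fun θ hθ => by
      rw [orbit_smul, Matrix.mulVec_smul]
      refine smul_mem_tube hb (h2 h3 (hball θ ?_))
      exact ((convex_ball θ₀ ε).ordConnected.uIcc_subset h4.2 (Metric.mem_ball_self hε)) hθ)
  rw [key, key2, contVal, orbit_smul, Matrix.mulVec_smul]

/-- The point of the complex mass shell with given complex spatial momentum near the real one. -/
def shellPointC (P : ℝ) (k : Fin 3 → ℂ) : MinkC :=
  Matrix.vecCons (((P : ℂ) + ∑ j, k j ^ 2) ^ (2⁻¹ : ℂ)) k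

/-- Near the real mass shell Re z⁰ > 0, so z⁰ is the principal square root and the spatial
components are complex coordinates. -/
lemma shellPointC_tail {P : ℝ} {z : MinkC} (hz : form z z = (P : ℂ)) (h0 : 0 < (z 0).re) :
    shellPointC P (fun j => z j.succ) = z := by
  have h : (P : ℂ) + ∑ j : Fin 3, z j.succ ^ 2 = z 0 ^ 2 := by
    have h1 : ∑ j : Fin 3, z j.succ ^ 2 = z 1 ^ 2 + z 2 ^ 2 + z 3 ^ 2 := Fin.sum_univ_three _
    rw [h1, ← hz, form]; ring
  ext j
  refine Fin.cases ?_ (fun j => ?_) j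
  · rw [shellPointC, Matrix.cons_val_zero, h, Complex.sq_cpow_two_inv h0]
  · rw [shellPointC, Matrix.cons_val_succ]

lemma differentiableAt_shellPointC {P : ℝ} {k : Fin 3 → ℂ}
    (hk : (P : ℂ) + ∑ j, k j ^ 2 ∈ Complex.slitPlane) :
    DifferentiableAt ℂ (shellPointC P) k := by
  rw [differentiableAt_pi]
  intro j
  refine Fin.cases ?_ (fun j => ?_) j
  · simp only [shellPointC, Matrix.cons_val_zero]
    refine DifferentiableAt.cpow_const ?_ hk
    fun_prop
  · simp only [shellPointC, Matrix.cons_val_succ]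
    exact differentiableAt_apply j k

lemma chartVec_mem_massShellC {P : ℝ} (hP : 0 < P) (σ : ℤˣ) (θ : ℝ) (x : Fin 3 → ℂ) :
    form (chartVec P σ θ x) (chartVec P σ θ x) = (P : ℂ) := by
  rw [chartVec, presForm_boostC, presForm_map ((presForm_rotA _).mul (presForm_rotB _)),
    presForm_boostC, form_toC, (shellPoint_mem hP _).1]

lemma continuous_chartVec {P : ℝ} (σ : ℤˣ) (θ : ℝ) : Continuous (chartVec P σ θ) := by
  have him : ∀ j, Continuous fun x : Fin 3 → ℂ => imT x j := fun j =>
    (continuous_apply j).comp continuous_imT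
  refine continuous_const.matrix_mulVec (Continuous.matrix_mulVec ?_
    (Continuous.matrix_mulVec ?_ ?_))
  · exact continuous_map_ofReal.comp ((continuous_rotA.comp (him 0)).matrix_mul
      (continuous_rotB.comp (him 1)))
  · exact continuous_boostC.comp (continuous_const.mul (continuous_imPt.comp
      (continuous_const.add (him 2)))).neg
  · exact continuous_toC.comp ((continuous_shellPoint P).comp continuous_reT)

lemma chartVec_real {P : ℝ} (σ : ℤˣ) (θ : ℝ) (k : Fin 3 → ℝ) :
    chartVec P σ θ (fun j => (k j : ℂ)) = toC (shellPoint P k) := by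
  have h1 : imT (fun j => (k j : ℂ)) = 0 := by ext j; simp [imT]
  have h2 : reT (fun j => (k j : ℂ)) = k := by ext j; simp [reT]
  rw [chartVec, h1, h2, Pi.zero_apply, Pi.zero_apply, Pi.zero_apply, rotA_zero, rotB_zero,
    Matrix.one_mul, map_one_ofReal, Matrix.one_mulVec, add_zero, Matrix.mulVec_mulVec,
    ← boostC_add, add_neg_cancel, boostC_zero, Matrix.one_mulVec]

/-- The regularized continuation of a wedge, as a function of complex spatial momentum. -/
def chartVal (P : ℝ) (I : Lorentz) (f : Hilb P) (n : ℕ) (k : Fin 3 → ℂ) : ℂ :=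
  pairing P (expVec P ((((n : ℝ) + 1 : ℝ) : ℂ) • (I.1.map Complex.ofReal).mulVec
    (shellPointC P k))) f / (kerMass P ((n : ℝ) + 1) : ℂ)

/-- The spatial momenta at which the regularized continuations are defined. -/
def chartDomain (P : ℝ) (I : Lorentz) : Set (Fin 3 → ℂ) :=
  {k | (P : ℂ) + ∑ j, k j ^ 2 ∈ Complex.slitPlane ∧
    (I.1.map Complex.ofReal).mulVec (shellPointC P k) ∈ tube}

lemma differentiableAt_map_shellPointC {P : ℝ} (I : Lorentz) {k : Fin 3 → ℂ}
    (hk : (P : ℂ) + ∑ j, k j ^ 2 ∈ Complex.slitPlane) :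
    DifferentiableAt ℂ (fun k => (I.1.map Complex.ofReal).mulVec (shellPointC P k)) k :=
  DifferentiableAt.comp (g := fun ζ : MinkC => (I.1.map Complex.ofReal).mulVec ζ)
    (f := shellPointC P) k (differentiable_mulVecC _ _) (differentiableAt_shellPointC hk)

lemma differentiableAt_chartVal {P : ℝ} (hP : 0 < P) (I : Lorentz) (f : Hilb P) (n : ℕ)
    {k : Fin 3 → ℂ} (hk : k ∈ chartDomain P I) : DifferentiableAt ℂ (chartVal P I f n) k := by
  have hb : (0 : ℝ) < (n : ℝ) + 1 := by positivity
  unfold chartVal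
  generalize (n : ℝ) + 1 = b at hb
  have h1 : DifferentiableAt ℂ (fun k => (b : ℂ) • (I.1.map Complex.ofReal).mulVec
      (shellPointC P k)) k := DifferentiableAt.fun_const_smul (differentiableAt_map_shellPointC I hk.1) _
  have h2 := DifferentiableAt.comp (g := expVec P) (f := fun k => (b : ℂ) •
      (I.1.map Complex.ofReal).mulVec (shellPointC P k)) k
    ((differentiableOn_expVec hP).differentiableAt
      (isOpen_tube.mem_nhds (smul_mem_tube hb hk.2))) h1
  have h3 : DifferentiableAt ℂ (fun k => pairing P (expVec P ((b : ℂ) •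
      (I.1.map Complex.ofReal).mulVec (shellPointC P k))) f) k :=
    ((pairing P).flip f).differentiableAt.comp k h2
  simp only [div_eq_mul_inv]
  exact h3.mul_const _

lemma eventually_mem_chartDomain {P : ℝ} (hP : 0 < P) (I : Lorentz) (k : Fin 3 → ℝ) :
    ∀ᶠ y in 𝓝 fun j => (k j : ℂ), y ∈ chartDomain P I := by
  have hslit : (P : ℂ) + ∑ j, ((k j : ℝ) : ℂ) ^ 2 ∈ Complex.slitPlane := by
    have h1 : (P : ℂ) + ∑ j, ((k j : ℝ) : ℂ) ^ 2 = ((P + ∑ j, k j ^ 2 : ℝ) : ℂ) := by push_cast; rfl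
    rw [h1, Complex.ofReal_mem_slitPlane]
    have : 0 ≤ ∑ j, k j ^ 2 := Finset.sum_nonneg fun j _ => sq_nonneg _
    linarith
  have hm : shellPointC P (fun j => (k j : ℂ)) = toC (shellPoint P k) := by
    have := shellPointC_tail (P := P) (z := toC (shellPoint P k))
      (by rw [form_toC, (shellPoint_mem hP k).1]) (by exact (shellPoint_mem hP k).2)
    exact this
  have hcont : Continuous fun y : Fin 3 → ℂ => (P : ℂ) + ∑ j, y j ^ 2 := by fun_prop
  have h1 : ∀ᶠ y : Fin 3 → ℂ in 𝓝 fun j => (k j : ℂ), (P : ℂ) + ∑ j, y j ^ 2 ∈ Complex.slitPlane :=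
    hcont.continuousAt.preimage_mem_nhds (Complex.isOpen_slitPlane.mem_nhds hslit)
  refine h1.and ((differentiableAt_map_shellPointC I hslit).continuousAt.preimage_mem_nhds
    (isOpen_tube.mem_nhds ?_))
  rw [hm, ← toC_mulVec]
  exact toC_mem_tube (I.ortho.fwd _ (massShell_subset_fwd hP (shellPoint_mem hP k)))

/-- Near each point of the complex manifold the regularized continuations converge to a holomorphic
function. -/
theorem exists_local_limit {P : ℝ} {hP : 0 < P} {σ : ℤˣ} {ψ : Hilb P} {S : Set Lorentz}
    (hS : IsOpen S) {F : Lorentz → ℂ → Hilb P} (hF : ∀ I ∈ S, WedgeOrbit hP σ I ψ (F I)) {C : NNReal}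
    (hC : ∀ I ∈ S, ∀ θ ∈ Ioo 0 Real.pi, ‖F I (imPt θ)‖ₑ ≤ C) {I₀ : Lorentz} (hI₀ : I₀ ∈ S)
    {p₀ : Mink} (hp₀ : p₀ ∈ massShell P) {θ₀ : ℝ} (hθ₀ : θ₀ ∈ Ioo 0 Real.pi) :
    ∃ U : Set MinkC, IsOpen U ∧ orbit I₀ (((σ : ℤ) : ℂ) * imPt θ₀) p₀ ∈ U ∧
      ∃ g : MinkC → ℂ, DifferentiableOn ℂ g U ∧ ∀ ζ ∈ U, form ζ ζ = (P : ℂ) →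
        ∃ I ∈ S, ∃ θ ∈ Ioo 0 Real.pi, ∃ p ∈ massShell P,
          ζ = orbit I (((σ : ℤ) : ℂ) * imPt θ) p ∧
          Tendsto (fun n => regFn P n (F I (imPt θ)) p) atTop (𝓝 (g ζ)) := by
  set q₀ := I₀.1⁻¹.mulVec p₀ with hq₀
  have hq₀m : q₀ ∈ massShell P := I₀.ortho_inv.massShell hP hp₀
  set k₀ : Fin 3 → ℝ := fun j => q₀ j.succ with hk₀
  have hkq : shellPoint P k₀ = q₀ := shellPoint_tail hP hq₀m
  have hp₀q : I₀.1.mulVec q₀ = p₀ := by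
    rw [hq₀, Matrix.mulVec_mulVec, I₀.mul_inv, Matrix.one_mulVec]
  set x₀ : Fin 3 → ℂ := fun j => (k₀ j : ℂ) with hx₀
  have him₀ : imT x₀ = 0 := by ext j; simp [imT, hx₀]
  have hre₀ : reT x₀ = k₀ := by ext j; simp [reT, hx₀]
  have hchart₀ : chart P σ θ₀ x₀ = x₀ := chart_real P σ θ₀ him₀
  have hcturn : Continuous fun x : Fin 3 → ℂ => turn I₀ (imT x) :=
    (continuous_turn I₀).comp continuous_imT
  have hcθ : Continuous fun x : Fin 3 → ℂ => θ₀ + imT x 2 :=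
    continuous_const.add ((continuous_apply 2).comp continuous_imT)
  have hcp : Continuous fun x : Fin 3 → ℂ => (turn I₀ (imT x)).1.mulVec (shellPoint P (reT x)) :=
    (continuous_subtype_val.comp hcturn).matrix_mulVec ((continuous_shellPoint P).comp continuous_reT)
  have e1 : ∀ᶠ x in 𝓝 x₀, turn I₀ (imT x) ∈ S :=
    hcturn.continuousAt.preimage_mem_nhds (hS.mem_nhds (by
      rw [him₀, turn_zero]; exact hI₀))
  have e2 : ∀ᶠ x in 𝓝 x₀, θ₀ + imT x 2 ∈ Ioo 0 Real.pi :=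
    hcθ.continuousAt.preimage_mem_nhds (isOpen_Ioo.mem_nhds (by
      rw [him₀, Pi.zero_apply, add_zero]; exact hθ₀))
  have e3 : ∀ᶠ x in 𝓝 x₀, 0 < (chartVec P σ θ₀ x 0).re := by
    have hc : Continuous fun x => (chartVec P σ θ₀ x 0).re :=
      Complex.continuous_re.comp ((continuous_apply 0).comp (continuous_chartVec σ θ₀))
    refine hc.continuousAt.eventually_const_lt ?_
    change 0 < (chartVec P σ θ₀ (fun j => (k₀ j : ℂ)) 0).re
    rw [chartVec_real, hkq]
    exact hq₀m.2
  have e4 : ∀ᶠ x in 𝓝 x₀, turn I₀ (imT x) ∈ S → ∀ b : ℝ, 0 < b →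
      pairing P (expVec P (toC (b • (turn I₀ (imT x)).1.mulVec (shellPoint P (reT x)))))
        (F (turn I₀ (imT x)) (imPt (θ₀ + imT x 2))) =
      pairing P (expVec P ((b : ℂ) • (I₀.1.map Complex.ofReal).mulVec (chartVec P σ θ₀ x)))
        (F I₀ (imPt θ₀)) := by
    have ht : Tendsto (fun x : Fin 3 → ℂ => (turn I₀ (imT x),
        (turn I₀ (imT x)).1.mulVec (shellPoint P (reT x)), θ₀ + imT x 2)) (𝓝 x₀)
        (𝓝 (I₀, p₀, θ₀)) := by
      have := (hcturn.prodMk (hcp.prodMk hcθ)).tendsto x₀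
      rwa [him₀, hre₀, turn_zero, Pi.zero_apply, add_zero, hkq, hp₀q] at this
    filter_upwards [ht.eventually (eventually_pairing_eq hF hI₀ (massShell_subset_fwd hP hp₀) hθ₀)]
      with x hx hxS b hb
    rw [map_chartVec]
    exact hx hxS b hb
  have heq : ∀ᶠ x in 𝓝 x₀, ∀ n, chartVal P I₀ (F I₀ (imPt θ₀)) n (chart P σ θ₀ x) =
      regFn P n (F (turn I₀ (imT x)) (imPt (θ₀ + imT x 2)))
        ((turn I₀ (imT x)).1.mulVec (shellPoint P (reT x))) := by
    filter_upwards [e1, e3, e4] with x h1 h3 h4 n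
    have h5 : shellPointC P (chart P σ θ₀ x) = chartVec P σ θ₀ x := by
      have := shellPointC_tail (chartVec_mem_massShellC hP σ θ₀ x) h3
      simp only [chartVec_succ] at this
      exact this
    rw [chartVal, regFn, h5, h4 h1 _ (by positivity)]
  have hcont : ∀ᶠ x in 𝓝 x₀, chart P σ θ₀ x ∈ chartDomain P I₀ := by
    have hc := (contDiff_chart hP σ θ₀).continuous.tendsto x₀
    rw [hchart₀] at hc
    exact hc.eventually (eventually_mem_chartDomain hP I₀ k₀)
  -- The imaginary parameters s turn the wedge (s₀, s₁) and shift the angle (s₂); the openness of S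
  -- keeps the turned wedges admissible. The set N records what must be known about the preimage of
  -- each point of the ball.
  obtain ⟨R, hR, hball, hlim⟩ := exists_tendsto_lintegral_ball hP (c := chart P σ θ₀) (x := x₀)
    (h := chartVal P I₀ (F I₀ (imPt θ₀)))
    (f := fun s => F (turn I₀ s) (imPt (θ₀ + s 2))) (A := fun s => (turn I₀ s).1)
    (contDiff_chart hP σ θ₀).contDiffAt (fderiv_chart_injective hP σ hθ₀ him₀)
    (fun s => (turn I₀ s).ortho) (C := C)
    (by filter_upwards [e1, e2] with x h1 h2 using hC _ h1 _ h2)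
    (by filter_upwards [hcont] with x hx n using (differentiableAt_chartVal hP I₀ _ n hx).continuousAt)
    heq (N := {x | (turn I₀ (imT x) ∈ S ∧ θ₀ + imT x 2 ∈ Ioo 0 Real.pi) ∧
      (0 < (chartVec P σ θ₀ x 0).re ∧ chart P σ θ₀ x ∈ chartDomain P I₀) ∧
      ∀ n, chartVal P I₀ (F I₀ (imPt θ₀)) n (chart P σ θ₀ x) =
        regFn P n (F (turn I₀ (imT x)) (imPt (θ₀ + imT x 2)))
          ((turn I₀ (imT x)).1.mulVec (shellPoint P (reT x)))})
    ((e1.and e2).and ((e3.and hcont).and heq))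
  rw [hchart₀] at hball hlim
  obtain ⟨g, hg, hglim⟩ := exists_holomorphic_limit hR (fun n y hy => by
    obtain ⟨x, hx, rfl⟩ := hball hy
    exact (differentiableAt_chartVal hP I₀ _ n hx.2.1.2).differentiableWithinAt) hlim
  -- Returns from ℂ⁴ to the frame of I₀ at angle θ₀. The limit is a function of the spatial
  -- components of Z alone and hence extends holomorphically off the mass shell; on the shell these
  -- components determine the point.
  set Z : MinkC → MinkC := fun ζ => (boostC (((σ : ℤ) : ℂ) * imPt θ₀)).mulVec
    ((I₀.1⁻¹.map Complex.ofReal).mulVec ζ) with hZ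
  have hZd : Differentiable ℂ Z := by
    intro ζ
    exact DifferentiableAt.comp (g := fun y : MinkC => (boostC (((σ : ℤ) : ℂ) * imPt θ₀)).mulVec y)
      (f := fun y : MinkC => (I₀.1⁻¹.map Complex.ofReal).mulVec y) ζ
      (differentiable_mulVecC _ _) (differentiable_mulVecC _ _)
  have hZt : Differentiable ℂ fun ζ => fun j : Fin 3 => Z ζ j.succ := by
    rw [differentiable_pi]
    intro j
    exact (differentiable_pi.1 hZd) j.succ
  have hZ0 : Z (orbit I₀ (((σ : ℤ) : ℂ) * imPt θ₀) p₀) = toC q₀ := by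
    rw [hZ]
    simp only
    rw [frame_orbit, Matrix.mulVec_mulVec, ← boostC_add, add_neg_cancel, boostC_zero,
      Matrix.one_mulVec]
  have hIZ : ∀ ζ, (I₀.1.map Complex.ofReal).mulVec (Z ζ) =
      (wedgeBoostC I₀ (((σ : ℤ) : ℂ) * imPt θ₀)).mulVec ζ := fun ζ => (frame_boost _ _ _).symm
  refine ⟨{ζ | 0 < (Z ζ 0).re} ∩ (fun ζ => fun j : Fin 3 => Z ζ j.succ) ⁻¹' Metric.ball x₀ (R / 4),
    ?_, ⟨?_, ?_⟩, fun ζ => g fun j : Fin 3 => Z ζ j.succ, ?_, ?_⟩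
  · refine IsOpen.inter ?_ (Metric.isOpen_ball.preimage hZt.continuous)
    exact isOpen_lt continuous_const
      (Complex.continuous_re.comp ((continuous_apply 0).comp hZd.continuous))
  · rw [mem_ofPred_eq, hZ0]
    exact hq₀m.2
  · rw [mem_preimage, hZ0]
    exact Metric.mem_ball_self (by positivity)
  · exact hg.comp hZt.differentiableOn fun ζ hζ => hζ.2
  · rintro ζ ⟨hζ0, hζ⟩ hζP
    rw [mem_ofPred_eq] at hζ0
    rw [mem_preimage] at hζ
    obtain ⟨x, ⟨⟨h1, h2⟩, ⟨h3, h4⟩, h5⟩, h6⟩ := hball (Metric.ball_subset_ball (by linarith) hζ)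
    have h7 : Z ζ = chartVec P σ θ₀ x := by
      have hf : form (Z ζ) (Z ζ) = (P : ℂ) := by
        rw [hZ]
        simp only
        rw [presForm_boostC, presForm_map I₀.ortho_inv.pres, hζP]
      rw [← shellPointC_tail hf hζ0, ← shellPointC_tail (chartVec_mem_massShellC hP σ θ₀ x) h3, ← h6]
      simp only [chartVec_succ]
    have h8 : ζ = orbit (turn I₀ (imT x)) (((σ : ℤ) : ℂ) * imPt (θ₀ + imT x 2))
        ((turn I₀ (imT x)).1.mulVec (shellPoint P (reT x))) := by
      have h9 : (wedgeBoostC I₀ (((σ : ℤ) : ℂ) * imPt θ₀)).mulVec ζ =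
          (wedgeBoostC I₀ (((σ : ℤ) : ℂ) * imPt θ₀)).mulVec
            (orbit (turn I₀ (imT x)) (((σ : ℤ) : ℂ) * imPt (θ₀ + imT x 2))
              ((turn I₀ (imT x)).1.mulVec (shellPoint P (reT x)))) := by
        rw [← hIZ, h7, map_chartVec]
      have h10 := congrArg (fun y => (wedgeBoostC I₀ (-(((σ : ℤ) : ℂ) * imPt θ₀))).mulVec y) h9
      simpa only [Matrix.mulVec_mulVec, ← wedgeBoostC_add, neg_add_cancel, wedgeBoostC_zero,
        Matrix.one_mulVec] using h10
    refine ⟨_, h1, _, h2, _, (turn I₀ (imT x)).ortho.massShell hP (shellPoint_mem hP _), h8, ?_⟩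
    have h9 := hglim _ hζ
    refine h9.congr fun n => ?_
    rw [← h5 n, h6]

/-! ### The holomorphic family of a localized vector -/

/-- The continuation of `ψ` along the orbits of a wedge that ends at the conjugate of `ψ`. -/
structure ModularOrbit {P : ℝ} (hP : 0 < P) (σ : ℤˣ) (I : Lorentz) (ψ : Hilb P) (F : ℂ → Hilb P) :
    Prop extends WedgeOrbit hP σ I ψ F where
  upper : F (Real.pi * Complex.I) = compOp hP (ortho_wedgeRot I) (star ψ)
  bound : ∀ z : ℂ, z.im ∈ Icc 0 Real.pi → ‖F z‖ ≤ ‖ψ‖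

section Family

variable {P : ℝ} {hP : 0 < P} {σ : ℤˣ}

/-- The strip orbit with its translation phase removed. Both edges have norm ‖φ‖, so the three lines
theorem bounds the orbit by ‖ψ‖ whatever the wedge; this uniformity in I later provides the
dominating constant. -/
lemma exists_modularOrbit {a : Mink} {I : Lorentz} {φ : Hilb P} (h : ModularMapsTo P σ a I φ φ) :
    ∃ F, ModularOrbit hP σ I (phaseOp P (-a) φ) F := by
  rw [modularMapsTo_iff hP] at h
  have hV := isoGroup_wedgeOp hP σ a I
  obtain ⟨G, hG⟩ := exists_stripOrbit hV h
  have h0 : G 0 = φ := by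
    have := hG.lower 0
    rwa [Complex.ofReal_zero, hV.zero] at this
  obtain ⟨B, hB⟩ := hG.bound
  refine ⟨fun z => phaseOp P (-a) (G z), ⟨⟨?_, ?_, fun z hz t => ?_⟩, ?_, fun z hz => ?_⟩⟩
  · exact (phaseOp P (-a)).toContinuousLinearMap.differentiable.comp_diffContOnCl hG.holo
  · simp only [h0]
  · simp only [hG.shift z hz t, wedgeOp_apply, phaseOp_apply_neg]
  · have := hG.upper 0
    rw [Complex.ofReal_zero, zero_add, hV.zero] at this
    simp only [this, wedgeConjOp, phaseOp_apply_neg]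
  · simp only [(phaseOp P (-a)).norm_map]
    refine norm_le_of_edges_of_bounded hG.holo (fun z hz => hB z ⟨hz.1.le, hz.2.le⟩)
      (fun t => ?_) (fun t => ?_) hz
    · rw [hG.lower, (wedgeOp hP σ a I t).norm_map]
    · rw [hG.upper, (wedgeOp hP σ a I t).norm_map, wedgeConjOp, (phaseOp P a).norm_map,
        (compOp hP _).norm_map, norm_star_hilb, (phaseOp P (-a)).norm_map]

lemma strip_eq_imPt_add (τ : ℂ) : τ = imPt τ.im + (τ.re : ℂ) :=
  Complex.ext (by simp [imPt]) (by simp [imPt])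

/-- In the frame of I the third component has imaginary part σ sin θ · q⁰ with q⁰ > 0. So the
complex manifold contains no real points, and values on ±Γ can be prescribed freely. -/
lemma orbit_im_ne_zero {I : Lorentz} {θ : ℝ} (hθ : θ ∈ Ioo 0 Real.pi) {p : Mink} (hp : p ∈ fwd) :
    imV (orbit I (((σ : ℤ) : ℂ) * imPt θ) p) ≠ 0 := by
  intro h
  have h1 : orbit I (((σ : ℤ) : ℂ) * imPt θ) p = toC (reV (orbit I (((σ : ℤ) : ℂ) * imPt θ) p)) := by
    ext j
    refine Complex.ext rfl ?_
    exact congrFun h j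
  have h2 := frame_orbit I (((σ : ℤ) : ℂ) * imPt θ) p
  rw [h1, ← toC_mulVec, boostC_neg_toC] at h2
  have h3 := congrArg Complex.im (congrFun h2 3)
  have hq := (I.ortho_inv.fwd _ hp).2
  have hs := Real.sin_pos_of_mem_Ioo hθ
  have hσ : ((σ : ℤ) : ℝ) ≠ 0 := fun h0 => by
    have := unit_sq σ
    rw [h0] at this
    norm_num at this
  simp [toC, -Complex.ofReal_mul, -Complex.ofReal_sin] at h3
  rcases h3 with h3 | h3
  · exact hs.ne' h3
  · exact hq.ne' h3

lemma regFn_eq_of_orbit_eq {ψ : Hilb P} {I I' : Lorentz} {F F' : ℂ → Hilb P}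
    (hF : WedgeOrbit hP σ I ψ F) (hF' : WedgeOrbit hP σ I' ψ F') {p p' : Mink} (hp : p ∈ fwd)
    (hp' : p' ∈ fwd) {θ θ' : ℝ} (hθ : θ ∈ Ioo 0 Real.pi) (hθ' : θ' ∈ Ioo 0 Real.pi)
    (h : orbit I (((σ : ℤ) : ℂ) * imPt θ) p = orbit I' (((σ : ℤ) : ℂ) * imPt θ') p') (n : ℕ) :
    regFn P n (F (imPt θ)) p = regFn P n (F' (imPt θ')) p' := by
  have hb : (0 : ℝ) < (n : ℝ) + 1 := by positivity
  rw [regFn, regFn, pairing_eq_of_orbit_eq hF hF' (smul_mem_fwd hb hp) (smul_mem_fwd hb hp') hθ hθ'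
    (by rw [orbit_smul, orbit_smul, h])]

variable {n : ℕ} {K : PolyhedralRegion n} {i : Fin n}

/-- The real part of τ is moved into the momentum, which leaves a purely imaginary parameter. -/
lemma exists_rep_of_mem (hP : 0 < P) {ζ : MinkC} (hζ : ζ ∈ cplxManifold P K σ i) :
    ∃ I ∈ interior (K.X i), ∃ θ ∈ Ioo 0 Real.pi, ∃ p ∈ massShell P,
      ζ = orbit I (((σ : ℤ) : ℂ) * imPt θ) p := by
  obtain ⟨-, p, hp, τ, hτ, I, hI, rfl⟩ := hζ
  have h1 : τ = ((σ : ℤ) : ℂ) * (((σ : ℤ) : ℂ) * τ) := by rw [← mul_assoc, unit_sqC, one_mul]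
  rw [h1, mem_openStrip_iff] at hτ
  refine ⟨I, hI, _, hτ, _, (ortho_wedgeBoost I (-(((σ : ℤ) : ℝ) *
    (((σ : ℤ) : ℂ) * τ).re))).massShell hP hp, ?_⟩
  rw [← orbit_shift, ← strip_eq_imPt_add, ← h1]

lemma toC_notMem_cplxManifold (hP : 0 < P) (q : Mink) : toC q ∉ cplxManifold P K σ i := by
  intro h
  obtain ⟨I, -, θ, hθ, p, hp, h1⟩ := exists_rep_of_mem hP h
  exact orbit_im_ne_zero (σ := σ) hθ (massShell_subset_fwd hP hp) (by rw [← h1]; rfl)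

/-- The limit of the regularized continuations is a holomorphic function on the complex manifold. -/
lemma exists_holomorphicOn_limit {ψ : Hilb P} {F : Lorentz → ℂ → Hilb P}
    (hF : ∀ I ∈ interior (K.X i), ModularOrbit hP σ I ψ (F I)) :
    ∃ v : MinkC → ℂ, HolomorphicOn v (cplxManifold P K σ i) ∧
      ∀ I ∈ interior (K.X i), ∀ θ ∈ Ioo 0 Real.pi, ∀ p ∈ massShell P,
        Tendsto (fun n => regFn P n (F I (imPt θ)) p) atTop
          (𝓝 (v (orbit I (((σ : ℤ) : ℂ) * imPt θ) p))) := by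
  have hW : ∀ I ∈ interior (K.X i), WedgeOrbit hP σ I ψ (F I) := fun I hI => (hF I hI).toWedgeOrbit
  have hC : ∀ I ∈ interior (K.X i), ∀ θ ∈ Ioo 0 Real.pi, ‖F I (imPt θ)‖ₑ ≤ (‖ψ‖₊ : ENNReal) := by
    intro I hI θ hθ
    have := (hF I hI).bound (imPt θ) (by rw [imPt_im]; exact ⟨hθ.1.le, hθ.2.le⟩)
    exact ENNReal.coe_le_coe.2 this
  have hloc := fun I₀ hI₀ θ₀ hθ₀ p₀ hp₀ => exists_local_limit (C := ‖ψ‖₊) isOpen_interior hW hC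
    (I₀ := I₀) hI₀ (p₀ := p₀) hp₀ (θ₀ := θ₀) hθ₀
  have hex : ∀ ζ : MinkC, ∃ c : ℂ, ζ ∈ cplxManifold P K σ i → ∀ I ∈ interior (K.X i),
      ∀ θ ∈ Ioo 0 Real.pi, ∀ p ∈ massShell P, ζ = orbit I (((σ : ℤ) : ℂ) * imPt θ) p →
        Tendsto (fun n => regFn P n (F I (imPt θ)) p) atTop (𝓝 c) := by
    intro ζ
    by_cases hζ : ζ ∈ cplxManifold P K σ i
    · obtain ⟨I₀, hI₀, θ₀, hθ₀, p₀, hp₀, h0⟩ := exists_rep_of_mem hP hζ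
      obtain ⟨U, -, hU, g, -, hg⟩ := hloc I₀ hI₀ θ₀ hθ₀ p₀ hp₀
      obtain ⟨I₁, hI₁, θ₁, hθ₁, p₁, hp₁, h1, hlim⟩ := hg ζ (by rw [h0]; exact hU) hζ.1
      -- The regularized values of any two representations of ζ coincide term by term, so a limit
      -- found along one representation is the limit along all.
      refine ⟨g ζ, fun _ I hI θ hθ p hp h => hlim.congr fun n => ?_⟩
      exact regFn_eq_of_orbit_eq (hW I₁ hI₁) (hW I hI) (massShell_subset_fwd hP hp₁)
        (massShell_subset_fwd hP hp) hθ₁ hθ (h1.symm.trans h) n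
    · exact ⟨0, fun h => absurd h hζ⟩
  choose v hv using hex
  have hmem : ∀ I ∈ interior (K.X i), ∀ θ ∈ Ioo 0 Real.pi, ∀ p ∈ massShell P,
      orbit I (((σ : ℤ) : ℂ) * imPt θ) p ∈ cplxManifold P K σ i := fun I hI θ hθ p hp =>
    orbit_mem_cplxManifold K σ i hI (by rw [strip, mem_preimage, imPt_im]; exact hθ) hp
  refine ⟨v, fun ζ hζ => ?_, fun I hI θ hθ p hp => hv _ (hmem I hI θ hθ p hp) I hI θ hθ p hp rfl⟩
  obtain ⟨I₀, hI₀, θ₀, hθ₀, p₀, hp₀, rfl⟩ := exists_rep_of_mem hP hζ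
  obtain ⟨U, hUo, hU, g, hgd, hg⟩ := hloc I₀ hI₀ θ₀ hθ₀ p₀ hp₀
  refine ⟨U, hUo, hU, g, hgd, fun η hη => ?_⟩
  obtain ⟨I₁, hI₁, θ₁, hθ₁, p₁, hp₁, h1, hlim⟩ := hg η hη.1 hη.2.1
  exact tendsto_nhds_unique (hv η hη.2 I₁ hI₁ θ₁ hθ₁ p₁ hp₁ h1) hlim

open Classical in
/-- The extension of a function on the complex manifold by `ψ` and its conjugate on the real
points. -/
def realExt (M : Set MinkC) (v : MinkC → ℂ) (ψ : Mink → ℂ) (ζ : MinkC) : ℂ :=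
  if ζ ∈ M then v ζ else if 0 < reV ζ 0 then ψ (reV ζ) else (starRingEnd ℂ) (ψ (-reV ζ))

lemma realExt_of_mem {M : Set MinkC} {v : MinkC → ℂ} {ψ : Mink → ℂ} {ζ : MinkC} (h : ζ ∈ M) :
    realExt M v ψ ζ = v ζ := if_pos h

lemma realExt_toC {v : MinkC → ℂ} {ψ : Mink → ℂ} {q : Mink} (hP : 0 < P) (hq : q ∈ massShell P) :
    realExt (cplxManifold P K σ i) v ψ (toC q) = ψ q := by
  rw [realExt, if_neg (toC_notMem_cplxManifold hP q), if_pos (by exact hq.2), reV_toC]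

lemma realExt_neg_toC {v : MinkC → ℂ} {ψ : Mink → ℂ} {q : Mink} (hP : 0 < P)
    (hq : q ∈ massShell P) :
    realExt (cplxManifold P K σ i) v ψ (-toC q) = (starRingEnd ℂ) (ψ q) := by
  have h : -toC q = toC (-q) := by ext j; simp [toC]
  have hq0 : 0 < q 0 := hq.2
  rw [h, realExt, if_neg (toC_notMem_cplxManifold hP _), if_neg ?_, reV_toC, neg_neg]
  rw [reV_toC, Pi.neg_apply]
  linarith

/-- Inside the strip the regularizations converge to v at every point and, along a subsequence,
almost everywhere to the L² vector; on the edges the values are those prescribed on ±Γ. Equivariance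
carries the result from imaginary parameters to all of the closed strip. -/
lemma orbit_value_ae {ψ : Hilb P} {F : Lorentz → ℂ → Hilb P}
    (hF : ∀ I ∈ interior (K.X i), ModularOrbit hP σ I ψ (F I)) {v : MinkC → ℂ}
    (hv : ∀ I ∈ interior (K.X i), ∀ θ ∈ Ioo 0 Real.pi, ∀ p ∈ massShell P,
      Tendsto (fun n => regFn P n (F I (imPt θ)) p) atTop
        (𝓝 (v (orbit I (((σ : ℤ) : ℂ) * imPt θ) p)))) {I : Lorentz} (hI : I ∈ interior (K.X i))
    {τ : ℂ} (hτ : τ.im ∈ Icc 0 Real.pi) :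
    ∀ᵐ p ∂(shellMeasure P), realExt (cplxManifold P K σ i) v ψ (orbit I (((σ : ℤ) : ℂ) * τ) p) =
      F I τ p := by
  have hFI := hF I hI
  have key : ∀ θ ∈ Icc 0 Real.pi, ∀ᵐ p ∂(shellMeasure P),
      realExt (cplxManifold P K σ i) v ψ (orbit I (((σ : ℤ) : ℂ) * imPt θ) p) =
        F I (imPt θ) p := by
    intro θ hθ
    rcases eq_or_lt_of_le hθ.1 with h0 | h0
    · subst h0
      filter_upwards [ae_mem_massShell hP] with p hp
      have := orbit_lower σ I 0 p
      simp only [Complex.ofReal_zero, mul_zero, neg_zero, wedgeBoost_zero, Matrix.one_mulVec] at this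
      rw [imPt_zero, mul_zero, this, realExt_toC hP hp, hFI.lower]
    rcases eq_or_lt_of_le hθ.2 with h1 | h1
    · subst h1
      have hr := ortho_wedgeRot I
      filter_upwards [ae_mem_massShell hP, coeFn_compOp hP hr (star ψ),
        ae_comp hP hr (Lp.coeFn_star ψ)] with p hp h2 h3
      have := orbit_upper σ I 0 p
      simp only [Complex.ofReal_zero, mul_zero, neg_zero, wedgeBoost_zero, Matrix.one_mulVec,
        zero_add] at this
      rw [imPt, this, realExt_neg_toC hP (hr.massShell hP hp), hFI.upper, h2, h3]
      rfl
    · have hs : imPt θ ∈ strip := by rw [strip, mem_preimage, imPt_im]; exact ⟨h0, h1⟩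
      obtain ⟨ns, hns, hlim⟩ :=
        (tendstoInMeasure_of_tendsto_Lp (tendsto_reg hP (F I (imPt θ)))).exists_seq_tendsto_ae
      filter_upwards [ae_mem_massShell hP, hlim,
        ae_all_iff.2 fun n => coeFn_reg hP n (F I (imPt θ))] with p hp h2 h3
      rw [realExt_of_mem (orbit_mem_cplxManifold K σ i hI hs hp)]
      have h4 := (hv I hI θ ⟨h0, h1⟩ p hp).comp hns.tendsto_atTop
      refine tendsto_nhds_unique h4 (h2.congr fun k => ?_)
      exact h3 _
  have hA := ortho_wedgeBoost I (-(((σ : ℤ) : ℝ) * τ.re))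
  have hsh := hFI.shift (imPt τ.im) (by rwa [imPt_im]) τ.re
  rw [← strip_eq_imPt_add] at hsh
  rw [hsh]
  filter_upwards [ae_comp hP hA (key τ.im hτ), coeFn_compOp hP hA (F I (imPt τ.im))] with p h1 h2
  rw [h2, ← h1, ← orbit_shift, ← strip_eq_imPt_add]

/-- A vector that is invariant under the modular operators is the boundary value of a holomorphic
family with the boundary condition. -/
lemma exists_isBoundaryValue (hP : 0 < P) {φ : Hilb P}
    (hφ : ∀ I ∈ K.X i, ModularMapsTo P σ (K.vertex i) I φ φ) :
    ∃ u, IsBoundaryValue P K σ i u φ ∧ BoundaryCondition P K i u := by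
  set a := K.vertex i with ha
  set ψ := phaseOp P (-a) φ with hψ
  have hex : ∀ I : Lorentz, ∃ F, I ∈ interior (K.X i) → ModularOrbit hP σ I ψ F := by
    intro I
    by_cases hI : I ∈ interior (K.X i)
    · obtain ⟨F, hF⟩ := exists_modularOrbit (hP := hP) (hφ I (interior_subset hI))
      exact ⟨F, fun _ => hF⟩
    · exact ⟨fun _ => 0, fun h => absurd h hI⟩
  choose F hF using hex
  obtain ⟨v, hvh, hv⟩ := exists_holomorphicOn_limit hF
  have hval := fun I (hI : I ∈ interior (K.X i)) τ hτ =>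
    orbit_value_ae (ψ := ψ) hF hv hI (τ := τ) hτ
  have hscale : ∀ τ, τ ∈ closedStrip σ → (((σ : ℤ) : ℂ) * τ).im ∈ Icc 0 Real.pi ∧
      ((σ : ℤ) : ℂ) * (((σ : ℤ) : ℂ) * τ) = τ := by
    intro τ hτ
    have h1 : ((σ : ℤ) : ℂ) * (((σ : ℤ) : ℂ) * τ) = τ := by rw [← mul_assoc, unit_sqC, one_mul]
    exact ⟨by rwa [← mem_closedStrip_iff, h1], h1⟩
  have hae : ∀ I ∈ interior (K.X i), ∀ Φ : SchwartzMap Mink ℂ, ∀ τ ∈ closedStrip σ,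
      ∀ᵐ p ∂(shellMeasure P), phase a p * realExt (cplxManifold P K σ i) v ψ (orbit I τ p) * Φ p =
        F I (((σ : ℤ) : ℂ) * τ) p * (phase a p * Φ p) := by
    intro I hI Φ τ hτ
    obtain ⟨h1, h2⟩ := hscale τ hτ
    filter_upwards [hval I hI _ h1] with p hp
    rw [h2] at hp
    rw [hp]
    ring
  have htemp := hasTemperateGrowth_shellMeasure hP
  have hphase : ∀ Φ : SchwartzMap Mink ℂ, ∃ g : Hilb P, g =ᵐ[shellMeasure P]
      fun p => phase a p * Φ p := by
    intro Φ
    obtain ⟨Φ', hΦ'⟩ := exists_schwartz_phase a Φ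
    refine ⟨(Φ'.memLp 2 (shellMeasure P)).toLp _, ?_⟩
    filter_upwards [(Φ'.memLp 2 (shellMeasure P)).coeFn_toLp] with p hp
    rw [hp, hΦ']
  -- The phase e^{i{p,a}} restores the translation removed in ψ and is the only dependence on the
  -- reference momentum, whence the phase rule.
  refine ⟨fun p ζ => phase a p * realExt (cplxManifold P K σ i) v ψ ζ,
    ⟨fun p _ ζ hζ => ?_, fun p _ q _ ζ _ => ?_, fun I hI Φ τ hτ => ?_, fun I hI Φ => ?_, ?_⟩,
    fun I _ => ?_⟩
  · obtain ⟨U, hU, hζU, g, hg, hgv⟩ := hvh ζ hζ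
    refine ⟨U, hU, hζU, fun η => phase a p * g η, hg.const_mul _, fun η hη => ?_⟩
    simp only
    rw [realExt_of_mem hη.2, hgv hη]
  · change phase a p * _ = phase a (p - q) * (phase a q * _)
    rw [phase_sub_left, ← mul_assoc, mul_assoc (phase a p), mul_comm (phase (-a) q), phase_mul_neg,
      mul_one]
  · obtain ⟨g, hg⟩ := hphase Φ
    refine (integrable_mul_hilb (F I (((σ : ℤ) : ℂ) * τ)) g).congr ?_
    filter_upwards [hae I hI Φ τ hτ, hg] with p h1 h2
    rw [h1, h2]
  · obtain ⟨g, hg⟩ := hphase Φ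
    have h1 : ContinuousOn (fun τ : ℂ => pairing P (F I (((σ : ℤ) : ℂ) * τ)) g) (closedStrip σ) := by
      refine ((pairing P).flip g).continuous.comp_continuousOn
        ((hF I hI).toWedgeOrbit.continuousOn.comp (Continuous.continuousOn (by fun_prop))
          fun τ hτ => (hscale τ hτ).1)
    refine h1.congr fun τ hτ => ?_
    simp only [pairing_apply]
    refine integral_congr_ae ?_
    filter_upwards [hae I hI Φ τ hτ, hg] with p h1 h2
    rw [h1, h2]
  · filter_upwards [ae_mem_massShell hP, coeFn_phaseOp P (-a) φ] with p hp h1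
    rw [realExt_toC hP hp, hψ, h1, ← mul_assoc, phase_mul_neg, one_mul]
  -- The condition is built into the values chosen on -Γ and holds for every wedge. That these
  -- values are the actual boundary values at iπ was settled through F_I(iπ) in `orbit_value_ae`.
  · filter_upwards [ae_mem_massShell hP] with p hp ξ hξ
    have hm : ξ ∈ massShell P := hξ ▸ (ortho_wedgeRot I).massShell hP hp
    change _ = phase a p * phase a ξ * (starRingEnd ℂ) _
    rw [realExt_toC hP hm, realExt_neg_toC hP hm, map_mul, conj_phase, mul_assoc, ← mul_assoc
      (phase a ξ), phase_mul_neg, one_mul]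

end Family

end WignerLoc

end

theorem proposition2p0 (P : ℝ) (hP : 0 < P) (n : ℕ) (K : WignerLoc.PolyhedralRegion n)
    (σ : ℤˣ) :
    WignerLoc.localizedSubspace P K σ =
      {φ : WignerLoc.Hilb P | ∀ i : Fin n, ∃ u : WignerLoc.Mink → WignerLoc.MinkC → ℂ,
        WignerLoc.IsBoundaryValue P K σ i u φ ∧ WignerLoc.BoundaryCondition P K i u} := by
  ext φ
  constructor
  · intro h i
    exact WignerLoc.exists_isBoundaryValue hP (h i)
  · intro h i I hI
    obtain ⟨u, hu, hbc⟩ := h i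
    exact WignerLoc.modularMapsTo_of_isBoundaryValue hP hu hbc hI
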